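/- **Setting.** Let $n\in\{6,7,8\}$ and let $x=(x_1,\dots,x_n)$ be coordinates of $\mathbb C^n$ with the weights $w_1,\dots,w_n$ given below ($w_n=1$). Let $z$ be the algebraic function of $x$ defined by $v-x_{n-1}+z^2=0$, where $v=v(x_1,\dots,x_{n-2})$ is given below, and let $F$ be the algebraic potential of type $E_n(1)$ given below as a polynomial in $x$ and $z$ (the $x_i$ are its flat coordinates). Put $P=(\partial_{x_n}F,\partial_{x_{n-1}}F,\dots,\partial_{x_1}F)$, let $C$ be the $n\times n$ matrix with entries $C_{ij}=\partial_{x_i}P_j$, let $E=\sum_{j}w_jx_j\partial_{x_j}$, $T=EC$ (entrywise) and $\Delta_{E_n(1)}=\det T$. Using $x_{n-1}=z^2+v$, $\Delta_{E_n(1)}$ is regarded as a polynomial in $x_1,\dots,x_{n-2},z,x_n$. The family $\mathcal F_{E_n(1)}$ consists of the hypersurfaces $z^2=f_{E_n(1)}(x,y)$ in $\mathbb C^3$ with the parameters $(t,s)\in\mathbb C^n$ given below. The discriminant of the family is the reduced (squarefree) polynomial in $(t,s)$ whose zero set is the set of parameters for which the hypersurface has a singular point; it is unique up to a non-zero constant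 factor. **Theorem.** For each $n\in\{6,7,8\}$: $\mathcal F_{E_n(1)}$ is a deformation of the simple singularity of type $E_n$, that is, at $(t,s)=0$ it is $z^2=y^3+x^4$ ($n=6$), $z^2=y^3+x^3y$ ($n=7$), $z^2=y^3+x^5$ ($n=8$). The discriminant of the family exists, and $\Delta_{E_n(1)}$ is indeed a polynomial in $x_1,\dots,x_{n-2},z,x_n$. For every constant $c\in\mathbb C$ satisfying the equation below, the formulas below define a coordinate transformation (a bijective polynomial map $\mathbb C^n\to\mathbb C^n$) from $(t,s)$ to $(x_1,\dots,x_{n-2},z,x_n)$, under which $$t_9\,\Delta_{E_6(1)}\ (n=6),\qquad t_7\,\Delta_{E_7(1)}\ (n=7),\qquad t_{12}\,\Delta_{E_8(1)}\ (n=8)$$ coincides with the discriminant of $\mathcal F_{E_n(1)}$ up to a non-zero constant factor. **Data for $n=6$.** Weights: $(w_1, w_2, w_3, w_4, w_5, w_6)=(2/9, 1/3, 5/9, 2/3, 8/9, 1)$. $$f_{E_6(1)}(x,y)=y^3+t_9x+t_6x^2+t_3x^3+x^4+y(t_5x+t_2x^2)+s_4y^2$$ $$v=-9x_1^4 -12x_1x_2^2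 +2x_2x_3 +2x_1x_4$$ $$F=x_3x_4x_6 +x_2x_5x_6 +\tfrac{1}{2}x_1x_6^2 +\tfrac{2106}{5}x_1^{10} +\tfrac{8100}{7}x_1^7x_2^2 +348x_1^4x_2^4 +\tfrac{104}{3}x_1x_2^6 +54x_1^6x_2x_3 -84x_1^3x_2^3x_3 -\tfrac{44}{5}x_2^5x_3 +\tfrac{648}{5}x_1^5x_3^2 +27x_1^2x_2^2x_3^2 +6x_1x_2x_3^3 +\tfrac{3}{8}x_3^4 +54x_1^7x_4 -180x_1^4x_2^2x_4 -20x_1x_2^4x_4 +126x_1^3x_2x_3x_4 +4x_2^3x_3x_4 +18x_1^2x_3^2x_4 +27x_1^4x_4^2 +10x_1x_2^2x_4^2 +x_2x_3x_4^2 +\tfrac{5}{3}x_1x_4^3 -27x_1^6x_5 +90x_1^3x_2^2x_5 +6x_2^4x_5 -27x_1^2x_2x_3x_5 +\tfrac{9}{2}x_1x_3^2x_5 +9x_1^3x_4x_5 -4x_2^2x_4x_5 +\tfrac{1}{2}x_4^2x_5 +\tfrac{9}{4}x_1^2x_5^2 +\tfrac{2}{5}z^5$$ Coordinate transformation, with $c^9=\tfrac{4}{2187}$: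 $$x_1=\frac{c^{5}}{4}\left(-9t_2\right)$$ $$x_2=\frac{c^{3}}{4}\left(3t_3\right)$$ $$x_3=\frac{c^{8}}{8}\left(-189t_2t_3 +486t_5\right)$$ $$x_4=\frac{c^{6}}{16}\left(108t_2s_4 -11t_2^3 +99t_3^2 -324t_6\right)$$ $$z=c\left(s_4\right)$$ $$x_6=\frac{1}{5832}\left(540t_2t_3s_4 -1944t_5s_4 -115t_2^3t_3 +270t_2^2t_5 +345t_3^3 -1620t_3t_6 +5832t_9\right)$$ **Data for $n=7$.** Weights: $(w_1, w_2, w_3, w_4, w_5, w_6, w_7)=(1/7, 2/7, 3/7, 4/7, 5/7, 6/7, 1)$. $$f_{E_7(1)}(x,y)=y^3+t_7x+t_5x^2+t_3x^3+t_1x^4+x^3y+y(t_4x+t_2x^2)+s_3y^2$$ $$v=-36x_1^6 -36x_1^4x_2 +12x_1^3x_3 -231x_1^2x_2^2 -6x_1^2x_4 -84x_1x_2x_3 -x_1x_5 -49x_2^3 -7x_2x_4 -7x_3^2$$ $$F=\tfrac{1}{2}x_1x_7^2 +\tfrac{1}{2}x_4^2x_7 +x_3x_5x_7 +x_2x_6x_7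 +\tfrac{3939238656}{1092455}x_1^{15} -\tfrac{10368}{7}x_1^{13}x_2 +\tfrac{3456}{7}x_1^{12}x_3 +\tfrac{18166464}{539}x_1^{11}x_2^2 -\tfrac{1728}{7}x_1^{11}x_4 -\tfrac{19008}{7}x_1^{10}x_2x_3 -\tfrac{288}{7}x_1^{10}x_5 +\tfrac{216576}{7}x_1^9x_2^3 +\tfrac{643392}{49}x_1^9x_3^2 -\tfrac{4608}{7}x_1^9x_2x_4 -\tfrac{288}{7}x_1^9x_6 -\tfrac{1728}{7}x_1^8x_2^2x_3 +\tfrac{864}{7}x_1^8x_3x_4 -\tfrac{432}{7}x_1^8x_2x_5 +60264x_1^7x_2^4 -\tfrac{115776}{7}x_1^7x_2x_3^2 +\tfrac{72360}{343}x_1^7x_4^2 +3024x_1^7x_2^2x_4 +\tfrac{144}{7}x_1^7x_3x_5 -\tfrac{432}{7}x_1^7x_2x_6 +\tfrac{42528}{7}x_1^6x_3^3 +19152x_1^6x_2^3x_3 +\tfrac{36864}{7}x_1^6x_2x_3x_4 +576x_1^6x_2^2x_5 -\tfrac{72}{7}x_1^6x_4x_5 +\tfrac{144}{7}x_1^6x_3x_6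 +\tfrac{252252}{5}x_1^5x_2^5 +18216x_1^5x_2^2x_3^2 +\tfrac{2844}{7}x_1^5x_2x_4^2 +\tfrac{942}{245}x_1^5x_5^2 +4824x_1^5x_2^3x_4 -\tfrac{10944}{7}x_1^5x_3^2x_4 +360x_1^5x_2x_3x_5 +576x_1^5x_2^2x_6 -\tfrac{72}{7}x_1^5x_4x_6 -7008x_1^4x_2x_3^3 +\tfrac{36}{7}x_1^4x_3x_4^2 +23940x_1^4x_2^4x_3 +1728x_1^4x_2^2x_3x_4 +420x_1^4x_2^3x_5 +\tfrac{1632}{7}x_1^4x_3^2x_5 +\tfrac{456}{7}x_1^4x_2x_4x_5 +360x_1^4x_2x_3x_6 -\tfrac{12}{7}x_1^4x_5x_6 +38220x_1^3x_2^6 +3032x_1^3x_3^4 -\tfrac{102}{7}x_1^3x_4^3 +4116x_1^3x_2^3x_3^2 +444x_1^3x_2^2x_4^2 -\tfrac{27}{7}x_1^3x_2x_5^2 +\tfrac{54}{49}x_1^3x_6^2 +5082x_1^3x_2^4x_4 +264x_1^3x_2x_3^2x_4 +156x_1^3x_2^2x_3x_5 -\tfrac{276}{7}x_1^3x_3x_4x_5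 +420x_1^3x_2^3x_6 +48x_1^3x_3^2x_6 +24x_1^3x_2x_4x_6 +1988x_1^2x_2^2x_3^3 -150x_1^2x_2x_3x_4^2 +\tfrac{25}{7}x_1^2x_3x_5^2 +24402x_1^2x_2^5x_3 -544x_1^2x_3^3x_4 +2436x_1^2x_2^3x_3x_4 +357x_1^2x_2^4x_5 -156x_1^2x_2x_3^2x_5 -\tfrac{3}{7}x_1^2x_4^2x_5 +48x_1^2x_2^2x_4x_5 +84x_1^2x_2^2x_3x_6 +\tfrac{156}{7}x_1^2x_3x_4x_6 -\tfrac{6}{7}x_1^2x_2x_5x_6 +5439x_1x_2^7 -812x_1x_2x_3^4 -6x_1x_2x_4^3 +6468x_1x_2^4x_3^2 +147x_1x_2^3x_4^2 +54x_1x_3^2x_4^2 +\tfrac{5}{2}x_1x_2^2x_5^2 -\tfrac{5}{14}x_1x_4x_5^2 +\tfrac{9}{7}x_1x_2x_6^2 +1764x_1x_2^5x_4 +42x_1x_2^2x_3^2x_4 +\tfrac{160}{3}x_1x_3^3x_5 +140x_1x_2^3x_3x_5 +20x_1x_2x_3x_4x_5 +294x_1x_2^4x_6 -12x_1x_2x_3^2x_6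 +\tfrac{9}{7}x_1x_4^2x_6 +36x_1x_2^2x_4x_6 -\tfrac{10}{7}x_1x_3x_5x_6 +\tfrac{1484}{15}x_3^5 +\tfrac{1666}{3}x_2^3x_3^3 +x_3x_4^3 +\tfrac{1}{84}x_5^3 +7x_2^2x_3x_4^2 -\tfrac{1}{2}x_2x_3x_5^2 +\tfrac{1}{7}x_3x_6^2 +1029x_2^6x_3 +\tfrac{364}{3}x_2x_3^3x_4 +392x_2^4x_3x_4 +\tfrac{49}{5}x_2^5x_5 +21x_2^2x_3^2x_5 -\tfrac{1}{2}x_2x_4^2x_5 +7x_2^3x_4x_5 -6x_3^2x_4x_5 -\tfrac{20}{3}x_3^3x_6 +84x_2^3x_3x_6 +8x_2x_3x_4x_6 +2x_2^2x_5x_6 +\tfrac{1}{7}x_4x_5x_6 +\tfrac{8}{105}z^5$$ Coordinate transformation, with $c^7=\tfrac{1}{14112}$: $$x_1=c^{2}\left(-3t_1\right)$$ $$x_2=\frac{c^{4}}{7}\left(-117t_1^2 -84t_2\right)$$ $$x_3=\frac{c^{6}}{7}\left(-1176s_3 -4743t_1^3 -4284t_1t_2 +3528t_3\right)$$ $$x_4=\frac{c}{64}\left(-32t_1s_3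 -105t_1^4 -120t_1^2t_2 +96t_1t_3 -16t_2^2 +64t_4\right)$$ $$x_5=\frac{c^{3}}{10976}\left(-646800t_1^2s_3 +65856t_2s_3 -1757745t_1^5 -2448600t_1^3t_2 +1940400t_1^2t_3 -646800t_1t_2^2 +724416t_1t_4 +724416t_2t_3 -921984t_5\right)$$ $$z=c^{6}\left(-2352s_3\right)$$ $$x_7=\frac{1}{843308032}\left(32269440t_1s_3^2 -747369560t_1^4s_3 -481736640t_1^2t_2s_3 +408746240t_1t_3s_3 +32269440t_2^2s_3 -180708864t_4s_3 -1498061973t_1^7 -2850681036t_1^5t_2 +2242108680t_1^4t_3 -1494739120t_1^3t_2^2 +686109760t_1^3t_4 +2058329280t_1^2t_2t_3 -613119360t_1^2t_5 -160578880t_1t_2^3 +408746240t_1t_2t_4 -613119360t_1t_3^2 +204373120t_2^2t_3 -301181440t_2t_5 -301181440t_3t_4 +843308032t_7\right)$$ **Data for $n=8$.** Weights: $(w_1, w_2, w_3, w_4, w_5, w_6, w_7, w_8)=(1/12, 1/4, 1/3, 1/2, 7/12, 3/4, 5/6, 1)$. $$f_{E_8(1)}(x,y)=y^3+t_{12}x+t_9x^2+t_6x^3+t_3x^4+x^5+y(t_7x+t_4x^2+t_1x^3)+s_5y^2$$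 $$v=-x_1^{10} +5x_1^7x_2 +\tfrac{1}{2}x_1^6x_3 -78x_1^4x_2^2 +2x_1^4x_4 +20x_1^3x_2x_3 -x_1^3x_5 -\tfrac{3}{2}x_1^2x_3^2 +88x_1x_2^3 -24x_1x_2x_4 +2x_1x_6 -12x_2^2x_3 +2x_2x_5 +2x_3x_4$$ $$F=\tfrac{1}{2}x_1x_8^2 +x_4x_5x_8 +x_3x_6x_8 +x_2x_7x_8 +\tfrac{472561}{883200}x_1^{25} +\tfrac{5}{6}x_1^{22}x_2 +\tfrac{1}{12}x_1^{21}x_3 +\tfrac{14781}{304}x_1^{19}x_2^2 +\tfrac{1}{3}x_1^{19}x_4 +\tfrac{65}{24}x_1^{18}x_2x_3 -\tfrac{1}{6}x_1^{18}x_5 +\tfrac{6255}{1088}x_1^{17}x_3^2 -\tfrac{1225}{6}x_1^{16}x_2^3 -\tfrac{13}{2}x_1^{16}x_2x_4 +\tfrac{1}{3}x_1^{16}x_6 +\tfrac{415}{8}x_1^{15}x_2^2x_3 +\tfrac{1}{12}x_1^{15}x_3x_4 +\tfrac{19}{12}x_1^{15}x_2x_5 -\tfrac{1}{6}x_1^{15}x_7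 +\tfrac{269}{8}x_1^{14}x_2x_3^2 +\tfrac{1}{8}x_1^{14}x_3x_5 +\tfrac{14879}{12}x_1^{13}x_2^4 +\tfrac{565}{96}x_1^{13}x_3^3 +\tfrac{2135}{104}x_1^{13}x_4^2 -19x_1^{13}x_2^2x_4 -\tfrac{5}{2}x_1^{13}x_2x_6 -\tfrac{766}{3}x_1^{12}x_2^3x_3 +\tfrac{329}{4}x_1^{12}x_2x_3x_4 +22x_1^{12}x_2^2x_5 +\tfrac{1}{2}x_1^{12}x_4x_5 -\tfrac{1}{4}x_1^{12}x_3x_6 +\tfrac{5}{4}x_1^{12}x_2x_7 +150x_1^{11}x_2^2x_3^2 +\tfrac{199}{352}x_1^{11}x_5^2 +\tfrac{373}{16}x_1^{11}x_3^2x_4 -\tfrac{43}{4}x_1^{11}x_2x_3x_5 +\tfrac{1}{8}x_1^{11}x_3x_7 -\tfrac{21216}{5}x_1^{10}x_2^5 +\tfrac{1583}{48}x_1^{10}x_2x_3^3 -\tfrac{95}{2}x_1^{10}x_2x_4^2 +\tfrac{1727}{3}x_1^{10}x_2^3x_4 +\tfrac{109}{32}x_1^{10}x_3^2x_5 -49x_1^{10}x_2^2x_6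 -x_1^{10}x_4x_6 +\tfrac{1559}{192}x_1^9x_3^4 +\tfrac{59}{2}x_1^9x_3x_4^2 +\tfrac{10795}{6}x_1^9x_2^4x_3 -\tfrac{239}{2}x_1^9x_2^2x_3x_4 -\tfrac{743}{6}x_1^9x_2^3x_5 +\tfrac{105}{2}x_1^9x_2x_4x_5 +21x_1^9x_2x_3x_6 +\tfrac{1}{2}x_1^9x_5x_6 +\tfrac{49}{2}x_1^9x_2^2x_7 +\tfrac{1}{2}x_1^9x_4x_7 -233x_1^8x_2^3x_3^2 -\tfrac{7}{8}x_1^8x_2x_5^2 +\tfrac{429}{4}x_1^8x_2x_3^2x_4 +\tfrac{207}{4}x_1^8x_2^2x_3x_5 +\tfrac{21}{2}x_1^8x_3x_4x_5 -\tfrac{7}{4}x_1^8x_3^2x_6 -\tfrac{21}{2}x_1^8x_2x_3x_7 -\tfrac{1}{4}x_1^8x_5x_7 +\tfrac{32150}{3}x_1^7x_2^6 +\tfrac{189}{2}x_1^7x_2^2x_3^3 +\tfrac{163}{6}x_1^7x_4^3 +442x_1^7x_2^2x_4^2 +\tfrac{7}{8}x_1^7x_3x_5^2 +\tfrac{67}{28}x_1^7x_6^2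 -2491x_1^7x_2^4x_4 +\tfrac{637}{24}x_1^7x_3^3x_4 +\tfrac{103}{8}x_1^7x_2x_3^2x_5 +\tfrac{584}{3}x_1^7x_2^3x_6 -26x_1^7x_2x_4x_6 +\tfrac{7}{8}x_1^7x_3^2x_7 +\tfrac{475}{24}x_1^6x_2x_3^4 +\tfrac{307}{2}x_1^6x_2x_3x_4^2 -5607x_1^6x_2^5x_3 +\tfrac{3446}{3}x_1^6x_2^3x_3x_4 +\tfrac{2659}{6}x_1^6x_2^4x_5 +\tfrac{131}{48}x_1^6x_3^3x_5 -\tfrac{1}{4}x_1^6x_4^2x_5 -96x_1^6x_2^2x_4x_5 -48x_1^6x_2^2x_3x_6 +\tfrac{39}{2}x_1^6x_3x_4x_6 +\tfrac{9}{2}x_1^6x_2x_5x_6 -\tfrac{292}{3}x_1^6x_2^3x_7 +13x_1^6x_2x_4x_7 +\tfrac{1}{2}x_1^6x_6x_7 +\tfrac{419}{160}x_1^5x_3^5 +\tfrac{2737}{2}x_1^5x_2^4x_3^2 +\tfrac{195}{4}x_1^5x_3^2x_4^2 +\tfrac{51}{4}x_1^5x_2^2x_5^2 +\tfrac{19}{8}x_1^5x_4x_5^2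 +\tfrac{17}{80}x_1^5x_7^2 +9x_1^5x_2^2x_3^2x_4 -147x_1^5x_2^3x_3x_5 +33x_1^5x_2x_3x_4x_5 +\tfrac{9}{2}x_1^5x_2x_3^2x_6 +\tfrac{13}{4}x_1^5x_3x_5x_6 +24x_1^5x_2^2x_3x_7 -3x_1^5x_3x_4x_7 -\tfrac{26144}{3}x_1^4x_2^7 -\tfrac{400}{3}x_1^4x_2^3x_3^3 -\tfrac{64}{3}x_1^4x_2x_4^3 -\tfrac{1}{48}x_1^4x_5^3 -640x_1^4x_2^3x_4^2 +\tfrac{13}{8}x_1^4x_2x_3x_5^2 +8x_1^4x_2x_6^2 +4956x_1^4x_2^5x_4 +65x_1^4x_2x_3^3x_4 +30x_1^4x_2^2x_3^2x_5 +\tfrac{51}{4}x_1^4x_3^2x_4x_5 -470x_1^4x_2^4x_6 +\tfrac{29}{12}x_1^4x_3^3x_6 +14x_1^4x_4^2x_6 +122x_1^4x_2^2x_4x_6 +\tfrac{5}{8}x_1^4x_3x_5x_7 +\tfrac{185}{8}x_1^3x_2^2x_3^4 +\tfrac{86}{3}x_1^3x_3x_4^3 +190x_1^3x_2^2x_3x_4^2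 +x_1^3x_3^2x_5^2 +\tfrac{7}{2}x_1^3x_3x_6^2 +\tfrac{10672}{3}x_1^3x_2^6x_3 +\tfrac{383}{48}x_1^3x_3^4x_4 -1900x_1^3x_2^4x_3x_4 -452x_1^3x_2^5x_5 +\tfrac{41}{12}x_1^3x_2x_3^3x_5 +34x_1^3x_2x_4^2x_5 +198x_1^3x_2^3x_4x_5 +162x_1^3x_2^3x_3x_6 +18x_1^3x_2x_3x_4x_6 -15x_1^3x_2^2x_5x_6 +4x_1^3x_4x_5x_6 +220x_1^3x_2^4x_7 -\tfrac{1}{12}x_1^3x_3^3x_7 +\tfrac{13}{2}x_1^3x_4^2x_7 -43x_1^3x_2^2x_4x_7 +x_1^3x_2x_6x_7 +\tfrac{25}{16}x_1^2x_2x_3^5 -492x_1^2x_2^5x_3^2 +36x_1^2x_2x_3^2x_4^2 -9x_1^2x_2^3x_5^2 -x_1^2x_2x_7^2 +302x_1^2x_2^3x_3^2x_4 +\tfrac{25}{32}x_1^2x_3^4x_5 +\tfrac{27}{2}x_1^2x_3x_4^2x_5 +124x_1^2x_2^4x_3x_5 -3x_1^2x_2^2x_3x_4x_5 -15x_1^2x_2^2x_3^2x_6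 +\tfrac{1}{2}x_1^2x_5^2x_6 +\tfrac{21}{2}x_1^2x_3^2x_4x_6 +9x_1^2x_2x_3x_5x_6 -69x_1^2x_2^3x_3x_7 +9x_1^2x_2x_3x_4x_7 +\tfrac{15}{2}x_1^2x_2^2x_5x_7 -\tfrac{1}{2}x_1^2x_4x_5x_7 +x_1^2x_3x_6x_7 +1240x_1x_2^8 +\tfrac{11}{96}x_1x_3^6 +\tfrac{35}{3}x_1x_4^4 +\tfrac{76}{3}x_1x_2^4x_3^3 +20x_1x_2^2x_4^3 +\tfrac{1}{6}x_1x_2x_5^3 +360x_1x_2^4x_4^2 +8x_1x_3^3x_4^2 +\tfrac{3}{2}x_1x_2^2x_3x_5^2 +x_1x_3x_4x_5^2 +10x_1x_2^2x_6^2 +5x_1x_4x_6^2 +\tfrac{1}{8}x_1x_3x_7^2 -\tfrac{3200}{3}x_1x_2^6x_4 -5x_1x_2^2x_3^3x_4 -7x_1x_2^3x_3^2x_5 +\tfrac{21}{2}x_1x_2x_3^2x_4x_5 +96x_1x_2^5x_6 +\tfrac{5}{2}x_1x_2x_3^3x_6 +20x_1x_2x_4^2x_6 -80x_1x_2^3x_4x_6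 +\tfrac{5}{4}x_1x_3^2x_5x_6 +\tfrac{15}{2}x_1x_2^2x_3^2x_7 +\tfrac{1}{8}x_1x_5^2x_7 +\tfrac{3}{4}x_1x_3^2x_4x_7 -\tfrac{3}{2}x_1x_2x_3x_5x_7 +\tfrac{1}{3}x_2^3x_3^4 +\tfrac{44}{3}x_2x_3x_4^3 +\tfrac{1}{24}x_3x_5^3 -44x_2^3x_3x_4^2 +\tfrac{1}{4}x_2x_3^2x_5^2 +x_2x_3x_6^2 +\tfrac{1}{2}x_5x_6^2 -\tfrac{704}{3}x_2^7x_3 +\tfrac{7}{4}x_2x_3^4x_4 +176x_2^5x_3x_4 +\tfrac{160}{3}x_2^6x_5 +\tfrac{1}{2}x_2^2x_3^3x_5 +\tfrac{2}{3}x_4^3x_5 +2x_2^2x_4^2x_5 -32x_2^4x_4x_5 +\tfrac{3}{4}x_3^3x_4x_5 +\tfrac{1}{8}x_3^4x_6 +6x_3x_4^2x_6 -8x_2^4x_3x_6 +12x_2^2x_3x_4x_6 +4x_2^3x_5x_6 +2x_2x_4x_5x_6 -\tfrac{168}{5}x_2^5x_7 -\tfrac{1}{4}x_2x_3^3x_7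 -4x_2x_4^2x_7 +24x_2^3x_4x_7 +\tfrac{1}{8}x_3^2x_5x_7 -4x_2^2x_6x_7 +x_4x_6x_7 +\tfrac{1}{15}z^5$$ Coordinate transformation, with $c^{12}=-\tfrac{16}{243}$: $$x_1=\frac{c^{7}}{16}\left(9t_1\right)$$ $$x_2=\frac{c^{9}}{1024}\left(-23t_1^3 -432t_3\right)$$ $$x_3=\frac{c^{4}}{27648}\left(481t_1^4 +11232t_1t_3 -20736t_4\right)$$ $$x_4=\frac{c^{6}}{7962624}\left(-1492992t_1s_5 -9061t_1^6 -301104t_1^3t_3 +528768t_1^2t_4 -1586304t_3^2 +4478976t_6\right)$$ $$x_5=\frac{c}{214990848}\left(20901888t_1^2s_5 +134695t_1^7 +5155920t_1^4t_3 -8999424t_1^3t_4 +40497408t_1t_3^2 -62705664t_1t_6 -62705664t_3t_4 +214990848t_7\right)$$ $$x_6=\frac{c^{3}}{743008370688}\left(-6897623040t_1^4s_5 -85136375808t_1t_3s_5 +185752092672t_4s_5 -40346383t_1^9 -1954725696t_1^6t_3 +3391331328t_1^5t_4 -25434984960t_1^3t_3^2 +20692869120t_1^3t_6 +62078607360t_1^2t_3t_4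 -42568187904t_1^2t_7 -42568187904t_1t_4^2 -62078607360t_3^3 +255409127424t_3t_6 -557256278016t_9\right)$$ $$z=\frac{c^{11}}{8}\left(-81s_5\right)$$ $$x_8=\frac{1}{11555266180939776}\left(-267483013447680t_1^2s_5^2 -4240658644992t_1^7s_5 -118958736015360t_1^4t_3s_5 +215472427499520t_1^3t_4s_5 -484812961873920t_1t_3^2s_5 +802449040343040t_1t_6s_5 +802449040343040t_3t_4s_5 -3851755393646592t_7s_5 -20239023875t_1^{12} -1290950892000t_1^9t_3 +2230763141376t_1^8t_4 -26769157696512t_1^6t_3^2 +12721975934976t_1^6t_6 +76331855609856t_1^5t_3t_4 -23791747203072t_1^5t_7 -59479368007680t_1^4t_4^2 -190829639024640t_1^3t_3^3 +356876208046080t_1^3t_3t_6 -161604320624640t_1^3t_9 +535314312069120t_1^2t_3^2t_4 -484812961873920t_1^2t_3t_7 -484812961873920t_1^2t_4t_6 -484812961873920t_1t_3t_4^2 +802449040343040t_1t_4t_7 +11555266180939776t_{12} -267657156034560t_3^4 +1454438885621760t_3^2t_6 -2407347121029120t_3t_9 +133741506723840t_4^3 -1203673560514560t_6^2\right)$$ 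-/

import Mathlib

open MvPolynomial

noncomputable section

/-- The partial derivative `∂F/∂x_i` of a function on `ℂ^n`. -/
def partialD {n : ℕ} (i : Fin n) (F : (Fin n → ℂ) → ℂ) (x : Fin n → ℂ) : ℂ :=
  fderiv ℂ F x (Pi.single i 1)

/-- The matrix `C` of `F`: its `(i, j)` entry is `∂P_j/∂x_i`, where
`P = (∂F/∂x_n, ∂F/∂x_{n-1}, …, ∂F/∂x_1)`. -/
def matrixC {n : ℕ} (F : (Fin n → ℂ) → ℂ) (x : Fin n → ℂ) : Matrix (Fin n) (Fin n) ℂ :=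
  Matrix.of fun i j => partialD i (partialD j.rev F) x

/-- The Euler vector field `E = ∑ w_k x_k ∂/∂x_k`. -/
def euler {n : ℕ} (w : Fin n → ℂ) (G : (Fin n → ℂ) → ℂ) (x : Fin n → ℂ) : ℂ :=
  ∑ k, w k * x k * partialD k G x

/-- The matrix `T = E C`, where `E` acts on every entry of `C`. -/
def matrixT {n : ℕ} (w : Fin n → ℂ) (F : (Fin n → ℂ) → ℂ) (x : Fin n → ℂ) :
    Matrix (Fin n) (Fin n) ℂ :=
  Matrix.of fun i j => euler w (fun y => matrixC F y i j) x

/-- Let `z` be the algebraic function of `x` given by `v(x) - x_m + z ^ 2 = 0`, and `F = G(x, z)`.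
The polynomial `Δ` is the discriminant `det T` of `F`, regarded as a polynomial in the coordinates
`x_i` (`i ≠ m`) and `z`, the variable of index `m` of `Δ` being `z`:
the two agree on every open set `U`, for every holomorphic branch `ζ` of `z` over `U`. -/
def IsPotentialDiscriminant {n : ℕ} (w : Fin n → ℂ) (m : Fin n) (v : (Fin n → ℂ) → ℂ)
    (G : (Fin n → ℂ) → ℂ → ℂ) (Δ : MvPolynomial (Fin n) ℂ) : Prop :=
  ∀ (U : Set (Fin n → ℂ)) (ζ : (Fin n → ℂ) → ℂ), IsOpen U → DifferentiableOn ℂ ζ U →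
    (∀ x ∈ U, v x - x m + ζ x ^ 2 = 0) →
    ∀ x ∈ U, (matrixT w (fun y => G y (ζ y)) x).det = eval (Function.update x m (ζ x)) Δ

/-- `a` is a singular point of the hypersurface `g = 0`. -/
def IsSingularPoint (g : (Fin 3 → ℂ) → ℂ) (a : Fin 3 → ℂ) : Prop :=
  g a = 0 ∧ ∀ i, partialD i g a = 0

/-- `D` is the discriminant of the family of hypersurfaces `S p = 0` with parameter `p`:
the reduced (squarefree) equation of the set of parameters for which the hypersurface is singular.
It is unique up to a nonzero constant factor. -/
def IsFamilyDiscriminant {n : ℕ} (S : (Fin n → ℂ) → (Fin 3 → ℂ) → ℂ)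
    (D : MvPolynomial (Fin n) ℂ) : Prop :=
  Squarefree D ∧ ∀ p, eval p D = 0 ↔ ∃ a, IsSingularPoint (S p) a

/-! ### Type `E6(1)` -/

/-- The weights of the flat coordinates `x1, …, x6` of `E6(1)`. -/
def weightE6 : Fin 6 → ℂ := ![2/9, 1/3, 5/9, 2/3, 8/9, 1]

/-- The polynomial `v` of `E6(1)`; the algebraic function `z` is defined by `v - x5 + z ^ 2 = 0`. -/
def vE6 {K : Type*} [Field K] (x1 x2 x3 x4 : K) : K :=
  -9 * x1 ^ 4 - 12 * x1 * x2 ^ 2 + 2 * x2 * x3 + 2 * x1 * x4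

/-- The algebraic potential `F` of type `E6(1)`, as an expression in the flat coordinates and `z`. -/
def potentialE6 {K : Type*} [Field K] (x1 x2 x3 x4 x5 x6 z : K) : K :=
  x3 * x4 * x6 + x2 * x5 * x6 + 1/2 * x1 * x6 ^ 2 + 2106/5 * x1 ^ 10 + 8100/7 * x1 ^ 7 * x2 ^ 2
  + 348 * x1 ^ 4 * x2 ^ 4 + 104/3 * x1 * x2 ^ 6 + 54 * x1 ^ 6 * x2 * x3 - 84 * x1 ^ 3 * x2 ^ 3 * x3
  - 44/5 * x2 ^ 5 * x3 + 648/5 * x1 ^ 5 * x3 ^ 2 + 27 * x1 ^ 2 * x2 ^ 2 * x3 ^ 2 + 6 * x1 * x2 * x3 ^ 3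
  + 3/8 * x3 ^ 4 + 54 * x1 ^ 7 * x4 - 180 * x1 ^ 4 * x2 ^ 2 * x4 - 20 * x1 * x2 ^ 4 * x4
  + 126 * x1 ^ 3 * x2 * x3 * x4 + 4 * x2 ^ 3 * x3 * x4 + 18 * x1 ^ 2 * x3 ^ 2 * x4 + 27 * x1 ^ 4 * x4 ^ 2
  + 10 * x1 * x2 ^ 2 * x4 ^ 2 + x2 * x3 * x4 ^ 2 + 5/3 * x1 * x4 ^ 3 - 27 * x1 ^ 6 * x5
  + 90 * x1 ^ 3 * x2 ^ 2 * x5 + 6 * x2 ^ 4 * x5 - 27 * x1 ^ 2 * x2 * x3 * x5 + 9/2 * x1 * x3 ^ 2 * x5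
  + 9 * x1 ^ 3 * x4 * x5 - 4 * x2 ^ 2 * x4 * x5 + 1/2 * x4 ^ 2 * x5 + 9/4 * x1 ^ 2 * x5 ^ 2 + 2/5 * z ^ 5

/-- `Δ` is the discriminant of the potential `E6(1)`, written as a polynomial in
`x1, x2, x3, x4, z, x6`. -/
def IsPotentialDiscriminantE6 (Δ : MvPolynomial (Fin 6) ℂ) : Prop :=
  IsPotentialDiscriminant weightE6 4 (fun x => vE6 (x 0) (x 1) (x 2) (x 3))
    (fun x z => potentialE6 (x 0) (x 1) (x 2) (x 3) (x 4) (x 5) z) Δ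

/-- The polynomial `f` of the family of type `E6(1)`. -/
def fE6 {K : Type*} [Field K] (t2 t3 t5 t6 t9 s4 x y : K) : K :=
  y ^ 3 + t9 * x + t6 * x ^ 2 + t3 * x ^ 3 + x ^ 4 + y * (t5 * x + t2 * x ^ 2) + s4 * y ^ 2

/-- The left-hand side of `z ^ 2 - f(x, y) = 0`, with `(x, y, z) = (a 0, a 1, a 2)` and with parameters
`p = (t2, t3, t5, t6, t9, s4)`. -/
def surfaceE6 (p : Fin 6 → ℂ) (a : Fin 3 → ℂ) : ℂ :=
  a 2 ^ 2 - fE6 (p 0) (p 1) (p 2) (p 3) (p 4) (p 5) (a 0) (a 1)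

/-- The coordinate transformation from the parameters `(t2, t3, t5, t6, t9, s4)` to
`(x1, x2, x3, x4, z, x6)`. -/
def transformE6 {K : Type*} [Field K] (c t2 t3 t5 t6 t9 s4 : K) : Fin 6 → K :=
  ![
    -- x1
    c ^ 5 * (-9 * t2) / 4,
    -- x2
    c ^ 3 * (3 * t3) / 4,
    -- x3
    c ^ 8 * (
      -189 * t2 * t3 + 486 * t5) / 8,
    -- x4
    c ^ 6 * (
      108 * t2 * s4 - 11 * t2 ^ 3 + 99 * t3 ^ 2 - 324 * t6) / 16,
    -- z
    c * (s4),
    -- x6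
    (
      540 * t2 * t3 * s4 - 1944 * t5 * s4 - 115 * t2 ^ 3 * t3 + 270 * t2 ^ 2 * t5 + 345 * t3 ^ 3
      - 1620 * t3 * t6 + 5832 * t9) / 5832]

/-- `transformE6` as a map `ℂ^6 → ℂ^6`. -/
def coordE6 (c : ℂ) (p : Fin 6 → ℂ) : Fin 6 → ℂ :=
  transformE6 c (p 0) (p 1) (p 2) (p 3) (p 4) (p 5)

/-! ### Type `E7(1)` -/

/-- The weights of the flat coordinates `x1, …, x7` of `E7(1)`. -/
def weightE7 : Fin 7 → ℂ := ![1/7, 2/7, 3/7, 4/7, 5/7, 6/7, 1]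

/-- The polynomial `v` of `E7(1)`; the algebraic function `z` is defined by `v - x6 + z ^ 2 = 0`. -/
def vE7 {K : Type*} [Field K] (x1 x2 x3 x4 x5 : K) : K :=
  -36 * x1 ^ 6 - 36 * x1 ^ 4 * x2 + 12 * x1 ^ 3 * x3 - 231 * x1 ^ 2 * x2 ^ 2 - 6 * x1 ^ 2 * x4
  - 84 * x1 * x2 * x3 - x1 * x5 - 49 * x2 ^ 3 - 7 * x2 * x4 - 7 * x3 ^ 2

/-- The quadratic part `F_0` of the potential. -/
def potentialE7Part0 {K : Type*} [Field K] (x1 x2 x3 x4 x5 x6 x7 : K) : K :=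
  1/2 * x1 * x7 ^ 2 + 1/2 * x4 ^ 2 * x7 + x3 * x5 * x7 + x2 * x6 * x7

/-- Some of the terms of the potential (summand 1 of 6). -/
def potentialE7Part1 {K : Type*} [Field K] (x1 x2 x3 x4 x5 x6 : K) : K :=
  3939238656/1092455 * x1 ^ 15 - 10368/7 * x1 ^ 13 * x2 + 3456/7 * x1 ^ 12 * x3
  + 18166464/539 * x1 ^ 11 * x2 ^ 2 - 1728/7 * x1 ^ 11 * x4 - 19008/7 * x1 ^ 10 * x2 * x3
  - 288/7 * x1 ^ 10 * x5 + 216576/7 * x1 ^ 9 * x2 ^ 3 + 643392/49 * x1 ^ 9 * x3 ^ 2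
  - 4608/7 * x1 ^ 9 * x2 * x4 - 288/7 * x1 ^ 9 * x6 - 1728/7 * x1 ^ 8 * x2 ^ 2 * x3
  + 864/7 * x1 ^ 8 * x3 * x4 - 432/7 * x1 ^ 8 * x2 * x5 + 60264 * x1 ^ 7 * x2 ^ 4
  - 115776/7 * x1 ^ 7 * x2 * x3 ^ 2 + 72360/343 * x1 ^ 7 * x4 ^ 2 + 3024 * x1 ^ 7 * x2 ^ 2 * x4
  + 144/7 * x1 ^ 7 * x3 * x5

/-- Some of the terms of the potential (summand 2 of 6). -/
def potentialE7Part2 {K : Type*} [Field K] (x1 x2 x3 x4 x5 x6 : K) : K :=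
  -432/7 * x1 ^ 7 * x2 * x6 + 42528/7 * x1 ^ 6 * x3 ^ 3 + 19152 * x1 ^ 6 * x2 ^ 3 * x3
  + 36864/7 * x1 ^ 6 * x2 * x3 * x4 + 576 * x1 ^ 6 * x2 ^ 2 * x5 - 72/7 * x1 ^ 6 * x4 * x5
  + 144/7 * x1 ^ 6 * x3 * x6 + 252252/5 * x1 ^ 5 * x2 ^ 5 + 18216 * x1 ^ 5 * x2 ^ 2 * x3 ^ 2
  + 2844/7 * x1 ^ 5 * x2 * x4 ^ 2 + 942/245 * x1 ^ 5 * x5 ^ 2 + 4824 * x1 ^ 5 * x2 ^ 3 * x4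
  - 10944/7 * x1 ^ 5 * x3 ^ 2 * x4 + 360 * x1 ^ 5 * x2 * x3 * x5 + 576 * x1 ^ 5 * x2 ^ 2 * x6
  - 72/7 * x1 ^ 5 * x4 * x6 - 7008 * x1 ^ 4 * x2 * x3 ^ 3 + 36/7 * x1 ^ 4 * x3 * x4 ^ 2
  + 23940 * x1 ^ 4 * x2 ^ 4 * x3

/-- Some of the terms of the potential (summand 3 of 6). -/
def potentialE7Part3 {K : Type*} [Field K] (x1 x2 x3 x4 x5 x6 : K) : K :=
  1728 * x1 ^ 4 * x2 ^ 2 * x3 * x4 + 420 * x1 ^ 4 * x2 ^ 3 * x5 + 1632/7 * x1 ^ 4 * x3 ^ 2 * x5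
  + 456/7 * x1 ^ 4 * x2 * x4 * x5 + 360 * x1 ^ 4 * x2 * x3 * x6 - 12/7 * x1 ^ 4 * x5 * x6
  + 38220 * x1 ^ 3 * x2 ^ 6 + 3032 * x1 ^ 3 * x3 ^ 4 - 102/7 * x1 ^ 3 * x4 ^ 3 + 4116 * x1 ^ 3 * x2 ^ 3 * x3 ^ 2
  + 444 * x1 ^ 3 * x2 ^ 2 * x4 ^ 2 - 27/7 * x1 ^ 3 * x2 * x5 ^ 2 + 54/49 * x1 ^ 3 * x6 ^ 2
  + 5082 * x1 ^ 3 * x2 ^ 4 * x4 + 264 * x1 ^ 3 * x2 * x3 ^ 2 * x4 + 156 * x1 ^ 3 * x2 ^ 2 * x3 * x5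
  - 276/7 * x1 ^ 3 * x3 * x4 * x5 + 420 * x1 ^ 3 * x2 ^ 3 * x6 + 48 * x1 ^ 3 * x3 ^ 2 * x6

/-- Some of the terms of the potential (summand 4 of 6). -/
def potentialE7Part4 {K : Type*} [Field K] (x1 x2 x3 x4 x5 x6 : K) : K :=
  24 * x1 ^ 3 * x2 * x4 * x6 + 1988 * x1 ^ 2 * x2 ^ 2 * x3 ^ 3 - 150 * x1 ^ 2 * x2 * x3 * x4 ^ 2
  + 25/7 * x1 ^ 2 * x3 * x5 ^ 2 + 24402 * x1 ^ 2 * x2 ^ 5 * x3 - 544 * x1 ^ 2 * x3 ^ 3 * x4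
  + 2436 * x1 ^ 2 * x2 ^ 3 * x3 * x4 + 357 * x1 ^ 2 * x2 ^ 4 * x5 - 156 * x1 ^ 2 * x2 * x3 ^ 2 * x5
  - 3/7 * x1 ^ 2 * x4 ^ 2 * x5 + 48 * x1 ^ 2 * x2 ^ 2 * x4 * x5 + 84 * x1 ^ 2 * x2 ^ 2 * x3 * x6
  + 156/7 * x1 ^ 2 * x3 * x4 * x6 - 6/7 * x1 ^ 2 * x2 * x5 * x6 + 5439 * x1 * x2 ^ 7
  - 812 * x1 * x2 * x3 ^ 4 - 6 * x1 * x2 * x4 ^ 3 + 6468 * x1 * x2 ^ 4 * x3 ^ 2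
  + 147 * x1 * x2 ^ 3 * x4 ^ 2

/-- Some of the terms of the potential (summand 5 of 6). -/
def potentialE7Part5 {K : Type*} [Field K] (x1 x2 x3 x4 x5 x6 : K) : K :=
  54 * x1 * x3 ^ 2 * x4 ^ 2 + 5/2 * x1 * x2 ^ 2 * x5 ^ 2 - 5/14 * x1 * x4 * x5 ^ 2 + 9/7 * x1 * x2 * x6 ^ 2
  + 1764 * x1 * x2 ^ 5 * x4 + 42 * x1 * x2 ^ 2 * x3 ^ 2 * x4 + 160/3 * x1 * x3 ^ 3 * x5
  + 140 * x1 * x2 ^ 3 * x3 * x5 + 20 * x1 * x2 * x3 * x4 * x5 + 294 * x1 * x2 ^ 4 * x6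
  - 12 * x1 * x2 * x3 ^ 2 * x6 + 9/7 * x1 * x4 ^ 2 * x6 + 36 * x1 * x2 ^ 2 * x4 * x6
  - 10/7 * x1 * x3 * x5 * x6 + 1484/15 * x3 ^ 5 + 1666/3 * x2 ^ 3 * x3 ^ 3 + x3 * x4 ^ 3 + 1/84 * x5 ^ 3
  + 7 * x2 ^ 2 * x3 * x4 ^ 2

/-- Some of the terms of the potential (summand 6 of 6). -/
def potentialE7Part6 {K : Type*} [Field K] (x2 x3 x4 x5 x6 z : K) : K :=
  -1/2 * x2 * x3 * x5 ^ 2 + 1/7 * x3 * x6 ^ 2 + 1029 * x2 ^ 6 * x3 + 364/3 * x2 * x3 ^ 3 * x4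
  + 392 * x2 ^ 4 * x3 * x4 + 49/5 * x2 ^ 5 * x5 + 21 * x2 ^ 2 * x3 ^ 2 * x5 - 1/2 * x2 * x4 ^ 2 * x5
  + 7 * x2 ^ 3 * x4 * x5 - 6 * x3 ^ 2 * x4 * x5 - 20/3 * x3 ^ 3 * x6 + 84 * x2 ^ 3 * x3 * x6
  + 8 * x2 * x3 * x4 * x6 + 2 * x2 ^ 2 * x5 * x6 + 1/7 * x4 * x5 * x6 + 8/105 * z ^ 5

/-- The algebraic potential `F` of type `E7(1)`, as an expression in the flat coordinates and `z`. -/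
def potentialE7 {K : Type*} [Field K] (x1 x2 x3 x4 x5 x6 x7 z : K) : K :=
  potentialE7Part0 x1 x2 x3 x4 x5 x6 x7 +
  potentialE7Part1 x1 x2 x3 x4 x5 x6 +
  potentialE7Part2 x1 x2 x3 x4 x5 x6 +
  potentialE7Part3 x1 x2 x3 x4 x5 x6 +
  potentialE7Part4 x1 x2 x3 x4 x5 x6 +
  potentialE7Part5 x1 x2 x3 x4 x5 x6 +
  potentialE7Part6 x2 x3 x4 x5 x6 z

/-- `Δ` is the discriminant of the potential `E7(1)`, written as a polynomial in
`x1, x2, x3, x4, x5, z, x7`. -/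
def IsPotentialDiscriminantE7 (Δ : MvPolynomial (Fin 7) ℂ) : Prop :=
  IsPotentialDiscriminant weightE7 5 (fun x => vE7 (x 0) (x 1) (x 2) (x 3) (x 4))
    (fun x z => potentialE7 (x 0) (x 1) (x 2) (x 3) (x 4) (x 5) (x 6) z) Δ

/-- The polynomial `f` of the family of type `E7(1)`. -/
def fE7 {K : Type*} [Field K] (t1 t2 t3 t4 t5 t7 s3 x y : K) : K :=
  y ^ 3 + t7 * x + t5 * x ^ 2 + t3 * x ^ 3 + t1 * x ^ 4 + x ^ 3 * y + y * (t4 * x + t2 * x ^ 2) + s3 * y ^ 2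

/-- The left-hand side of `z ^ 2 - f(x, y) = 0`, with `(x, y, z) = (a 0, a 1, a 2)` and with parameters
`p = (t1, t2, t3, t4, t5, t7, s3)`. -/
def surfaceE7 (p : Fin 7 → ℂ) (a : Fin 3 → ℂ) : ℂ :=
  a 2 ^ 2 - fE7 (p 0) (p 1) (p 2) (p 3) (p 4) (p 5) (p 6) (a 0) (a 1)

/-- The coordinate transformation from the parameters `(t1, t2, t3, t4, t5, t7, s3)` to
`(x1, x2, x3, x4, x5, z, x7)`. -/
def transformE7 {K : Type*} [Field K] (c t1 t2 t3 t4 t5 t7 s3 : K) : Fin 7 → K :=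
  ![
    -- x1
    c ^ 2 * (-3 * t1),
    -- x2
    c ^ 4 * (
      -117 * t1 ^ 2 - 84 * t2) / 7,
    -- x3
    c ^ 6 * (
      -1176 * s3 - 4743 * t1 ^ 3 - 4284 * t1 * t2 + 3528 * t3) / 7,
    -- x4
    c * (
      -32 * t1 * s3 - 105 * t1 ^ 4 - 120 * t1 ^ 2 * t2 + 96 * t1 * t3 - 16 * t2 ^ 2 + 64 * t4) / 64,
    -- x5
    c ^ 3 * (
      -646800 * t1 ^ 2 * s3 + 65856 * t2 * s3 - 1757745 * t1 ^ 5 - 2448600 * t1 ^ 3 * t2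
      + 1940400 * t1 ^ 2 * t3 - 646800 * t1 * t2 ^ 2 + 724416 * t1 * t4 + 724416 * t2 * t3
      - 921984 * t5) / 10976,
    -- z
    c ^ 6 * (-2352 * s3),
    -- x7
    (
      32269440 * t1 * s3 ^ 2 - 747369560 * t1 ^ 4 * s3 - 481736640 * t1 ^ 2 * t2 * s3
      + 408746240 * t1 * t3 * s3 + 32269440 * t2 ^ 2 * s3 - 180708864 * t4 * s3
      - 1498061973 * t1 ^ 7 - 2850681036 * t1 ^ 5 * t2 + 2242108680 * t1 ^ 4 * t3
      - 1494739120 * t1 ^ 3 * t2 ^ 2 + 686109760 * t1 ^ 3 * t4 + 2058329280 * t1 ^ 2 * t2 * t3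
      - 613119360 * t1 ^ 2 * t5 - 160578880 * t1 * t2 ^ 3 + 408746240 * t1 * t2 * t4
      - 613119360 * t1 * t3 ^ 2 + 204373120 * t2 ^ 2 * t3 - 301181440 * t2 * t5
      - 301181440 * t3 * t4 + 843308032 * t7) / 843308032]

/-- `transformE7` as a map `ℂ^7 → ℂ^7`. -/
def coordE7 (c : ℂ) (p : Fin 7 → ℂ) : Fin 7 → ℂ :=
  transformE7 c (p 0) (p 1) (p 2) (p 3) (p 4) (p 5) (p 6)

/-! ### Type `E8(1)` -/

/-- The weights of the flat coordinates `x1, …, x8` of `E8(1)`. -/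
def weightE8 : Fin 8 → ℂ := ![1/12, 1/4, 1/3, 1/2, 7/12, 3/4, 5/6, 1]

/-- The polynomial `v` of `E8(1)`; the algebraic function `z` is defined by `v - x7 + z ^ 2 = 0`. -/
def vE8 {K : Type*} [Field K] (x1 x2 x3 x4 x5 x6 : K) : K :=
  -x1 ^ 10 + 5 * x1 ^ 7 * x2 + 1/2 * x1 ^ 6 * x3 - 78 * x1 ^ 4 * x2 ^ 2 + 2 * x1 ^ 4 * x4
  + 20 * x1 ^ 3 * x2 * x3 - x1 ^ 3 * x5 - 3/2 * x1 ^ 2 * x3 ^ 2 + 88 * x1 * x2 ^ 3 - 24 * x1 * x2 * x4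
  + 2 * x1 * x6 - 12 * x2 ^ 2 * x3 + 2 * x2 * x5 + 2 * x3 * x4

/-- The quadratic part `F_0` of the potential. -/
def potentialE8Part0 {K : Type*} [Field K] (x1 x2 x3 x4 x5 x6 x7 x8 : K) : K :=
  1/2 * x1 * x8 ^ 2 + x4 * x5 * x8 + x3 * x6 * x8 + x2 * x7 * x8

/-- Some of the terms of the potential (summand 1 of 11). -/
def potentialE8Part1 {K : Type*} [Field K] (x1 x2 x3 x4 x5 x6 x7 : K) : K :=
  472561/883200 * x1 ^ 25 + 5/6 * x1 ^ 22 * x2 + 1/12 * x1 ^ 21 * x3 + 14781/304 * x1 ^ 19 * x2 ^ 2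
  + 1/3 * x1 ^ 19 * x4 + 65/24 * x1 ^ 18 * x2 * x3 - 1/6 * x1 ^ 18 * x5 + 6255/1088 * x1 ^ 17 * x3 ^ 2
  - 1225/6 * x1 ^ 16 * x2 ^ 3 - 13/2 * x1 ^ 16 * x2 * x4 + 1/3 * x1 ^ 16 * x6
  + 415/8 * x1 ^ 15 * x2 ^ 2 * x3 + 1/12 * x1 ^ 15 * x3 * x4 + 19/12 * x1 ^ 15 * x2 * x5
  - 1/6 * x1 ^ 15 * x7 + 269/8 * x1 ^ 14 * x2 * x3 ^ 2 + 1/8 * x1 ^ 14 * x3 * x5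
  + 14879/12 * x1 ^ 13 * x2 ^ 4 + 565/96 * x1 ^ 13 * x3 ^ 3

/-- Some of the terms of the potential (summand 2 of 11). -/
def potentialE8Part2 {K : Type*} [Field K] (x1 x2 x3 x4 x5 x6 x7 : K) : K :=
  2135/104 * x1 ^ 13 * x4 ^ 2 - 19 * x1 ^ 13 * x2 ^ 2 * x4 - 5/2 * x1 ^ 13 * x2 * x6
  - 766/3 * x1 ^ 12 * x2 ^ 3 * x3 + 329/4 * x1 ^ 12 * x2 * x3 * x4 + 22 * x1 ^ 12 * x2 ^ 2 * x5
  + 1/2 * x1 ^ 12 * x4 * x5 - 1/4 * x1 ^ 12 * x3 * x6 + 5/4 * x1 ^ 12 * x2 * x7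
  + 150 * x1 ^ 11 * x2 ^ 2 * x3 ^ 2 + 199/352 * x1 ^ 11 * x5 ^ 2 + 373/16 * x1 ^ 11 * x3 ^ 2 * x4
  - 43/4 * x1 ^ 11 * x2 * x3 * x5 + 1/8 * x1 ^ 11 * x3 * x7 - 21216/5 * x1 ^ 10 * x2 ^ 5
  + 1583/48 * x1 ^ 10 * x2 * x3 ^ 3 - 95/2 * x1 ^ 10 * x2 * x4 ^ 2 + 1727/3 * x1 ^ 10 * x2 ^ 3 * x4
  + 109/32 * x1 ^ 10 * x3 ^ 2 * x5

/-- Some of the terms of the potential (summand 3 of 11). -/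
def potentialE8Part3 {K : Type*} [Field K] (x1 x2 x3 x4 x5 x6 x7 : K) : K :=
  -49 * x1 ^ 10 * x2 ^ 2 * x6 - x1 ^ 10 * x4 * x6 + 1559/192 * x1 ^ 9 * x3 ^ 4 + 59/2 * x1 ^ 9 * x3 * x4 ^ 2
  + 10795/6 * x1 ^ 9 * x2 ^ 4 * x3 - 239/2 * x1 ^ 9 * x2 ^ 2 * x3 * x4 - 743/6 * x1 ^ 9 * x2 ^ 3 * x5
  + 105/2 * x1 ^ 9 * x2 * x4 * x5 + 21 * x1 ^ 9 * x2 * x3 * x6 + 1/2 * x1 ^ 9 * x5 * x6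
  + 49/2 * x1 ^ 9 * x2 ^ 2 * x7 + 1/2 * x1 ^ 9 * x4 * x7 - 233 * x1 ^ 8 * x2 ^ 3 * x3 ^ 2
  - 7/8 * x1 ^ 8 * x2 * x5 ^ 2 + 429/4 * x1 ^ 8 * x2 * x3 ^ 2 * x4 + 207/4 * x1 ^ 8 * x2 ^ 2 * x3 * x5
  + 21/2 * x1 ^ 8 * x3 * x4 * x5 - 7/4 * x1 ^ 8 * x3 ^ 2 * x6 - 21/2 * x1 ^ 8 * x2 * x3 * x7

/-- Some of the terms of the potential (summand 4 of 11). -/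
def potentialE8Part4 {K : Type*} [Field K] (x1 x2 x3 x4 x5 x6 x7 : K) : K :=
  -1/4 * x1 ^ 8 * x5 * x7 + 32150/3 * x1 ^ 7 * x2 ^ 6 + 189/2 * x1 ^ 7 * x2 ^ 2 * x3 ^ 3
  + 163/6 * x1 ^ 7 * x4 ^ 3 + 442 * x1 ^ 7 * x2 ^ 2 * x4 ^ 2 + 7/8 * x1 ^ 7 * x3 * x5 ^ 2
  + 67/28 * x1 ^ 7 * x6 ^ 2 - 2491 * x1 ^ 7 * x2 ^ 4 * x4 + 637/24 * x1 ^ 7 * x3 ^ 3 * x4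
  + 103/8 * x1 ^ 7 * x2 * x3 ^ 2 * x5 + 584/3 * x1 ^ 7 * x2 ^ 3 * x6 - 26 * x1 ^ 7 * x2 * x4 * x6
  + 7/8 * x1 ^ 7 * x3 ^ 2 * x7 + 475/24 * x1 ^ 6 * x2 * x3 ^ 4 + 307/2 * x1 ^ 6 * x2 * x3 * x4 ^ 2
  - 5607 * x1 ^ 6 * x2 ^ 5 * x3 + 3446/3 * x1 ^ 6 * x2 ^ 3 * x3 * x4 + 2659/6 * x1 ^ 6 * x2 ^ 4 * x5
  + 131/48 * x1 ^ 6 * x3 ^ 3 * x5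

/-- Some of the terms of the potential (summand 5 of 11). -/
def potentialE8Part5 {K : Type*} [Field K] (x1 x2 x3 x4 x5 x6 x7 : K) : K :=
  -1/4 * x1 ^ 6 * x4 ^ 2 * x5 - 96 * x1 ^ 6 * x2 ^ 2 * x4 * x5 - 48 * x1 ^ 6 * x2 ^ 2 * x3 * x6
  + 39/2 * x1 ^ 6 * x3 * x4 * x6 + 9/2 * x1 ^ 6 * x2 * x5 * x6 - 292/3 * x1 ^ 6 * x2 ^ 3 * x7
  + 13 * x1 ^ 6 * x2 * x4 * x7 + 1/2 * x1 ^ 6 * x6 * x7 + 419/160 * x1 ^ 5 * x3 ^ 5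
  + 2737/2 * x1 ^ 5 * x2 ^ 4 * x3 ^ 2 + 195/4 * x1 ^ 5 * x3 ^ 2 * x4 ^ 2 + 51/4 * x1 ^ 5 * x2 ^ 2 * x5 ^ 2
  + 19/8 * x1 ^ 5 * x4 * x5 ^ 2 + 17/80 * x1 ^ 5 * x7 ^ 2 + 9 * x1 ^ 5 * x2 ^ 2 * x3 ^ 2 * x4
  - 147 * x1 ^ 5 * x2 ^ 3 * x3 * x5 + 33 * x1 ^ 5 * x2 * x3 * x4 * x5 + 9/2 * x1 ^ 5 * x2 * x3 ^ 2 * x6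
  + 13/4 * x1 ^ 5 * x3 * x5 * x6

/-- Some of the terms of the potential (summand 6 of 11). -/
def potentialE8Part6 {K : Type*} [Field K] (x1 x2 x3 x4 x5 x6 x7 : K) : K :=
  24 * x1 ^ 5 * x2 ^ 2 * x3 * x7 - 3 * x1 ^ 5 * x3 * x4 * x7 - 26144/3 * x1 ^ 4 * x2 ^ 7
  - 400/3 * x1 ^ 4 * x2 ^ 3 * x3 ^ 3 - 64/3 * x1 ^ 4 * x2 * x4 ^ 3 - 1/48 * x1 ^ 4 * x5 ^ 3
  - 640 * x1 ^ 4 * x2 ^ 3 * x4 ^ 2 + 13/8 * x1 ^ 4 * x2 * x3 * x5 ^ 2 + 8 * x1 ^ 4 * x2 * x6 ^ 2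
  + 4956 * x1 ^ 4 * x2 ^ 5 * x4 + 65 * x1 ^ 4 * x2 * x3 ^ 3 * x4 + 30 * x1 ^ 4 * x2 ^ 2 * x3 ^ 2 * x5
  + 51/4 * x1 ^ 4 * x3 ^ 2 * x4 * x5 - 470 * x1 ^ 4 * x2 ^ 4 * x6 + 29/12 * x1 ^ 4 * x3 ^ 3 * x6
  + 14 * x1 ^ 4 * x4 ^ 2 * x6 + 122 * x1 ^ 4 * x2 ^ 2 * x4 * x6 + 5/8 * x1 ^ 4 * x3 * x5 * x7
  + 185/8 * x1 ^ 3 * x2 ^ 2 * x3 ^ 4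

/-- Some of the terms of the potential (summand 7 of 11). -/
def potentialE8Part7 {K : Type*} [Field K] (x1 x2 x3 x4 x5 x6 x7 : K) : K :=
  86/3 * x1 ^ 3 * x3 * x4 ^ 3 + 190 * x1 ^ 3 * x2 ^ 2 * x3 * x4 ^ 2 + x1 ^ 3 * x3 ^ 2 * x5 ^ 2
  + 7/2 * x1 ^ 3 * x3 * x6 ^ 2 + 10672/3 * x1 ^ 3 * x2 ^ 6 * x3 + 383/48 * x1 ^ 3 * x3 ^ 4 * x4
  - 1900 * x1 ^ 3 * x2 ^ 4 * x3 * x4 - 452 * x1 ^ 3 * x2 ^ 5 * x5 + 41/12 * x1 ^ 3 * x2 * x3 ^ 3 * x5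
  + 34 * x1 ^ 3 * x2 * x4 ^ 2 * x5 + 198 * x1 ^ 3 * x2 ^ 3 * x4 * x5 + 162 * x1 ^ 3 * x2 ^ 3 * x3 * x6
  + 18 * x1 ^ 3 * x2 * x3 * x4 * x6 - 15 * x1 ^ 3 * x2 ^ 2 * x5 * x6 + 4 * x1 ^ 3 * x4 * x5 * x6
  + 220 * x1 ^ 3 * x2 ^ 4 * x7 - 1/12 * x1 ^ 3 * x3 ^ 3 * x7 + 13/2 * x1 ^ 3 * x4 ^ 2 * x7
  - 43 * x1 ^ 3 * x2 ^ 2 * x4 * x7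

/-- Some of the terms of the potential (summand 8 of 11). -/
def potentialE8Part8 {K : Type*} [Field K] (x1 x2 x3 x4 x5 x6 x7 : K) : K :=
  x1 ^ 3 * x2 * x6 * x7 + 25/16 * x1 ^ 2 * x2 * x3 ^ 5 - 492 * x1 ^ 2 * x2 ^ 5 * x3 ^ 2
  + 36 * x1 ^ 2 * x2 * x3 ^ 2 * x4 ^ 2 - 9 * x1 ^ 2 * x2 ^ 3 * x5 ^ 2 - x1 ^ 2 * x2 * x7 ^ 2
  + 302 * x1 ^ 2 * x2 ^ 3 * x3 ^ 2 * x4 + 25/32 * x1 ^ 2 * x3 ^ 4 * x5 + 27/2 * x1 ^ 2 * x3 * x4 ^ 2 * x5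
  + 124 * x1 ^ 2 * x2 ^ 4 * x3 * x5 - 3 * x1 ^ 2 * x2 ^ 2 * x3 * x4 * x5 - 15 * x1 ^ 2 * x2 ^ 2 * x3 ^ 2 * x6
  + 1/2 * x1 ^ 2 * x5 ^ 2 * x6 + 21/2 * x1 ^ 2 * x3 ^ 2 * x4 * x6 + 9 * x1 ^ 2 * x2 * x3 * x5 * x6
  - 69 * x1 ^ 2 * x2 ^ 3 * x3 * x7 + 9 * x1 ^ 2 * x2 * x3 * x4 * x7 + 15/2 * x1 ^ 2 * x2 ^ 2 * x5 * x7
  - 1/2 * x1 ^ 2 * x4 * x5 * x7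

/-- Some of the terms of the potential (summand 9 of 11). -/
def potentialE8Part9 {K : Type*} [Field K] (x1 x2 x3 x4 x5 x6 x7 : K) : K :=
  x1 ^ 2 * x3 * x6 * x7 + 1240 * x1 * x2 ^ 8 + 11/96 * x1 * x3 ^ 6 + 35/3 * x1 * x4 ^ 4
  + 76/3 * x1 * x2 ^ 4 * x3 ^ 3 + 20 * x1 * x2 ^ 2 * x4 ^ 3 + 1/6 * x1 * x2 * x5 ^ 3
  + 360 * x1 * x2 ^ 4 * x4 ^ 2 + 8 * x1 * x3 ^ 3 * x4 ^ 2 + 3/2 * x1 * x2 ^ 2 * x3 * x5 ^ 2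
  + x1 * x3 * x4 * x5 ^ 2 + 10 * x1 * x2 ^ 2 * x6 ^ 2 + 5 * x1 * x4 * x6 ^ 2 + 1/8 * x1 * x3 * x7 ^ 2
  - 3200/3 * x1 * x2 ^ 6 * x4 - 5 * x1 * x2 ^ 2 * x3 ^ 3 * x4 - 7 * x1 * x2 ^ 3 * x3 ^ 2 * x5
  + 21/2 * x1 * x2 * x3 ^ 2 * x4 * x5 + 96 * x1 * x2 ^ 5 * x6

/-- Some of the terms of the potential (summand 10 of 11). -/
def potentialE8Part10 {K : Type*} [Field K] (x1 x2 x3 x4 x5 x6 x7 : K) : K :=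
  5/2 * x1 * x2 * x3 ^ 3 * x6 + 20 * x1 * x2 * x4 ^ 2 * x6 - 80 * x1 * x2 ^ 3 * x4 * x6
  + 5/4 * x1 * x3 ^ 2 * x5 * x6 + 15/2 * x1 * x2 ^ 2 * x3 ^ 2 * x7 + 1/8 * x1 * x5 ^ 2 * x7
  + 3/4 * x1 * x3 ^ 2 * x4 * x7 - 3/2 * x1 * x2 * x3 * x5 * x7 + 1/3 * x2 ^ 3 * x3 ^ 4
  + 44/3 * x2 * x3 * x4 ^ 3 + 1/24 * x3 * x5 ^ 3 - 44 * x2 ^ 3 * x3 * x4 ^ 2 + 1/4 * x2 * x3 ^ 2 * x5 ^ 2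
  + x2 * x3 * x6 ^ 2 + 1/2 * x5 * x6 ^ 2 - 704/3 * x2 ^ 7 * x3 + 7/4 * x2 * x3 ^ 4 * x4
  + 176 * x2 ^ 5 * x3 * x4 + 160/3 * x2 ^ 6 * x5

/-- Some of the terms of the potential (summand 11 of 11). -/
def potentialE8Part11 {K : Type*} [Field K] (x2 x3 x4 x5 x6 x7 z : K) : K :=
  1/2 * x2 ^ 2 * x3 ^ 3 * x5 + 2/3 * x4 ^ 3 * x5 + 2 * x2 ^ 2 * x4 ^ 2 * x5 - 32 * x2 ^ 4 * x4 * x5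
  + 3/4 * x3 ^ 3 * x4 * x5 + 1/8 * x3 ^ 4 * x6 + 6 * x3 * x4 ^ 2 * x6 - 8 * x2 ^ 4 * x3 * x6
  + 12 * x2 ^ 2 * x3 * x4 * x6 + 4 * x2 ^ 3 * x5 * x6 + 2 * x2 * x4 * x5 * x6 - 168/5 * x2 ^ 5 * x7
  - 1/4 * x2 * x3 ^ 3 * x7 - 4 * x2 * x4 ^ 2 * x7 + 24 * x2 ^ 3 * x4 * x7 + 1/8 * x3 ^ 2 * x5 * x7
  - 4 * x2 ^ 2 * x6 * x7 + x4 * x6 * x7 + 1/15 * z ^ 5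

/-- The algebraic potential `F` of type `E8(1)`, as an expression in the flat coordinates and `z`. -/
def potentialE8 {K : Type*} [Field K] (x1 x2 x3 x4 x5 x6 x7 x8 z : K) : K :=
  potentialE8Part0 x1 x2 x3 x4 x5 x6 x7 x8 +
  potentialE8Part1 x1 x2 x3 x4 x5 x6 x7 +
  potentialE8Part2 x1 x2 x3 x4 x5 x6 x7 +
  potentialE8Part3 x1 x2 x3 x4 x5 x6 x7 +
  potentialE8Part4 x1 x2 x3 x4 x5 x6 x7 +
  potentialE8Part5 x1 x2 x3 x4 x5 x6 x7 +
  potentialE8Part6 x1 x2 x3 x4 x5 x6 x7 +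
  potentialE8Part7 x1 x2 x3 x4 x5 x6 x7 +
  potentialE8Part8 x1 x2 x3 x4 x5 x6 x7 +
  potentialE8Part9 x1 x2 x3 x4 x5 x6 x7 +
  potentialE8Part10 x1 x2 x3 x4 x5 x6 x7 +
  potentialE8Part11 x2 x3 x4 x5 x6 x7 z

/-- `Δ` is the discriminant of the potential `E8(1)`, written as a polynomial in
`x1, x2, x3, x4, x5, x6, z, x8`. -/
def IsPotentialDiscriminantE8 (Δ : MvPolynomial (Fin 8) ℂ) : Prop :=
  IsPotentialDiscriminant weightE8 6 (fun x => vE8 (x 0) (x 1) (x 2) (x 3) (x 4) (x 5))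
    (fun x z => potentialE8 (x 0) (x 1) (x 2) (x 3) (x 4) (x 5) (x 6) (x 7) z) Δ

/-- The polynomial `f` of the family of type `E8(1)`. -/
def fE8 {K : Type*} [Field K] (t1 t3 t4 t6 t7 t9 t12 s5 x y : K) : K :=
  y ^ 3 + t12 * x + t9 * x ^ 2 + t6 * x ^ 3 + t3 * x ^ 4 + x ^ 5 + y * (t7 * x + t4 * x ^ 2 + t1 * x ^ 3) + s5 * y ^ 2

/-- The left-hand side of `z ^ 2 - f(x, y) = 0`, with `(x, y, z) = (a 0, a 1, a 2)` and with parameters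
`p = (t1, t3, t4, t6, t7, t9, t12, s5)`. -/
def surfaceE8 (p : Fin 8 → ℂ) (a : Fin 3 → ℂ) : ℂ :=
  a 2 ^ 2 - fE8 (p 0) (p 1) (p 2) (p 3) (p 4) (p 5) (p 6) (p 7) (a 0) (a 1)

/-- The coordinate transformation from the parameters `(t1, t3, t4, t6, t7, t9, t12, s5)` to
`(x1, x2, x3, x4, x5, x6, z, x8)`. -/
def transformE8 {K : Type*} [Field K] (c t1 t3 t4 t6 t7 t9 t12 s5 : K) : Fin 8 → K :=
  ![
    -- x1
    c ^ 7 * (9 * t1) / 16,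
    -- x2
    c ^ 9 * (
      -23 * t1 ^ 3 - 432 * t3) / 1024,
    -- x3
    c ^ 4 * (
      481 * t1 ^ 4 + 11232 * t1 * t3 - 20736 * t4) / 27648,
    -- x4
    c ^ 6 * (
      -1492992 * t1 * s5 - 9061 * t1 ^ 6 - 301104 * t1 ^ 3 * t3 + 528768 * t1 ^ 2 * t4
      - 1586304 * t3 ^ 2 + 4478976 * t6) / 7962624,
    -- x5
    c * (
      20901888 * t1 ^ 2 * s5 + 134695 * t1 ^ 7 + 5155920 * t1 ^ 4 * t3 - 8999424 * t1 ^ 3 * t4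
      + 40497408 * t1 * t3 ^ 2 - 62705664 * t1 * t6 - 62705664 * t3 * t4 + 214990848 * t7) / 214990848,
    -- x6
    c ^ 3 * (
      -6897623040 * t1 ^ 4 * s5 - 85136375808 * t1 * t3 * s5 + 185752092672 * t4 * s5
      - 40346383 * t1 ^ 9 - 1954725696 * t1 ^ 6 * t3 + 3391331328 * t1 ^ 5 * t4
      - 25434984960 * t1 ^ 3 * t3 ^ 2 + 20692869120 * t1 ^ 3 * t6 + 62078607360 * t1 ^ 2 * t3 * t4
      - 42568187904 * t1 ^ 2 * t7 - 42568187904 * t1 * t4 ^ 2 - 62078607360 * t3 ^ 3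
      + 255409127424 * t3 * t6 - 557256278016 * t9) / 743008370688,
    -- z
    c ^ 11 * (-81 * s5) / 8,
    -- x8
    (
      -267483013447680 * t1 ^ 2 * s5 ^ 2 - 4240658644992 * t1 ^ 7 * s5
      - 118958736015360 * t1 ^ 4 * t3 * s5 + 215472427499520 * t1 ^ 3 * t4 * s5
      - 484812961873920 * t1 * t3 ^ 2 * s5 + 802449040343040 * t1 * t6 * s5
      + 802449040343040 * t3 * t4 * s5 - 3851755393646592 * t7 * s5 - 20239023875 * t1 ^ 12
      - 1290950892000 * t1 ^ 9 * t3 + 2230763141376 * t1 ^ 8 * t4 - 26769157696512 * t1 ^ 6 * t3 ^ 2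
      + 12721975934976 * t1 ^ 6 * t6 + 76331855609856 * t1 ^ 5 * t3 * t4
      - 23791747203072 * t1 ^ 5 * t7 - 59479368007680 * t1 ^ 4 * t4 ^ 2
      - 190829639024640 * t1 ^ 3 * t3 ^ 3 + 356876208046080 * t1 ^ 3 * t3 * t6
      - 161604320624640 * t1 ^ 3 * t9 + 535314312069120 * t1 ^ 2 * t3 ^ 2 * t4
      - 484812961873920 * t1 ^ 2 * t3 * t7 - 484812961873920 * t1 ^ 2 * t4 * t6
      - 484812961873920 * t1 * t3 * t4 ^ 2 + 802449040343040 * t1 * t4 * t7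
      + 11555266180939776 * t12 - 267657156034560 * t3 ^ 4 + 1454438885621760 * t3 ^ 2 * t6
      - 2407347121029120 * t3 * t9 + 133741506723840 * t4 ^ 3 - 1203673560514560 * t6 ^ 2) / 11555266180939776]

/-- `transformE8` as a map `ℂ^8 → ℂ^8`. -/
def coordE8 (c : ℂ) (p : Fin 8 → ℂ) : Fin 8 → ℂ :=
  transformE8 c (p 0) (p 1) (p 2) (p 3) (p 4) (p 5) (p 6) (p 7)

end

/-! Write `t` for the coefficient of `x` in the family polynomial `f` (the parameter `t9`, `t7` or
`t12`) and `s` for that of `y ^ 2`. Every surface `z ^ 2 = f` passes through the origin, which is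
singular exactly when `t = 0`; this accounts for the factor `t` in the discriminant.

Suppose `t ≠ 0`. Then every singular point has `x ≠ 0`, and in terms of `x` and `u = y / x`
singularity means `R₁ = R₂ = 0` and `f / x = 0`, where `R₁ = f_y / x` and `R₂ = (3 f - 3 x f_x - y
f_y) / x ^ 2` do not contain `t` (`exists_isSingularPoint_iff`). Modulo `R₁` and `R₂` one computes
with the `n` monomials `x ^ i`, `x ^ i u`: `x u ^ 2` is reduced by `R₁` and `s u ^ 2` by `R₂`, so
multiplication by `x`, by `y = x u` and by `s u` is given, up to integer factors, by matrices `X`,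
`Y`, `V` over the polynomial ring of the parameters. Multiplication by `f / x` then has a matrix `t
+ N` that is a polynomial in `X`, `Y`, `V`, with `N` free of `t`. At a solution of `R₁ = R₂ = 0` the
vector of monomials is a common eigenvector, so a singular point makes `det (t + N)` vanish.
Conversely, `X`, `Y`, `V` commute, so a singular `t + N` has a common eigenvector in its kernel, and
its entries give back `x` and `u` (`HMat.exists_eigenvector_of_det_eq_zero`). Hence `D = t det (t +
N)` has the right zero set. It is squarefree because it is, up to a unit, monic in `t` and separable
at one explicit choice of the other parameters (`HMat.squarefree_X_mul_det`).

On the side of the potential, `F = Q + const z ^ 5` with `z ^ 2 = x_m - v`. Since `2 z dz = d(x_m -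
v)`, the second derivatives of `F` are polynomials in `x` and `z`; since `x_m - v` is weighted
homogeneous, `E z` is a constant multiple of `z`, so `T` is polynomial in `x` and `z` as well
(`PotentialData.isPotentialDiscriminant`).

The two sides meet in the identity `eq_transition` of each type. Regard the parameters as functions
of the flat coordinates and expand the classes of `(∂f/∂x_i) / x` in the monomials. The resulting
matrix `P` is polynomial and triangular with constant diagonal, and it intertwines `t + N` with a
constant multiple of `T`: in the frame of these classes, multiplication by `f / x` is `T`. Taking
determinants gives `Δ = const det (t + N)`, hence `t Δ = const D`.

All the large identities are identities of integer polynomials and are checked by evaluation. To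
have integer coefficients the coordinates are rescaled by powers of one number `μ` according to
their weights; weighted homogeneity then restores the constant `c` (`HMat.det_eq_of_coordinates`).
-/

noncomputable section

/-! ### Arithmetic of integer polynomials in several variables. -/

/-- Polynomials with integer coefficients in recursive (Horner) form. Read at level `k`,
`horner a b` stands for `a + x_k * b`, where `a` is read at level `k + 1` and `b` at level `k`.
The operations are defined by the recursor, so that the kernel evaluates them quickly. -/
inductive HPoly
  | const (q : ℤ) : HPoly
  | horner (a b : HPoly) : HPoly

namespace HPoly

/-- The value of a polynomial read at level `k`. -/
def eval {R : Type*} [CommRing R] (ρ : ℕ → R) : ℕ → HPoly → R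
  | _, const q => (q : R)
  | k, horner a b => eval ρ (k + 1) a + ρ k * eval ρ k b

/-- Whether an integer is zero. -/
def intIsZero (q : ℤ) : Bool := Int.rec (fun n => Nat.beq n 0) (fun _ => false) q

/-- Whether a polynomial is literally the constant zero. -/
def isConstZero (p : HPoly) : Bool := HPoly.rec intIsZero (fun _ _ _ _ => false) p

/-- The polynomial `a + x * b`. -/
def node (a b : HPoly) : HPoly :=
  cond (isConstZero b) (cond (isConstZero a) (const 0) (horner a b)) (horner a b)

/-- Addition of a constant. -/
def addConst (q : ℤ) (p : HPoly) : HPoly :=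
  cond (intIsZero q) p
    (HPoly.rec (fun r => const (Int.add q r)) (fun _ b iha _ => horner iha b) p)

/-- Addition. -/
def add (p : HPoly) : HPoly → HPoly :=
  HPoly.rec (motive := fun _ => HPoly → HPoly) addConst
    (fun a b iha ihb p => HPoly.rec (fun r => horner (addConst r a) b)
      (fun c d _ _ => horner (iha c) (ihb d)) p) p

/-- Multiplication by a constant. -/
def smul (q : ℤ) (p : HPoly) : HPoly :=
  HPoly.rec (fun r => const (Int.mul q r)) (fun _ _ iha ihb => horner iha ihb) p

/-- Application of a map to the coefficients with respect to the first variable. -/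
def mapCoeff (φ : HPoly → HPoly) (p : HPoly) : HPoly :=
  HPoly.rec (fun r => node (φ (const r)) (const 0)) (fun a _ _ ihb => node (φ a) ihb) p

/-- Multiplication by the first variable. -/
def shift (p : HPoly) : HPoly := node (const 0) p

/-- Multiplication. -/
def mul (p : HPoly) : HPoly → HPoly :=
  HPoly.rec (motive := fun _ => HPoly → HPoly)
    (fun q p => cond (intIsZero q) (const 0) (smul q p))
    (fun _ _ iha ihb p => cond (isConstZero p) (const 0)
      (add (mapCoeff iha p) (shift (ihb p)))) p

/-- The variable of index `i`. -/
def var : ℕ → HPoly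
  | 0 => horner (const 0) (const 1)
  | i + 1 => horner (var i) (const 0)

/-- Whether all coefficients vanish. -/
def isZero (p : HPoly) : Bool := HPoly.rec intIsZero (fun _ _ iha ihb => and iha ihb) p

/-- The partial derivative with respect to the variable of index `i`. -/
def deriv (i : ℕ) (p : HPoly) : HPoly :=
  HPoly.rec (motive := fun _ => ℕ → HPoly) (fun _ _ => const 0)
    (fun _ b iha ihb i => Nat.rec (add b (shift (ihb 0))) (fun i _ => node (iha i) (ihb (i + 1))) i)
    p i

/-- The Euler derivation with weights `w`. -/
def euler (w : List ℤ) (p : HPoly) : HPoly :=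
  HPoly.rec (motive := fun _ => List ℤ → HPoly) (fun _ _ => const 0)
    (fun _ b iha ihb w => node (iha w.tail) (add (ihb w) (smul w.headI b))) p w

/-- Substitution of `σ i` for the variable of index `i`. -/
def subst (σ : ℕ → HPoly) : ℕ → HPoly → HPoly
  | _, const q => const q
  | k, horner a b => add (subst σ (k + 1) a) (mul (σ k) (subst σ k b))

/-- The monomial with coefficient `q` and the given exponents. -/
def monomial (q : ℤ) : List ℕ → HPoly
  | [] => const q
  | e :: es => shift^[e] (node (monomial q es) (const 0))

/-- The polynomial with the given coefficients and exponents. -/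
def ofTerms : List (ℤ × List ℕ) → HPoly
  | [] => const 0
  | (q, es) :: l => add (monomial q es) (ofTerms l)

/-- Whether all monomials have degree `d` with respect to the weights `w`. -/
def isHomogeneous : List ℕ → ℕ → HPoly → Bool
  | _, d, const q => Nat.beq d 0 || intIsZero q
  | w, d, horner a b =>
    isHomogeneous w.tail d a &&
      (isZero b || (decide (w.headI ≤ d) && isHomogeneous w (d - w.headI) b))

section eval

variable {R : Type*} [CommRing R] (ρ : ℕ → R)

@[simp] lemma eval_const (k : ℕ) (q : ℤ) : eval ρ k (const q) = (q : R) := rfl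

@[simp] lemma eval_horner (k : ℕ) (a b : HPoly) :
    eval ρ k (horner a b) = eval ρ (k + 1) a + ρ k * eval ρ k b := rfl

lemma eq_zero_of_intIsZero {q : ℤ} (h : intIsZero q = true) : q = 0 := by
  cases q with
  | ofNat n => simpa [intIsZero] using h
  | negSucc n => simp [intIsZero] at h

lemma eq_of_isConstZero {p : HPoly} (h : isConstZero p = true) : p = const 0 := by
  cases p with
  | const q => rw [eq_zero_of_intIsZero h]
  | horner a b => simp [isConstZero] at h

@[simp] lemma eval_node (k : ℕ) (a b : HPoly) :
    eval ρ k (node a b) = eval ρ (k + 1) a + ρ k * eval ρ k b := by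
  unfold node
  cases hb : isConstZero b
  · rfl
  · cases ha : isConstZero a
    · rfl
    · simp [eq_of_isConstZero ha, eq_of_isConstZero hb]

@[simp] lemma eval_addConst (q : ℤ) (k : ℕ) (p : HPoly) :
    eval ρ k (addConst q p) = (q : R) + eval ρ k p := by
  unfold addConst
  cases hq : intIsZero q
  · rw [cond_false]
    induction p generalizing k with
    | const r => exact Int.cast_add q r
    | horner a b iha _ => simp only [eval_horner, iha, add_assoc]
  · simp [eq_zero_of_intIsZero hq]

@[simp] lemma eval_add (k : ℕ) (p q : HPoly) : eval ρ k (add p q) = eval ρ k p + eval ρ k q := by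
  induction p generalizing k q with
  | const r => exact eval_addConst ρ r k q
  | horner a b iha ihb =>
    cases q with
    | const r =>
      change eval ρ k (horner (addConst r a) b) = _
      simp; ring
    | horner c d =>
      change eval ρ k (horner (add a c) (add b d)) = _
      simp [iha, ihb]; ring

@[simp] lemma eval_smul (q : ℤ) (k : ℕ) (p : HPoly) :
    eval ρ k (smul q p) = (q : R) * eval ρ k p := by
  induction p generalizing k with
  | const r => exact Int.cast_mul q r
  | horner a b iha ihb =>
    change eval ρ k (horner (smul q a) (smul q b)) = _
    simp [iha, ihb]; ring

@[simp] lemma eval_shift (k : ℕ) (p : HPoly) : eval ρ k (shift p) = ρ k * eval ρ k p := by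
  simp [shift]

/-- The coefficients are polynomials in the later variables, read one level deeper, so multiplying
each of them by `c` commutes with the powers of the first variable. This is the inductive step for
products. -/
lemma eval_mapCoeff {φ : HPoly → HPoly} {c : R} {k : ℕ}
    (h : ∀ p, eval ρ (k + 1) (φ p) = c * eval ρ (k + 1) p) (p : HPoly) :
    eval ρ k (mapCoeff φ p) = c * eval ρ k p := by
  induction p with
  | const r =>
    change eval ρ k (node (φ (const r)) (const 0)) = _
    simp [h]
  | horner a b _ ihb =>
    change eval ρ k (node (φ a) (mapCoeff φ b)) = _
    simp [h, ihb]; ring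

@[simp] lemma eval_mul (k : ℕ) (p q : HPoly) : eval ρ k (mul p q) = eval ρ k p * eval ρ k q := by
  induction p generalizing k q with
  | const r =>
    change eval ρ k (cond (intIsZero r) (const 0) (smul r q)) = _
    cases hr : intIsZero r
    · simp
    · simp [eq_zero_of_intIsZero hr]
  | horner a b iha ihb =>
    change eval ρ k (cond (isConstZero q) (const 0) (add (mapCoeff (mul a) q) (shift (mul b q)))) = _
    cases hq : isConstZero q
    · simp [eval_mapCoeff ρ (iha (k + 1)), ihb]; ring
    · simp [eq_of_isConstZero hq]

@[simp] lemma eval_var (k i : ℕ) : eval ρ k (var i) = ρ (k + i) := by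
  induction i generalizing k with
  | zero => simp [var]
  | succ i ih => simp [var, ih]; congr 1; omega

lemma eval_of_isZero (k : ℕ) (p : HPoly) (h : isZero p = true) : eval ρ k p = 0 := by
  induction p generalizing k with
  | const r => simp [eq_zero_of_intIsZero h]
  | horner a b iha ihb =>
    have h' : isZero a = true ∧ isZero b = true := by simpa [isZero] using h
    simp [iha _ h'.1, ihb _ h'.2]

-- The level `k` only selects which `σ i` are inserted; the result is always read at level `0`.
@[simp] lemma eval_subst (σ : ℕ → HPoly) (k : ℕ) (p : HPoly) :
    eval ρ 0 (subst σ k p) = eval (fun i => eval ρ 0 (σ i)) k p := by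
  induction p generalizing k with
  | const r => simp [subst]
  | horner a b iha ihb => simp [subst, iha, ihb]

lemma eval_shift_iterate (k e : ℕ) (p : HPoly) :
    eval ρ k (shift^[e] p) = ρ k ^ e * eval ρ k p := by
  induction e with
  | zero => simp
  | succ e ih => rw [Function.iterate_succ_apply', eval_shift, ih]; ring

@[simp] lemma eval_monomial_nil (k : ℕ) (q : ℤ) :
    eval ρ k (monomial q []) = (q : R) := rfl

@[simp] lemma eval_monomial_cons (k : ℕ) (q : ℤ) (e : ℕ) (es : List ℕ) :
    eval ρ k (monomial q (e :: es)) = ρ k ^ e * eval ρ (k + 1) (monomial q es) := by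
  simp [monomial, eval_shift_iterate]

@[simp] lemma eval_ofTerms_nil (k : ℕ) : eval ρ k (ofTerms []) = 0 := by simp [ofTerms]

@[simp] lemma eval_ofTerms_cons (k : ℕ) (t : ℤ × List ℕ) (l : List (ℤ × List ℕ)) :
    eval ρ k (ofTerms (t :: l)) = eval ρ k (monomial t.1 t.2) + eval ρ k (ofTerms l) := by
  simp [ofTerms]

lemma map_eval {S : Type*} [CommRing S] (f : R →+* S) (k : ℕ) (p : HPoly) :
    f (eval ρ k p) = eval (fun i => f (ρ i)) k p := by
  induction p generalizing k with
  | const r => simp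
  | horner a b iha ihb => simp [iha, ihb]

/-- Serves two purposes: the scaling of coordinates and parameters, and, with weight one on a single
variable and degree zero, the proof that this variable does not occur. -/
lemma eval_of_isHomogeneous (w : ℕ → ℕ) (μ : R) (k d : ℕ) (l : List ℕ) (p : HPoly)
    (hl : ∀ i, l.getD i 0 = w (k + i)) (h : isHomogeneous l d p = true) :
    eval (fun i => μ ^ w i * ρ i) k p = μ ^ d * eval ρ k p := by
  induction p generalizing k d l with
  | const r =>
    rcases (by simpa [isHomogeneous] using h : d = 0 ∨ intIsZero r = true) with rfl | h
    · simp
    · simp [eq_zero_of_intIsZero h]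
  | horner a b iha ihb =>
    simp only [isHomogeneous, Bool.and_eq_true, Bool.or_eq_true, decide_eq_true_eq] at h
    have hw : l.headI = w k := by
      have := hl 0
      rw [add_zero] at this
      rw [← this]
      cases l <;> rfl
    have ht : ∀ i, l.tail.getD i 0 = w (k + 1 + i) := fun i => by
      have := hl (i + 1)
      rw [show k + 1 + i = k + (i + 1) by ring, ← this]
      cases l <;> simp
    rw [eval_horner, eval_horner, iha _ _ _ ht h.1]
    rcases h.2 with h0 | ⟨h1, h2⟩
    · simp [eval_of_isZero _ _ _ h0]
    · rw [ihb _ _ _ hl h2, hw] at *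
      -- The truncated difference `d - w k` is a true one, by the check `w.headI ≤ d`.
      rw [show μ ^ d = μ ^ w k * μ ^ (d - w k) by rw [← pow_add]; congr 1; omega]
      ring

end eval
end HPoly

/-! ### Matrices with polynomial entries and their values. -/

/-- Matrices of polynomials, as lists of rows; missing entries are zero. -/
abbrev HMat := List (List HPoly)

namespace HMat
open HPoly

/-- Addition of rows. -/
def addRow : List HPoly → List HPoly → List HPoly
  | [], s => s
  | r, [] => r
  | p :: r, q :: s => p.add q :: addRow r s

/-- The combination of the rows of a matrix with the given coefficients. -/
def comb : List HPoly → HMat → List HPoly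
  | p :: v, r :: A => addRow (r.map p.mul) (comb v A)
  | _, _ => []

/-- The product of matrices. -/
def mul (A B : HMat) : HMat := A.map fun r => comb r B

/-- The sum of matrices. -/
def add : HMat → HMat → HMat
  | [], B => B
  | A, [] => A
  | r :: A, s :: B => addRow r s :: add A B

/-- The multiple of a matrix by a polynomial. -/
def smul (p : HPoly) (A : HMat) : HMat := A.map fun r => r.map p.mul

/-- Scalar matrices. -/
def scalar (p : HPoly) : ℕ → HMat
  | 0 => []
  | n + 1 => [p] :: (scalar p n).map fun r => const 0 :: r

/-- Substitution in the entries. -/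
def subst (σ : ℕ → HPoly) (A : HMat) : HMat := A.map fun r => r.map (HPoly.subst σ 0)

/-- The entry at the given place. -/
def entry (A : HMat) (i j : ℕ) : HPoly := (A.getD i []).getD j (const 0)

/-- Whether all entries are zero. -/
def isZero (A : HMat) : Bool := A.all fun r => r.all HPoly.isZero

/-- The matrix of size `n` of the values of the entries. -/
def toMatrix {R : Type*} [CommRing R] (n : ℕ) (ρ : ℕ → R) (A : HMat) :
    Matrix (Fin n) (Fin n) R :=
  Matrix.of fun i j => (A.entry i j).eval ρ 0

section

variable {R : Type*} [CommRing R] (n : ℕ) (ρ : ℕ → R)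

lemma toMatrix_apply (A : HMat) (i j : Fin n) :
    toMatrix n ρ A i j = (A.entry i j).eval ρ 0 := rfl

lemma eval_getD_addRow (r s : List HPoly) (j : ℕ) :
    ((addRow r s).getD j (const 0)).eval ρ 0 =
      (r.getD j (const 0)).eval ρ 0 + (s.getD j (const 0)).eval ρ 0 := by
  induction r generalizing s j with
  | nil => simp [addRow]
  | cons p r ih =>
    cases s with
    | nil => simp [addRow]
    | cons q s =>
      cases j with
      | zero => simp [addRow]
      | succ j => simpa [addRow] using ih s j

/-- The condition `c 0 = 0` takes care of indices out of range, where both sides read the default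
entry zero. -/
lemma eval_getD_map (f : HPoly → HPoly) (c : R → R) (hc : c 0 = 0)
    (h : ∀ p, (f p).eval ρ 0 = c (p.eval ρ 0)) (r : List HPoly) (j : ℕ) :
    ((r.map f).getD j (const 0)).eval ρ 0 = c ((r.getD j (const 0)).eval ρ 0) := by
  by_cases hj : j < r.length
  · simp [hj, h]
  · simp [not_lt.1 hj, hc]

lemma eval_getD_comb (v : List HPoly) (A : HMat) (hA : A.length ≤ n) (j : ℕ) :
    ((comb v A).getD j (const 0)).eval ρ 0 =
      ∑ k ∈ Finset.range n, (v.getD k (const 0)).eval ρ 0 * (A.entry k j).eval ρ 0 := by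
  induction A generalizing v n with
  | nil => cases v <;> simp [comb, entry]
  | cons r A ih =>
    obtain ⟨n, rfl⟩ : ∃ m, n = m + 1 := ⟨n - 1, by simp at hA; omega⟩
    cases v with
    | nil => simp [comb]
    | cons p v =>
      rw [comb, eval_getD_addRow, ih n v (by simpa using hA), Finset.sum_range_succ', add_comm,
        eval_getD_map ρ p.mul (fun x => p.eval ρ 0 * x) (by simp) (by simp)]
      simp [entry]

lemma getD_map_nil (f : List HPoly → List HPoly) (hf : f [] = []) (A : HMat) (i : ℕ) :
    (A.map f).getD i [] = f (A.getD i []) := by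
  by_cases hi : i < A.length
  · simp [hi]
  · simp [not_lt.1 hi, hf]

/-- Only `B` needs a bound on its rows: `comb` would use rows of `B` that truncation to size `n`
forgets, while superfluous rows of `A` do no harm. -/
lemma toMatrix_mul (A B : HMat) (hB : B.length ≤ n) :
    toMatrix n ρ (A.mul B) = toMatrix n ρ A * toMatrix n ρ B := by
  ext i j
  rw [Matrix.mul_apply, toMatrix_apply, entry, mul,
    getD_map_nil _ (by cases B <;> rfl), eval_getD_comb n ρ _ _ hB, Finset.sum_range]
  rfl

lemma toMatrix_add (A B : HMat) : toMatrix n ρ (A.add B) = toMatrix n ρ A + toMatrix n ρ B := by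
  have key : ∀ (A B : HMat) (i j : ℕ), ((A.add B).entry i j).eval ρ 0 =
      (A.entry i j).eval ρ 0 + (B.entry i j).eval ρ 0 := by
    intro A
    induction A with
    | nil => simp [add, entry]
    | cons r A ih =>
      intro B i j
      cases B with
      | nil => simp [add, entry]
      | cons s B =>
        cases i with
        | zero => simpa [add, entry] using eval_getD_addRow ρ r s j
        | succ i => simpa [add, entry] using ih B i j
  ext i j
  exact key A B i j

lemma toMatrix_smul (p : HPoly) (A : HMat) :
    toMatrix n ρ (A.smul p) = p.eval ρ 0 • toMatrix n ρ A := by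
  ext i j
  rw [Matrix.smul_apply, toMatrix_apply, toMatrix_apply, entry, smul, entry,
    getD_map_nil _ List.map_nil,
    eval_getD_map ρ p.mul (fun x => p.eval ρ 0 * x) (by simp) (by simp), smul_eq_mul]

lemma toMatrix_scalar (p : HPoly) :
    toMatrix n ρ (scalar p n) = p.eval ρ 0 • (1 : Matrix (Fin n) (Fin n) R) := by
  have key : ∀ n i j, i < n →
      ((scalar p n).entry i j).eval ρ 0 = if i = j then p.eval ρ 0 else 0 := by
    intro n
    induction n with
    | zero => simp
    | succ n ih =>
      intro i j hi
      cases i with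
      | zero => cases j <;> simp [scalar, entry]
      | succ i =>
        have hl : i < (scalar p n).length := by
          have : ∀ m, (scalar p m).length = m := fun m => by
            induction m with
            | zero => rfl
            | succ m ih => simp [scalar, ih]
          rw [this]; omega
        cases j with
        | zero => simp [scalar, entry, hl]
        | succ j => simpa [scalar, entry, hl] using ih i j (by omega)
  ext i j
  rw [toMatrix_apply, key n i j i.2]
  simp [Matrix.one_apply, Fin.ext_iff]

lemma toMatrix_subst (σ : ℕ → HPoly) (A : HMat) :
    toMatrix n ρ (A.subst σ) = toMatrix n (fun i => (σ i).eval ρ 0) A := by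
  ext i j
  rw [toMatrix_apply, toMatrix_apply, entry, subst, entry, getD_map_nil _ List.map_nil]
  by_cases hj : (j : ℕ) < (A.getD i []).length
  · rw [List.getD_eq_getElem _ _ (by simpa using hj), List.getElem_map, List.getD_eq_getElem _ _ hj,
      eval_subst]
  · rw [List.getD_eq_default _ _ (by simpa using hj), List.getD_eq_default _ _ (not_lt.1 hj)]
    rfl

lemma toMatrix_eq_zero (A : HMat) (h : A.isZero = true) : toMatrix n ρ A = 0 := by
  ext i j
  rw [toMatrix_apply, Matrix.zero_apply]
  apply eval_of_isZero
  simp only [isZero, List.all_eq_true] at h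
  unfold entry
  by_cases hi : (i : ℕ) < A.length
  · rw [List.getD_eq_getElem _ _ hi]
    by_cases hj : (j : ℕ) < A[(i : ℕ)].length
    · rw [List.getD_eq_getElem _ _ hj]
      exact h _ (List.getElem_mem _) _ (List.getElem_mem _)
    · rw [List.getD_eq_default _ _ (not_lt.1 hj)]; rfl
  · rw [List.getD_eq_default _ _ (not_lt.1 hi)]; rfl

lemma map_toMatrix {S : Type*} [CommRing S] (f : R →+* S) (A : HMat) :
    (toMatrix n ρ A).map f = toMatrix n (fun i => f (ρ i)) A := by
  ext i j
  exact map_eval ρ f 0 _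

end

end HMat

end

/-! ### Directional derivatives and the Euler derivation on polynomials. -/

noncomputable section

namespace HPoly

/-- The derivative of a polynomial in the direction `δ`. -/
def dirDeriv {R : Type*} [CommRing R] (ρ δ : ℕ → R) : ℕ → HPoly → R
  | _, const _ => 0
  | k, horner a b =>
    dirDeriv ρ δ (k + 1) a + (δ k * eval ρ k b + ρ k * dirDeriv ρ δ k b)

section

variable {R : Type*} [CommRing R] (ρ δ : ℕ → R)

lemma eval_deriv_zero_horner (k : ℕ) (a b : HPoly) :
    eval ρ k (deriv 0 (horner a b)) = eval ρ k b + ρ k * eval ρ k (deriv 0 b) := by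
  change eval ρ k (add b (shift (deriv 0 b))) = _
  simp

lemma eval_deriv_succ_horner (k i : ℕ) (a b : HPoly) :
    eval ρ k (deriv (i + 1) (horner a b)) =
      eval ρ (k + 1) (deriv i a) + ρ k * eval ρ k (deriv (i + 1) b) := by
  change eval ρ k (node (deriv i a) (deriv (i + 1) b)) = _
  simp

/-- The chain rule, by the product rule on `a + x_k b`. The vanishing of `δ` from `k + N` on makes
the sum finite. -/
lemma dirDeriv_eq_sum (k N : ℕ) (p : HPoly) (hδ : ∀ i, k + N ≤ i → δ i = 0) :
    dirDeriv ρ δ k p = ∑ i ∈ Finset.range N, δ (k + i) * eval ρ k (deriv i p) := by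
  induction p generalizing k N with
  | const q =>
    symm
    exact Finset.sum_eq_zero fun i _ => by
      rw [show deriv i (const q) = const 0 from rfl]; simp
  | horner a b iha ihb =>
    cases N with
    | zero =>
      rw [dirDeriv, ihb k 0 hδ, iha (k + 1) 0 (fun i hi => hδ i (by omega)), hδ k (by omega)]
      simp
    | succ N =>
      rw [dirDeriv, ihb k (N + 1) hδ, iha (k + 1) N (fun i hi => hδ i (by omega)),
        Finset.sum_range_succ', Finset.sum_range_succ']
      simp only [eval_deriv_zero_horner, eval_deriv_succ_horner, mul_add, Finset.sum_add_distrib,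
        Finset.mul_sum, add_zero, show ∀ i, k + 1 + i = k + (i + 1) from fun i => by ring]
      have : ∀ i, ρ k * (δ (k + (i + 1)) * eval ρ k (deriv (i + 1) b)) =
          δ (k + (i + 1)) * (ρ k * eval ρ k (deriv (i + 1) b)) := fun i => by ring
      simp only [this]
      ring

/-- The Euler field is the direction whose components are the weights times the variables. The
factor `h` clears the denominators of the weights, so that `euler` needs integers only. -/
lemma mul_dirDeriv_eq_euler (h : R) (k : ℕ) (W : List ℤ) (p : HPoly)
    (hδ : ∀ i, h * δ (k + i) = (W.getD i 0 : ℤ) * ρ (k + i)) :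
    h * dirDeriv ρ δ k p = eval ρ k (euler W p) := by
  induction p generalizing k W with
  | const q =>
    rw [show euler W (const q) = const 0 from rfl]
    simp [dirDeriv]
  | horner a b iha ihb =>
    change _ = eval ρ k (node (euler W.tail a) (add (euler W b) (smul W.headI b)))
    have h0 : h * δ k = (W.headI : ℤ) * ρ k := by
      have := hδ 0
      rw [add_zero] at this
      rw [this]
      cases W <;> rfl
    have ht : ∀ i, h * δ (k + 1 + i) = (W.tail.getD i 0 : ℤ) * ρ (k + 1 + i) := fun i => by
      rw [show k + 1 + i = k + (i + 1) by ring, hδ (i + 1)]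
      cases W <;> simp
    rw [eval_node, eval_add, eval_smul, ← iha (k + 1) W.tail ht, ← ihb k W hδ, dirDeriv]
    linear_combination eval ρ k b * h0

end

/-- The variables are themselves functions of `x`, because one of them will be a branch of the
algebraic function `z`. -/
lemma hasFDerivAt_eval {E : Type*} [NormedAddCommGroup E] [NormedSpace ℂ E] {ρ : E → ℕ → ℂ}
    {ρ' : ℕ → E →L[ℂ] ℂ} {x : E} (h : ∀ i, HasFDerivAt (fun y => ρ y i) (ρ' i) x) (k : ℕ)
    (p : HPoly) :
    ∃ A : E →L[ℂ] ℂ, HasFDerivAt (fun y => eval (ρ y) k p) A x ∧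
      ∀ d, A d = dirDeriv (ρ x) (fun i => ρ' i d) k p := by
  induction p generalizing k with
  | const q => exact ⟨0, hasFDerivAt_const _ _, fun d => rfl⟩
  | horner a b iha ihb =>
    obtain ⟨A, hA, hA'⟩ := iha (k + 1)
    obtain ⟨B, hB, hB'⟩ := ihb k
    refine ⟨_, hA.add ((h k).mul hB), fun d => ?_⟩
    simp only [_root_.add_apply, _root_.smul_apply, smul_eq_mul, hA',
      hB', dirDeriv]
    ring

end HPoly

open HPoly

/-! ### Potentials involving an algebraic function, and their discriminants. -/

/-- The assignment of `x` to the first `n` variables and of `z` to the next one. -/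
def slots {n : ℕ} {R : Type*} [Zero R] (x : Fin n → R) (z : R) (i : ℕ) : R :=
  if h : i < n then x ⟨i, h⟩ else if i = n then z else 0

lemma slots_val {n : ℕ} {R : Type*} [Zero R] (x : Fin n → R) (z : R) (i : Fin n) :
    slots x z i = x i := by simp [slots]

lemma slots_self {n : ℕ} {R : Type*} [Zero R] (x : Fin n → R) (z : R) : slots x z n = z := by
  simp [slots]

lemma slots_of_lt {n : ℕ} {R : Type*} [Zero R] (x : Fin n → R) (z : R) {i : ℕ} (h : n < i) :
    slots x z i = 0 := by
  simp [slots, h.not_gt, h.ne']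

lemma map_slots {R S : Type*} [CommRing R] [CommRing S] {n : ℕ} (f : R →+* S) (x : Fin n → R) (z : R)
    (i : ℕ) : f (slots x z i) = slots (fun k => f (x k)) (f z) i := by
  unfold slots
  split_ifs <;> simp

lemma HMat.entry_map_range (n : ℕ) (f : ℕ → ℕ → HPoly) (i j : Fin n) :
    HMat.entry ((List.range n).map fun i => (List.range n).map fun j => f i j) i j = f i j := by
  simp [HMat.entry]

/-- The entries of the Hessian of `Q + c z ^ 5`. -/
def hessianEntry (n : ℕ) (β γ : ℤ) (Q r : HPoly) (i j : ℕ) : HPoly :=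
  add (deriv i (deriv j Q))
    (mul (var n) (add (smul β (mul (mul (var n) (var n)) (deriv i (deriv j r))))
      (smul γ (mul (deriv i r) (deriv j r)))))

/-- A multiple of the matrix `T` of a potential `F = Q + c z ^ 5`, where `z ^ 2 = x_m - v`. The
polynomials `Q` and `r` are multiples of the polynomial part of `F` and of `x_m - v`, and the
variable of index `n` stands for `z`. -/
def eulerMatrix (n : ℕ) (β γ : ℤ) (Q r : HPoly) (W : List ℤ) : HMat :=
  (List.range n).map fun i => (List.range n).map fun j =>
    euler W (hessianEntry n β γ Q r i (n - 1 - j))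

lemma fderiv_apply_eq_sum {n : ℕ} (A : (Fin n → ℂ) →L[ℂ] ℂ) (d : Fin n → ℂ) :
    A d = ∑ k, d k * A (Pi.single k 1) := by
  conv_lhs => rw [pi_eq_sum_univ' d]
  simp only [map_sum, map_smul, smul_eq_mul]

lemma euler_eq_fderiv {n : ℕ} (w : Fin n → ℂ) (F : (Fin n → ℂ) → ℂ) (x : Fin n → ℂ) :
    euler w F x = fderiv ℂ F x (fun k => w k * x k) := by
  rw [fderiv_apply_eq_sum]; rfl

section

variable {n : ℕ} {U : Set (Fin n → ℂ)} {ζ : (Fin n → ℂ) → ℂ}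

lemma hasFDerivAt_slots (hU : IsOpen U) (hζ : DifferentiableOn ℂ ζ U) {x : Fin n → ℂ}
    (hx : x ∈ U) (i : ℕ) :
    ∃ A : (Fin n → ℂ) →L[ℂ] ℂ, HasFDerivAt (fun y => slots y (ζ y) i) A x ∧
      ∀ d, A d = slots d (fderiv ℂ ζ x d) i := by
  unfold slots
  by_cases h : i < n
  · refine ⟨ContinuousLinearMap.proj ⟨i, h⟩, ?_, fun d => by simp [h]⟩
    simp only [h, dif_pos]
    exact (ContinuousLinearMap.proj (R := ℂ) (φ := fun _ : Fin n => ℂ) ⟨i, h⟩).hasFDerivAt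
  · by_cases h' : i = n
    · refine ⟨fderiv ℂ ζ x, ?_, fun d => by simp [h']⟩
      simp only [h', lt_irrefl, dif_neg, not_false_eq_true, if_true]
      exact (hζ.differentiableAt (hU.mem_nhds hx)).hasFDerivAt
    · refine ⟨0, ?_, fun d => by simp [h, h']⟩
      simp only [h, h', dif_neg, not_false_eq_true, if_false]
      exact hasFDerivAt_const _ _

/-- The derivative of a polynomial in `x` and in a branch `ζ`. -/
lemma hasFDerivAt_eval_slots (hU : IsOpen U) (hζ : DifferentiableOn ℂ ζ U) {x : Fin n → ℂ}
    (hx : x ∈ U) (p : HPoly) :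
    ∃ A : (Fin n → ℂ) →L[ℂ] ℂ, HasFDerivAt (fun y => eval (slots y (ζ y)) 0 p) A x ∧
      ∀ d, A d = dirDeriv (slots x (ζ x)) (slots d (fderiv ℂ ζ x d)) 0 p := by
  choose A hA hA' using fun i => hasFDerivAt_slots hU hζ hx i
  obtain ⟨B, hB, hB'⟩ := hasFDerivAt_eval hA 0 p
  exact ⟨B, hB, fun d => by rw [hB', show (fun i => A i d) = slots d (fderiv ℂ ζ x d) from
    funext fun i => hA' i d]⟩

lemma dirDeriv_slots (ρ : ℕ → ℂ) (d : Fin n → ℂ) (e : ℂ) (p : HPoly) :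
    dirDeriv ρ (slots d e) 0 p =
      (∑ i : Fin n, d i * eval ρ 0 (deriv i p)) + e * eval ρ 0 (deriv n p) := by
  rw [dirDeriv_eq_sum ρ _ 0 (n + 1) p (fun i hi => slots_of_lt d e (by omega)),
    Finset.sum_range_succ, Finset.sum_range]
  simp [slots_self, slots_val]

lemma dirDeriv_slots_single (ρ : ℕ → ℂ) (i : Fin n) (e : ℂ) (p : HPoly) :
    dirDeriv ρ (slots (Pi.single i 1) e) 0 p =
      eval ρ 0 (deriv i p) + e * eval ρ 0 (deriv n p) := by
  rw [dirDeriv_slots, Finset.sum_eq_single i (fun j _ hj => by simp [hj]) (by simp)]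
  simp

/-- The data of an algebraic potential `G(x, z) = L⁻¹ Q + c z ^ 5` with `z ^ 2 = x_m - v`, where
`r = b (x_m - v)`, and the weights `w_k = W_k / h`. -/
structure PotentialData (n : ℕ) (m : Fin n) (w : Fin n → ℂ) (v : (Fin n → ℂ) → ℂ)
    (G : (Fin n → ℂ) → ℂ → ℂ) where
  (Q r : HPoly)
  (W : List ℤ)
  (L b β γ h W' : ℤ)
  L_ne : L ≠ 0
  b_ne : b ≠ 0
  h_ne : h ≠ 0
  two_b_mul_γ : 2 * b * γ = 3 * β
  -- The coefficient of `z ^ 5` in `G` is `2 b β / (5 L)`; this normalization makes `β` the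
  -- coefficient of `z ^ 3 ∂r` in `L` times the first derivatives.
  eval_Q : ∀ x z, 5 * (L * G x z) = 5 * eval (slots x z) 0 Q + 2 * b * β * z ^ 5
  eval_r : ∀ x z, eval (slots x z) 0 r = b * (x m - v x)
  v_update : ∀ x y, v (Function.update x m y) = v x
  weight : ∀ k : Fin n, (h : ℂ) * w k = (W.getD k 0 : ℤ)
  weight_z : W.getD n 0 = W'
  weight_r : isZero (HPoly.add (euler W r) (smul (-2 * W') r)) = true
  deriv_r : isZero (HPoly.add (HPoly.deriv m r) (const (-b))) = true
  deriv_z_Q : isZero (HPoly.deriv n Q) = true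
  deriv_z_r : isZero (HPoly.deriv n r) = true
  deriv_z_deriv_Q : ∀ i < n, isZero (HPoly.deriv n (HPoly.deriv i Q)) = true
  deriv_z_deriv_r : ∀ i < n, isZero (HPoly.deriv n (HPoly.deriv i r)) = true

namespace PotentialData

variable {m : Fin n} {w : Fin n → ℂ} {v : (Fin n → ℂ) → ℂ} {G : (Fin n → ℂ) → ℂ → ℂ}
  (D : PotentialData n m w v G)

include D

/-- Implicit differentiation of `b ζ ^ 2 = r(x)`, kept in the form without division by `ζ`. -/
lemma fderiv_branch_apply (hU : IsOpen U) (hζ : DifferentiableOn ℂ ζ U)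
    (h : ∀ x ∈ U, v x - x m + ζ x ^ 2 = 0) {x : Fin n → ℂ} (hx : x ∈ U) (d : Fin n → ℂ) :
    2 * D.b * ζ x * fderiv ℂ ζ x d = dirDeriv (slots x (ζ x)) (slots d (fderiv ℂ ζ x d)) 0 D.r := by
  obtain ⟨A, hA, hA'⟩ := hasFDerivAt_eval_slots hU hζ hx D.r
  have hz := ((hζ.differentiableAt (hU.mem_nhds hx)).hasFDerivAt.pow 2).const_mul (D.b : ℂ)
  have heq : (fun y => eval (slots y (ζ y)) 0 D.r) =ᶠ[nhds x] fun y => (D.b : ℂ) * ζ y ^ 2 := by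
    filter_upwards [hU.mem_nhds hx] with y hy
    rw [D.eval_r]
    linear_combination (-D.b : ℂ) * h y hy
  rw [← hA', hA.unique (hz.congr_of_eventuallyEq heq)]
  simp
  ring

lemma fderiv_branch_single (hU : IsOpen U) (hζ : DifferentiableOn ℂ ζ U)
    (h : ∀ x ∈ U, v x - x m + ζ x ^ 2 = 0) {x : Fin n → ℂ} (hx : x ∈ U) (i : Fin n) :
    2 * D.b * ζ x * fderiv ℂ ζ x (Pi.single i 1) = eval (slots x (ζ x)) 0 (HPoly.deriv i D.r) := by
  rw [D.fderiv_branch_apply hU hζ h hx, dirDeriv_slots_single,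
    eval_of_isZero _ _ _ D.deriv_z_r, mul_zero, add_zero]

/-- As `∂r/∂x_m = b`, the derivative in the direction `x_m` reads `2 b ζ ∂_m ζ = b ≠ 0`: a
holomorphic branch over an open set avoids the ramification locus. -/
lemma branch_ne_zero (hU : IsOpen U) (hζ : DifferentiableOn ℂ ζ U)
    (h : ∀ x ∈ U, v x - x m + ζ x ^ 2 = 0) {x : Fin n → ℂ} (hx : x ∈ U) : ζ x ≠ 0 := by
  intro h0
  have h1 := D.fderiv_branch_single hU hζ h hx m
  have h2 := eval_of_isZero (slots x (ζ x)) 0 _ D.deriv_r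
  simp only [HPoly.eval_add, eval_const, Int.cast_neg] at h2
  rw [h0] at h1 h2
  have : (D.b : ℂ) = 0 := by linear_combination -h2 - h1
  exact D.b_ne (by exact_mod_cast this)

/-- The derivative of the potential. -/
lemma partialD_potential (hU : IsOpen U) (hζ : DifferentiableOn ℂ ζ U)
    (h : ∀ x ∈ U, v x - x m + ζ x ^ 2 = 0) {x : Fin n → ℂ} (hx : x ∈ U) (j : Fin n) :
    D.L * partialD j (fun y => G y (ζ y)) x =
      eval (slots x (ζ x)) 0 (HPoly.deriv j D.Q) +
        D.β * ζ x ^ 3 * eval (slots x (ζ x)) 0 (HPoly.deriv j D.r) := by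
  obtain ⟨A, hA, hA'⟩ := hasFDerivAt_eval_slots hU hζ hx D.Q
  -- With this coefficient, `∂_j ((2 b β / 5) ζ ^ 5) = β ζ ^ 3 (2 b ζ ∂_j ζ) = β ζ ^ 3 ∂_j r`.
  have hz := ((hζ.differentiableAt (hU.mem_nhds hx)).hasFDerivAt.pow 5).const_mul
    (2 * D.b * D.β / 5 : ℂ)
  have hL : (D.L : ℂ) ≠ 0 := by exact_mod_cast D.L_ne
  have heq : (fun y => G y (ζ y)) = fun y => (D.L : ℂ)⁻¹ *
      (eval (slots y (ζ y)) 0 D.Q + (2 * D.b * D.β / 5 : ℂ) * ζ y ^ 5) := by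
    funext y
    rw [eq_inv_mul_iff_mul_eq₀ hL]
    linear_combination D.eval_Q y (ζ y) / 5
  have h1 := D.fderiv_branch_single hU hζ h hx j
  rw [partialD, heq, ((hA.fun_add hz).const_mul (D.L : ℂ)⁻¹).fderiv, ← h1]
  simp only [_root_.add_apply, _root_.smul_apply, smul_eq_mul, hA', dirDeriv_slots_single,
    eval_of_isZero _ _ _ D.deriv_z_Q]
  field_simp
  ring

/-- The second derivatives of the potential. -/
lemma partialD_partialD_potential (hU : IsOpen U) (hζ : DifferentiableOn ℂ ζ U)
    (h : ∀ x ∈ U, v x - x m + ζ x ^ 2 = 0) {x : Fin n → ℂ} (hx : x ∈ U) (i j : Fin n) :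
    D.L * partialD i (partialD j (fun y => G y (ζ y))) x =
      eval (slots x (ζ x)) 0 (hessianEntry n D.β D.γ D.Q D.r i j) := by
  obtain ⟨A, hA, hA'⟩ := hasFDerivAt_eval_slots hU hζ hx (HPoly.deriv j D.Q)
  obtain ⟨B, hB, hB'⟩ := hasFDerivAt_eval_slots hU hζ hx (HPoly.deriv j D.r)
  have hz := ((hζ.differentiableAt (hU.mem_nhds hx)).hasFDerivAt.pow 3).const_mul (D.β : ℂ)
  have hL : (D.L : ℂ) ≠ 0 := by exact_mod_cast D.L_ne
  have hb : (D.b : ℂ) ≠ 0 := by exact_mod_cast D.b_ne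
  have heq : partialD j (fun y => G y (ζ y)) =ᶠ[nhds x] fun y => (D.L : ℂ)⁻¹ *
      (eval (slots y (ζ y)) 0 (HPoly.deriv j D.Q) +
        D.β * ζ y ^ 3 * eval (slots y (ζ y)) 0 (HPoly.deriv j D.r)) := by
    filter_upwards [hU.mem_nhds hx] with y hy
    rw [eq_inv_mul_iff_mul_eq₀ hL, D.partialD_potential hU hζ h hy]
  have h1 := D.fderiv_branch_single hU hζ h hx i
  have hγ : (2 * D.b * D.γ : ℂ) = 3 * D.β := by exact_mod_cast D.two_b_mul_γ
  rw [partialD, heq.fderiv_eq, ((hA.fun_add (hz.fun_mul hB)).const_mul (D.L : ℂ)⁻¹).fderiv]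
  simp only [_root_.add_apply, _root_.smul_apply, smul_eq_mul, hA', hB', dirDeriv_slots_single,
    eval_of_isZero _ _ _ (D.deriv_z_deriv_Q j j.2), eval_of_isZero _ _ _ (D.deriv_z_deriv_r j j.2),
    hessianEntry, HPoly.eval_add, HPoly.eval_mul, eval_smul, eval_var, zero_add, slots_self, ← h1]
  -- Differentiating `β ζ ^ 3 r_j` produces `3 β ζ ^ 2 ∂_i ζ r_j = (3 β / (2 b)) ζ r_i r_j`, and
  -- this coefficient is `γ`.
  have h2 : (D.γ : ℂ) = 3 * D.β / (2 * D.b) := by field_simp; linear_combination hγ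
  rw [h2]
  field_simp
  ring

/-- The Hessian is a polynomial in `x` and `ζ`, and `E` multiplies each of these variables by its
weight, also `ζ`, because `r = b ζ ^ 2` is weighted homogeneous. Hence the analytic operator `E`
becomes the formal derivation `euler`. -/
lemma matrixT_potential (hU : IsOpen U) (hζ : DifferentiableOn ℂ ζ U)
    (h : ∀ x ∈ U, v x - x m + ζ x ^ 2 = 0) {x : Fin n → ℂ} (hx : x ∈ U) :
    matrixT w (fun y => G y (ζ y)) x = ((D.L : ℂ)⁻¹ * (D.h : ℂ)⁻¹) •
      HMat.toMatrix n (slots x (ζ x)) (eulerMatrix n D.β D.γ D.Q D.r D.W) := by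
  have hL : (D.L : ℂ) ≠ 0 := by exact_mod_cast D.L_ne
  have hh : (D.h : ℂ) ≠ 0 := by exact_mod_cast D.h_ne
  have hb : (D.b : ℂ) ≠ 0 := by exact_mod_cast D.b_ne
  have hz0 := D.branch_ne_zero hU hζ h hx
  set d : Fin n → ℂ := fun k => w k * x k with hd
  have hW : ∀ i, (D.h : ℂ) * slots d (D.W' * ζ x / D.h) i =
      (D.W.getD i 0 : ℤ) * slots x (ζ x) i := by
    intro i
    rcases lt_trichotomy i n with hi | rfl | hi
    · simp only [slots, hi, dif_pos, hd]
      rw [← mul_assoc, D.weight ⟨i, hi⟩]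
    · rw [slots_self, slots_self, D.weight_z]
      field_simp
    · rw [slots_of_lt _ _ hi, slots_of_lt _ _ hi, mul_zero, mul_zero]
  have hr : eval (slots x (ζ x)) 0 D.r = D.b * ζ x ^ 2 := by
    rw [D.eval_r]
    linear_combination (-D.b : ℂ) * h x hx
  -- Compare two values of the Euler derivative of `r`: `2 b ζ dζ(d)`, from the equation of the
  -- branch, and `2 W' b ζ ^ 2 / h`, from homogeneity of weight `2 W'`. Cancelling `2 b ζ` uses that
  -- `ζ` does not vanish.
  have hdζ : fderiv ℂ ζ x d = D.W' * ζ x / D.h := by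
    have h1 := D.fderiv_branch_apply hU hζ h hx d
    have h2 := mul_dirDeriv_eq_euler (slots x (ζ x)) _ (D.h : ℂ) 0 D.W D.r
      (by simpa only [zero_add] using hW)
    have h3 := eval_of_isZero (slots x (ζ x)) 0 _ D.weight_r
    rw [HPoly.eval_add, eval_smul, ← h2, hr] at h3
    rw [dirDeriv_slots, eval_of_isZero _ _ _ D.deriv_z_r, mul_zero, add_zero] at h1 h3
    rw [← h1] at h3
    push_cast at h3
    have h4 : (2 * D.b * ζ x) * (D.h * fderiv ℂ ζ x d - D.W' * ζ x) = 0 := by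
      linear_combination h3
    rw [mul_eq_zero_iff_left (by simp [hb, hz0])] at h4
    field_simp
    linear_combination h4
  ext i j
  have heq : (fun y => matrixC (fun y => G y (ζ y)) y i j) =ᶠ[nhds x] fun y => (D.L : ℂ)⁻¹ *
      eval (slots y (ζ y)) 0 (hessianEntry n D.β D.γ D.Q D.r i (n - 1 - j)) := by
    filter_upwards [hU.mem_nhds hx] with y hy
    rw [eq_inv_mul_iff_mul_eq₀ hL, matrixC, Matrix.of_apply,
      D.partialD_partialD_potential hU hζ h hy, Fin.val_rev]
    congr 2
    omega
  obtain ⟨A, hA, hA'⟩ := hasFDerivAt_eval_slots hU hζ hx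
    (hessianEntry n D.β D.γ D.Q D.r i (n - 1 - j))
  rw [matrixT, Matrix.of_apply, euler_eq_fderiv, heq.fderiv_eq,
    (hA.const_mul (D.L : ℂ)⁻¹).fderiv, _root_.smul_apply, hA', hdζ, Matrix.smul_apply,
    HMat.toMatrix_apply, eulerMatrix, HMat.entry_map_range,
    ← mul_dirDeriv_eq_euler (slots x (ζ x)) _ (D.h : ℂ) 0 D.W _
      (by simpa only [zero_add] using hW)]
  simp only [smul_eq_mul, ← hd]
  field_simp

/-- The values of `x` in terms of the coordinates in which `z` replaces `x_m`. -/
def point {R : Type*} [CommRing R] [Algebra ℂ R] (a : Fin n → R) : Fin n → R :=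
  Function.update a m (a m ^ 2 - algebraMap ℂ R (D.b : ℂ)⁻¹ *
    eval (slots (Function.update a m 0) 0) 0 D.r)

/-- As `v` does not involve `x_m`, the value of `r = b (x_m - v)` at `x_m = 0` is `-b v`. The
definition of `point` uses this to express `v` over any `ℂ`-algebra, in particular at the variables
themselves. -/
lemma point_eq (a : Fin n → ℂ) : D.point a = Function.update a m (a m ^ 2 + v a) := by
  have hb : (D.b : ℂ) ≠ 0 := by exact_mod_cast D.b_ne
  rw [point, D.eval_r, D.v_update, Function.update_self, Algebra.algebraMap_self_apply]
  congr 1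
  field_simp
  ring

/-- The discriminant of the potential, as a polynomial in `x` with `z` in place of `x_m`. -/
def discriminant : MvPolynomial (Fin n) ℂ :=
  C (((D.L : ℂ)⁻¹ * (D.h : ℂ)⁻¹) ^ n) *
    (HMat.toMatrix n (slots (D.point (MvPolynomial.X : Fin n → MvPolynomial (Fin n) ℂ))
      (MvPolynomial.X m)) (eulerMatrix n D.β D.γ D.Q D.r D.W)).det

lemma eval_discriminant (a : Fin n → ℂ) :
    MvPolynomial.eval a D.discriminant = ((D.L : ℂ)⁻¹ * (D.h : ℂ)⁻¹) ^ n *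
      (HMat.toMatrix n (slots (Function.update a m (a m ^ 2 + v a)) (a m))
        (eulerMatrix n D.β D.γ D.Q D.r D.W)).det := by
  have h : ∀ k, MvPolynomial.eval a (D.point (MvPolynomial.X : Fin n → MvPolynomial (Fin n) ℂ) k) =
      D.point a k := by
    intro k
    unfold point
    by_cases hk : k = m
    · subst hk
      simp only [Function.update_self, map_sub, map_mul, map_pow, eval_X, HPoly.map_eval, map_slots,
        map_zero, MvPolynomial.algebraMap_eq, eval_C, Algebra.algebraMap_self_apply]
      congr 4
      funext i
      congr 1
      funext l
      by_cases hl : l = k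
      · subst hl; simp
      · simp [hl]
    · simp [Function.update_of_ne hk]
  rw [discriminant, map_mul, eval_C, RingHom.map_det, RingHom.mapMatrix_apply, HMat.map_toMatrix,
    ← D.point_eq]
  simp only [map_slots, h, eval_X]

/-- Replacing `x_m` by `ζ` and then substituting `z ^ 2 + v` for `x_m` gives back the original
point, since `ζ ^ 2 + v = x_m` on the branch. -/
lemma isPotentialDiscriminant : IsPotentialDiscriminant w m v G D.discriminant := by
  intro U ζ hU hζ h x hx
  rw [D.matrixT_potential hU hζ h hx, Matrix.det_smul, Fintype.card_fin, D.eval_discriminant,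
    D.v_update, Function.update_idem, Function.update_self]
  congr 5
  rw [eq_comm, Function.update_eq_self_iff]
  linear_combination h x hx

end PotentialData

end

end

/-! ### Polynomials in a matrix, determinants and Krylov rows. -/

noncomputable section

open HPoly
open scoped Matrix

/-- The substitution of the members of a list for the variables. -/
def listSubst (l : List HPoly) (i : ℕ) : HPoly := l.getD i (const 0)

namespace HMat

/-- The value of the polynomial with the given coefficients at a matrix of size `n`. -/
def horner (n : ℕ) (A : HMat) : List HPoly → HMat
  | [] => []
  | p :: l => add (scalar p n) (mul A (horner n A l))

/-- Whether two matrices are equal. -/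
def eq (A B : HMat) : Bool := isZero (add A (smul (const (-1)) B))

/-- Whether the matrix of size `n` is upper triangular with the given diagonal. -/
def isTriangular (n : ℕ) (A : HMat) (q : List ℤ) : Bool :=
  (List.range n).all fun i => (List.range n).all fun j =>
    if j < i then HPoly.isZero (A.entry i j)
    else if i = j then HPoly.isZero (HPoly.add (A.entry i i) (const (-q.getD i 0))) else true

/-- Whether the entry at `(i, j)` is homogeneous of degree `h + e_i - e_j`, for all `i, j < n`. -/
def isHomogeneous (n : ℕ) (w e : List ℕ) (h : ℕ) (A : HMat) : Bool :=
  (List.range n).all fun i => (List.range n).all fun j =>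
    decide (e.getD j 0 ≤ h + e.getD i 0) &&
      HPoly.isHomogeneous w (h + e.getD i 0 - e.getD j 0) (A.entry i j)

/-- The rows `r, r A, r A ^ 2, …`. -/
def krylov (A : HMat) (r : List HPoly) : ℕ → HMat
  | 0 => []
  | k + 1 => r :: krylov A (comb r A) k

section

variable {R : Type*} [CommRing R] (n : ℕ) (ρ : ℕ → R)

lemma length_add (A B : HMat) : (A.add B).length = max A.length B.length := by
  induction A generalizing B with
  | nil => simp [add]
  | cons r A ih =>
    cases B with
    | nil => simp [add]
    | cons s B => simp [add, ih]

lemma length_scalar (p : HPoly) : (scalar p n).length = n := by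
  induction n with
  | zero => rfl
  | succ n ih => simp [scalar, ih]

lemma length_mul (A B : HMat) : (A.mul B).length = A.length := by simp [mul]

lemma length_horner_le {A : HMat} (hA : A.length ≤ n) (l : List HPoly) :
    (A.horner n l).length ≤ n := by
  cases l with
  | nil => simp [horner]
  | cons p l => simp [horner, length_add, length_scalar, length_mul, hA]

lemma toMatrix_nil : toMatrix n ρ [] = 0 := by
  ext i j
  simp [toMatrix_apply, entry]

/-- The value at `x` of the polynomial with the given coefficients. -/
def hornerVal (x : R) : List HPoly → R
  | [] => 0
  | p :: l => p.eval ρ 0 + x * hornerVal x l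

lemma toMatrix_horner_cons {A : HMat} (hA : A.length ≤ n) (p : HPoly) (l : List HPoly) :
    toMatrix n ρ (A.horner n (p :: l)) = p.eval ρ 0 • (1 : Matrix (Fin n) (Fin n) R) +
      toMatrix n ρ A * toMatrix n ρ (A.horner n l) := by
  rw [horner, toMatrix_add, toMatrix_scalar, toMatrix_mul _ _ _ _ (length_horner_le n hA l)]

lemma toMatrix_horner_mulVec {A : HMat} (hA : A.length ≤ n) (l : List HPoly) {x : R}
    {e : Fin n → R} (h : toMatrix n ρ A *ᵥ e = x • e) :
    toMatrix n ρ (A.horner n l) *ᵥ e = hornerVal ρ x l • e := by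
  induction l with
  | nil => simp [horner, hornerVal, toMatrix_nil]
  | cons p l ih =>
    rw [toMatrix_horner_cons n ρ hA, Matrix.add_mulVec, Matrix.smul_mulVec, Matrix.one_mulVec,
      ← Matrix.mulVec_mulVec, ih, Matrix.mulVec_smul, h, hornerVal, add_smul, smul_smul,
      mul_comm]

lemma commute_horner {A : HMat} (hA : A.length ≤ n) (l : List HPoly)
    {B : Matrix (Fin n) (Fin n) R} (h : Commute B (toMatrix n ρ A)) :
    Commute B (toMatrix n ρ (A.horner n l)) := by
  induction l with
  | nil => rw [horner, toMatrix_nil]; exact Commute.zero_right _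
  | cons p l ih =>
    rw [toMatrix_horner_cons n ρ hA]
    exact ((Commute.one_right _).smul_right _).add_right (h.mul_right ih)

lemma toMatrix_eq {A B : HMat} (h : A.eq B = true) : toMatrix n ρ A = toMatrix n ρ B := by
  have := toMatrix_eq_zero n ρ _ h
  rw [toMatrix_add, toMatrix_smul] at this
  simpa [add_neg_eq_zero] using this

/-- Applied to the transition matrix, whose determinant is thus a constant although its entries
above the diagonal depend on the coordinates. -/
lemma det_toMatrix_of_isTriangular {A : HMat} {q : List ℤ} (h : A.isTriangular n q = true) :
    (toMatrix n ρ A).det = ((∏ i : Fin n, q.getD i 0 : ℤ) : R) := by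
  simp only [isTriangular, List.all_eq_true, List.mem_range] at h
  rw [Matrix.det_of_isUpperTriangular, Int.cast_prod]
  · refine Finset.prod_congr rfl fun i _ => ?_
    have := h i i.2 i i.2
    rw [if_neg (lt_irrefl _), if_pos rfl] at this
    have := eval_of_isZero ρ 0 _ this
    rw [HPoly.eval_add, eval_const, Int.cast_neg] at this
    rw [toMatrix_apply]
    exact add_neg_eq_zero.1 this
  · intro i j hij
    have := h i i.2 j j.2
    rw [if_pos (by simpa using hij)] at this
    exact eval_of_isZero ρ 0 _ this

/-- Rescaling the variables amounts to multiplying by `μ ^ h` and conjugating with the diagonal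
matrix of the `μ ^ e_i`; the conjugation drops out of the determinant. -/
lemma det_toMatrix_of_isHomogeneous {A : HMat} {w e : List ℕ} {h : ℕ}
    (hA : A.isHomogeneous n w e h = true) {μ : R} (hμ : IsUnit μ) :
    (toMatrix n (fun i => μ ^ w.getD i 0 * ρ i) A).det =
      μ ^ (h * n) * (toMatrix n ρ A).det := by
  simp only [isHomogeneous, List.all_eq_true, List.mem_range, Bool.and_eq_true,
    decide_eq_true_eq] at hA
  have key : toMatrix n (fun i => μ ^ w.getD i 0 * ρ i) A *
      Matrix.diagonal (fun i : Fin n => μ ^ e.getD i 0) =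
      Matrix.diagonal (fun i : Fin n => μ ^ (h + e.getD i 0)) * toMatrix n ρ A := by
    ext i j
    obtain ⟨h1, h2⟩ := hA i i.2 j j.2
    rw [Matrix.mul_diagonal, Matrix.diagonal_mul, toMatrix_apply, toMatrix_apply,
      eval_of_isHomogeneous ρ (fun i => w.getD i 0) μ 0 _ w _ (fun i => by rw [zero_add]) h2,
      mul_right_comm, ← pow_add, Nat.sub_add_cancel h1]
  -- Both sides now contain the product of the `μ ^ e_i`, a unit that can be cancelled.
  have := congrArg Matrix.det key
  rw [Matrix.det_mul, Matrix.det_mul, Matrix.det_diagonal, Matrix.det_diagonal] at this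
  simp only [pow_add, Finset.prod_mul_distrib] at this
  rw [Finset.prod_const, Finset.card_univ, Fintype.card_fin, ← pow_mul, mul_right_comm,
    mul_comm] at this
  have hu : IsUnit (∏ i : Fin n, μ ^ e.getD i 0) := by
    rw [Finset.prod_pow_eq_pow_sum]
    exact hμ.pow _
  refine hu.mul_left_cancel ?_
  rw [this]; ring

/-- The bound on the rows of `A` is the one required by `comb`, so that each new row is the previous
one times the matrix of size `n`. -/
lemma entry_krylov (A : HMat) (hA : A.length ≤ n) (r : List HPoly) (N k : ℕ) (hk : k < N)
    (j : Fin n) :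
    ((krylov A r N).entry k j).eval ρ 0 =
      ((fun i : Fin n => (r.getD i (const 0)).eval ρ 0) ᵥ* toMatrix n ρ A ^ k) j := by
  induction N generalizing r k with
  | zero => omega
  | succ N ih =>
    cases k with
    | zero => simp [krylov, entry]
    | succ k =>
      have h1 : (krylov A r (N + 1)).entry (k + 1) j = (krylov A (comb r A) N).entry k j := by
        simp [krylov, entry]
      rw [h1, ih _ k (by omega), pow_succ', ← Matrix.vecMul_vecMul]
      congr 2
      funext i
      rw [eval_getD_comb n ρ r A hA, Finset.sum_range]
      rfl

end

end HMat

end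

/-! ### Squarefreeness by specialization to a separable polynomial. -/

noncomputable section

open HPoly
open scoped Matrix

/-! ### Squarefree polynomials -/

/-- A polynomial whose leading coefficient is a unit is squarefree if a specialization is. -/
lemma Polynomial.squarefree_of_map {R K : Type*} [CommRing R] [IsDomain R] [Field K] (f : R →+* K)
    {P : Polynomial R} (hP : IsUnit P.leadingCoeff) (h : Squarefree (P.map f)) : Squarefree P := by
  intro q hq
  obtain ⟨r, rfl⟩ := hq
  rw [Polynomial.leadingCoeff_mul, Polynomial.leadingCoeff_mul] at hP
  -- The leading coefficient of `q` divides a unit, so `q` keeps its degree under `f`. Its image is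
  -- a unit, hence of degree zero, so `q` is a constant equal to its leading coefficient.
  have hl : IsUnit q.leadingCoeff := isUnit_of_mul_isUnit_left (isUnit_of_mul_isUnit_left hP)
  have hu : IsUnit (q.map f) := h _ ⟨r.map f, by simp⟩
  have hd : (q.map f).natDegree = q.natDegree :=
    Polynomial.natDegree_map_of_leadingCoeff_ne_zero f (hl.map f).ne_zero
  rw [Polynomial.natDegree_eq_zero_of_isUnit hu] at hd
  rw [Polynomial.eq_C_of_natDegree_eq_zero hd.symm] at hl ⊢
  rw [Polynomial.leadingCoeff_C] at hl
  exact hl.map Polynomial.C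

/-- The characteristic polynomial of a matrix with a cyclic row vector `r` is the monic polynomial
`q` of the same degree such that `q` of the matrix kills `r`. -/
lemma Matrix.charpoly_eq_of_vecMul {K : Type*} [Field K] {n : ℕ} (A : Matrix (Fin n) (Fin n) K)
    (r : Fin n → K) (hr : LinearIndependent K fun k : Fin n => r ᵥ* A ^ (k : ℕ))
    {q : Polynomial K} (hm : q.Monic) (hd : q.natDegree = n)
    (h : r ᵥ* Polynomial.aeval A q = 0) : A.charpoly = q := by
  rcases Nat.eq_zero_or_pos n with rfl | hn
  · rw [Polynomial.eq_one_of_monic_natDegree_zero hm hd, Matrix.charpoly_isEmpty]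
  have hA : A.charpoly.natDegree = n := by rw [Matrix.charpoly_natDegree_eq_dim, Fintype.card_fin]
  -- The difference has degree less than `n` and, by Cayley–Hamilton, also kills `r`. Its
  -- coefficients thus form a linear relation between `r, r A, …, r A ^ (n - 1)`.
  set d := A.charpoly - q with hd'
  have hdeg : d.natDegree < n := by
    have h1 : d.degree < A.charpoly.degree := Polynomial.degree_sub_lt_left
      (by rw [Polynomial.degree_eq_natDegree A.charpoly_monic.ne_zero,
        Polynomial.degree_eq_natDegree hm.ne_zero, hA, hd]) A.charpoly_monic.ne_zero
      (by rw [A.charpoly_monic.leadingCoeff, hm.leadingCoeff])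
    rw [← hA]
    by_cases h0 : d = 0
    · rw [h0, Polynomial.natDegree_zero, hA]; exact hn
    · exact Polynomial.natDegree_lt_natDegree h0 h1
  have hz : r ᵥ* Polynomial.aeval A d = 0 := by
    rw [hd', map_sub, Matrix.aeval_self_charpoly, Matrix.vecMul_sub, h, Matrix.vecMul_zero,
      sub_zero]
  rw [Polynomial.aeval_eq_sum_range' hdeg, Finset.sum_range, Matrix.vecMul_sum] at hz
  simp only [Matrix.vecMul_smul] at hz
  have hc := Fintype.linearIndependent_iff.1 hr (fun k => d.coeff k) hz
  have : d = 0 := by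
    ext k
    by_cases hk : k < n
    · exact hc ⟨k, hk⟩
    · exact Polynomial.coeff_eq_zero_of_natDegree_lt (by omega)
  exact sub_eq_zero.1 this

lemma Matrix.det_smul_one_add_map {R : Type*} [CommRing R] {n : ℕ} (B : Matrix (Fin n) (Fin n) R) :
    ((Polynomial.X : Polynomial R) • (1 : Matrix (Fin n) (Fin n) (Polynomial R)) +
      (Polynomial.C : R →+* Polynomial R).mapMatrix B).det = (-B).charpoly := by
  rw [Matrix.charpoly, Matrix.charmatrix, map_neg, sub_neg_eq_add, Matrix.scalar_apply,
    Matrix.smul_one_eq_diagonal]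

/-- The polynomial in one variable with the given coefficients. -/
def HPoly.ofCoeffs : List ℤ → HPoly
  | [] => const 0
  | q :: l => horner (const q) (ofCoeffs l)

lemma HPoly.eval_ofCoeffs {R : Type*} [CommRing R] (x : R) (l : List ℤ) :
    eval (fun _ => x) 0 (ofCoeffs l) =
      ∑ k ∈ Finset.range l.length, ((l.getD k 0 : ℤ) : R) * x ^ k := by
  induction l with
  | nil => simp [ofCoeffs]
  | cons q l ih =>
    rw [List.length_cons, Finset.sum_range_succ', ofCoeffs, eval_horner, ih, Finset.mul_sum]
    simp [pow_succ]
    rw [add_comm]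
    congr 1
    exact Finset.sum_congr rfl fun k _ => by ring

lemma HPoly.derivative_eval_ofCoeffs (l : List ℤ) :
    Polynomial.derivative (eval (fun _ => (Polynomial.X : Polynomial ℂ)) 0 (ofCoeffs l)) =
      eval (fun _ => Polynomial.X) 0 (deriv 0 (ofCoeffs l)) := by
  induction l with
  | nil =>
    rw [show deriv 0 (ofCoeffs []) = const 0 from rfl]
    simp [ofCoeffs]
  | cons q l ih =>
    rw [ofCoeffs, eval_deriv_zero_horner, eval_horner, Polynomial.derivative_add,
      Polynomial.derivative_mul, ih]
    simp

/-- A certificate that `q` is monic of degree `n`, separable, and does not vanish at zero. -/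
def isSeparableCert (n : ℕ) (q a b : List ℤ) (N : ℤ) : Bool :=
  decide (q.length = n + 1) && decide (q.getD n 0 = 1) && decide (q.getD 0 0 ≠ 0) &&
    decide (N ≠ 0) && isZero (HPoly.add (HPoly.add (HPoly.mul (ofCoeffs a) (ofCoeffs q))
      (HPoly.mul (ofCoeffs b) (deriv 0 (ofCoeffs q)))) (const (-N)))

/-- The polynomial over `ℂ` with the given coefficients. -/
abbrev HPoly.toPolynomial (l : List ℤ) : Polynomial ℂ :=
  eval (fun _ => Polynomial.X) 0 (ofCoeffs l)

lemma HPoly.toPolynomial_eq {n : ℕ} {q : List ℤ} (hl : q.length = n + 1) (h1 : q.getD n 0 = 1) :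
    toPolynomial q = Polynomial.X ^ n +
      ∑ k ∈ Finset.range n, ((q.getD k 0 : ℤ) : Polynomial ℂ) * Polynomial.X ^ k := by
  rw [toPolynomial, eval_ofCoeffs, hl, Finset.sum_range_succ, h1, add_comm]
  simp

lemma HPoly.degree_sum_lt (n : ℕ) (q : List ℤ) :
    (∑ k ∈ Finset.range n, ((q.getD k 0 : ℤ) : Polynomial ℂ) * Polynomial.X ^ k).degree <
      (n : WithBot ℕ) := by
  refine lt_of_le_of_lt (Polynomial.degree_sum_le _ _) ?_
  rw [Finset.sup_lt_iff (by exact_mod_cast WithBot.bot_lt_coe n)]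
  intro k hk
  rw [← Polynomial.C_eq_intCast]
  exact lt_of_le_of_lt (Polynomial.degree_C_mul_X_pow_le _ _)
    (by exact_mod_cast Finset.mem_range.1 hk)

lemma HPoly.monic_toPolynomial {n : ℕ} {q : List ℤ} (hl : q.length = n + 1)
    (h1 : q.getD n 0 = 1) : (toPolynomial q).Monic ∧ (toPolynomial q).natDegree = n := by
  rw [toPolynomial_eq hl h1]
  exact ⟨Polynomial.monic_X_pow_add (degree_sum_lt n q),
    Polynomial.natDegree_eq_of_degree_eq_some (by
      rw [Polynomial.degree_add_eq_left_of_degree_lt, Polynomial.degree_X_pow]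
      rw [Polynomial.degree_X_pow]; exact degree_sum_lt n q)⟩

/-- The certificate is a Bézout identity `a q + b q' = N` with an integer `N ≠ 0`, which makes `q`
separable over `ℂ`; and `q(0) ≠ 0` makes `q` coprime to `X`. -/
lemma squarefree_of_isSeparableCert {n : ℕ} {q a b : List ℤ} {N : ℤ}
    (h : isSeparableCert n q a b N = true) :
    Squarefree (Polynomial.X * HPoly.toPolynomial q) := by
  simp only [isSeparableCert, Bool.and_eq_true, decide_eq_true_eq] at h
  obtain ⟨⟨⟨⟨-, -⟩, h0⟩, hN⟩, hz⟩ := h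
  have hz := eval_of_isZero (fun _ => (Polynomial.X : Polynomial ℂ)) 0 _ hz
  rw [HPoly.eval_add, HPoly.eval_add, HPoly.eval_mul, HPoly.eval_mul, eval_const,
    ← derivative_eval_ofCoeffs] at hz
  have hN' : (N : ℂ) ≠ 0 := by exact_mod_cast hN
  have hq : (HPoly.toPolynomial q).Separable := by
    refine ⟨Polynomial.C (N : ℂ)⁻¹ * eval (fun _ => Polynomial.X) 0 (ofCoeffs a),
      Polynomial.C (N : ℂ)⁻¹ * eval (fun _ => Polynomial.X) 0 (ofCoeffs b), ?_⟩
    have hc : Polynomial.C (N : ℂ)⁻¹ * ((N : ℤ) : Polynomial ℂ) = 1 := by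
      rw [← map_intCast (Polynomial.C : ℂ →+* Polynomial ℂ), ← Polynomial.C_mul, inv_mul_cancel₀ hN',
        Polynomial.C_1]
    push_cast at hz
    rw [HPoly.toPolynomial]
    linear_combination Polynomial.C (N : ℂ)⁻¹ * hz + hc
  refine (Polynomial.Separable.mul Polynomial.separable_X hq ?_).squarefree
  rw [(Polynomial.irreducible_X).coprime_iff_not_dvd, Polynomial.X_dvd_iff]
  have : (HPoly.toPolynomial q).coeff 0 = ((q.getD 0 0 : ℤ) : ℂ) := by
    cases q with
    | nil => simp at h0
    | cons c q => simp [HPoly.toPolynomial, ofCoeffs]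
  rw [this]
  exact_mod_cast h0

/-! ### Certified characteristic polynomials and squarefree determinants. -/

namespace HMat

/-- Whether the entries do not involve the variable of index `i`. -/
def isFree (i : ℕ) (A : HMat) : Bool :=
  A.all fun r => r.all (HPoly.isHomogeneous (List.replicate i 0 ++ [1]) 0)

lemma toMatrix_congr_of_isFree {R : Type*} [CommRing R] (n i : ℕ) {A : HMat}
    (h : A.isFree i = true) {ρ σ : ℕ → R} (hρ : ∀ j, j ≠ i → ρ j = σ j) :
    toMatrix n ρ A = toMatrix n σ A := by
  have hw : ∀ j, (List.replicate i 0 ++ [1]).getD j 0 = if j = i then 1 else 0 := by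
    intro j
    rcases lt_trichotomy j i with hj | rfl | hj
    · simp [List.getElem?_append, hj, hj.ne]
    · simp
    · simp [List.getElem?_append, hj.not_gt, hj.ne', show j - i ≠ 0 by omega]
  -- Scaling the variable `x_i` from `1` to `ρ i` multiplies a polynomial of degree zero in it by
  -- `(ρ i) ^ 0`, so the value does not depend on `ρ i`.
  have key : ∀ (ρ : ℕ → R) (p : HPoly),
      HPoly.isHomogeneous (List.replicate i 0 ++ [1]) 0 p = true →
      eval ρ 0 p = eval (fun j => if j = i then 1 else ρ j) 0 p := by
    intro ρ p hp
    have := eval_of_isHomogeneous (fun j => if j = i then 1 else ρ j)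
      (fun j => if j = i then 1 else 0) (ρ i) 0 0 _ p (fun j => by rw [hw, zero_add]) hp
    rw [pow_zero, one_mul] at this
    rw [← this]
    congr 1
    funext j
    by_cases hj : j = i
    · simp [hj]
    · simp [hj]
  have key2 : ∀ p : HPoly, HPoly.isHomogeneous (List.replicate i 0 ++ [1]) 0 p = true →
      eval ρ 0 p = eval σ 0 p := by
    intro p hp
    rw [key ρ p hp, key σ p hp]
    congr 1
    funext j
    by_cases hj : j = i
    · simp [hj]
    · simp [hj, hρ j hj]
  ext a b
  rw [toMatrix_apply, toMatrix_apply]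
  simp only [isFree, List.all_eq_true] at h
  unfold entry
  by_cases ha : (a : ℕ) < A.length
  · rw [List.getD_eq_getElem _ _ ha]
    by_cases hb : (b : ℕ) < A[(a : ℕ)].length
    · rw [List.getD_eq_getElem _ _ hb]
      exact key2 _ (h _ (List.getElem_mem _) _ (List.getElem_mem _))
    · rw [List.getD_eq_default _ _ (not_lt.1 hb)]; simp
  · rw [List.getD_eq_default _ _ (not_lt.1 ha)]; simp

/-- The row vector `(0, …, 0, 1)` of length `n`. -/
def unitRow (n : ℕ) : List HPoly := List.replicate (n - 1) (const 0) ++ [const 1]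

/-- A certificate that `q` is the characteristic polynomial of a matrix with integer entries. -/
def isCharpolyCert (n : ℕ) (A K : HMat) (d : ℤ) (q : List ℤ) : Bool :=
  decide (A.length ≤ n) && decide (K.length ≤ n) && decide (d ≠ 0) &&
    eq (mul (krylov A (unitRow n) n) K) (scalar (const d) n) &&
    (comb (q.map const) (krylov A (unitRow n) (n + 1))).all HPoly.isZero

lemma length_krylov (A : HMat) (r : List HPoly) (N : ℕ) : (krylov A r N).length = N := by
  induction N generalizing r with
  | zero => rfl
  | succ N ih => simp [krylov, ih]

/-- The matrix `K` inverts the Krylov matrix up to the factor `d ≠ 0`, so the row `(0, …, 0, 1)` is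
cyclic. The vanishing combination of the `n + 1` Krylov rows says that `q` of the matrix kills this
row. -/
lemma charpoly_of_isCharpolyCert {n : ℕ} {A K : HMat} {d : ℤ} {q : List ℤ}
    (h : isCharpolyCert n A K d q = true) (hl : q.length = n + 1) (h1 : q.getD n 0 = 1)
    (ρ : ℕ → ℂ) : (toMatrix n ρ A).charpoly = HPoly.toPolynomial q := by
  simp only [isCharpolyCert, Bool.and_eq_true, decide_eq_true_eq] at h
  obtain ⟨⟨⟨⟨hA, hK⟩, hd⟩, hKr⟩, hq⟩ := h
  obtain ⟨hm, hdeg⟩ := HPoly.monic_toPolynomial hl h1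
  set r : Fin n → ℂ := fun i => ((unitRow n).getD i (const 0)).eval ρ 0 with hr
  have hd' : (d : ℂ) ≠ 0 := by exact_mod_cast hd
  have hrow : toMatrix n ρ (krylov A (unitRow n) n) =
      Matrix.of fun k : Fin n => r ᵥ* toMatrix n ρ A ^ (k : ℕ) := by
    ext k j
    rw [toMatrix_apply, entry_krylov n ρ A hA _ n k k.2]
    rfl
  refine Matrix.charpoly_eq_of_vecMul _ r ?_ hm hdeg ?_
  · have h2 := toMatrix_eq n ρ hKr
    rw [toMatrix_mul _ _ _ _ hK, toMatrix_scalar, eval_const] at h2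
    have hne : (toMatrix n ρ (krylov A (unitRow n) n)).det ≠ 0 := fun h0 => ?_
    · rw [hrow] at hne
      exact Matrix.linearIndependent_rows_of_det_ne_zero hne
    have h3 := congrArg Matrix.det h2
    rw [Matrix.det_mul, h0, zero_mul, Matrix.det_smul, Matrix.det_one, mul_one] at h3
    exact pow_ne_zero _ hd' h3.symm
  · rw [HPoly.toPolynomial, HPoly.eval_ofCoeffs, hl, map_sum, Matrix.vecMul_sum]
    funext j
    have h4 := eval_getD_comb (n + 1) ρ (q.map const) (krylov A (unitRow n) (n + 1))
      (length_krylov _ _ _).le j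
    have h5 :
        ((comb (q.map const) (krylov A (unitRow n) (n + 1))).getD j (const 0)).eval ρ 0 = 0 := by
      rw [List.all_eq_true] at hq
      by_cases hj : (j : ℕ) < (comb (q.map const) (krylov A (unitRow n) (n + 1))).length
      · rw [List.getD_eq_getElem _ _ hj]
        exact eval_of_isZero _ _ _ (hq _ (List.getElem_mem _))
      · rw [List.getD_eq_default _ _ (not_lt.1 hj)]; simp
    rw [h5] at h4
    rw [Finset.sum_apply, Pi.zero_apply, h4]
    refine Finset.sum_congr rfl fun k hk => ?_
    rw [entry_krylov n ρ A hA _ _ k (Finset.mem_range.1 hk)]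
    have h6 : ((q.map const).getD k (const 0)).eval ρ 0 = ((q.getD k 0 : ℤ) : ℂ) := by
      rw [List.getD_map]; rfl
    rw [h6, ← Polynomial.C_eq_intCast, map_mul, map_pow, Polynomial.aeval_X, Polynomial.aeval_C,
      ← Algebra.smul_def, Matrix.vecMul_smul]
    simp [hr]

/-- The product of the variable `X i` and of the characteristic polynomial of `-A` in a multiple
of `X i` is squarefree if a specialization is, where the matrix `A` does not involve `X i`. -/
lemma squarefree_X_mul_det {n : ℕ} (i : Fin n) {A : HMat} {S : ℤ} (hS : S ≠ 0)
    (hA : A.isFree i = true) {p : List ℤ} (hp : p.length ≤ n) {K : HMat} {d : ℤ}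
    {q a b : List ℤ} {N : ℤ}
    (hK : isCharpolyCert n ((A.subst (listSubst (p.map const))).smul (const (-1))) K d q = true)
    (hq : isSeparableCert n q a b N = true) :
    Squarefree (X i * (toMatrix n (slots (X : Fin n → MvPolynomial (Fin n) ℂ) 0)
      ((scalar (HPoly.smul S (var i)) n).add A)).det) := by
  have hS' : (S : ℂ) ≠ 0 := by exact_mod_cast hS
  have hq' := hq
  simp only [isSeparableCert, Bool.and_eq_true, decide_eq_true_eq] at hq'
  obtain ⟨⟨⟨⟨hl, h1⟩, -⟩, -⟩, -⟩ := hq'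
  -- View the polynomial ring as polynomials in the single variable `S X_i` over the others: `ι`
  -- rewrites `X i` as `S⁻¹` times the new variable, and `κ` evaluates back.
  let ι : MvPolynomial (Fin n) ℂ →+* Polynomial (MvPolynomial (Fin n) ℂ) :=
    eval₂Hom (Polynomial.C.comp C) fun j => if j = i then Polynomial.C (C (S : ℂ)⁻¹) * Polynomial.X
      else Polynomial.C (X j)
  let κ : Polynomial (MvPolynomial (Fin n) ℂ) →+* MvPolynomial (Fin n) ℂ :=
    Polynomial.evalRingHom (C (S : ℂ) * X i)
  have hC : (C (S : ℂ)⁻¹ : MvPolynomial (Fin n) ℂ) * C (S : ℂ) = 1 := by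
    rw [← C_mul, inv_mul_cancel₀ hS', C_1]
  have hκ : ∀ g, κ (ι g) = g := by
    have : κ.comp ι = RingHom.id _ := by
      refine MvPolynomial.ringHom_ext (fun c => ?_) fun j => ?_
      · simp [κ, ι]
      · by_cases hj : j = i
        · subst hj
          simp only [κ, ι, RingHom.comp_apply, eval₂Hom_X', if_true, map_mul,
            Polynomial.coe_evalRingHom, Polynomial.eval_C, Polynomial.eval_X, ← mul_assoc, hC,
            one_mul, RingHom.id_apply]
        · simp [κ, ι, hj]
    intro g
    exact congrArg (fun f => f g) this
  have hi : ι (X i) = Polynomial.C (C (S : ℂ)⁻¹) * Polynomial.X := by simp [ι]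
  have hSi : ((S : ℤ) : Polynomial (MvPolynomial (Fin n) ℂ)) * ι (X i) = Polynomial.X := by
    have : ((S : ℤ) : Polynomial (MvPolynomial (Fin n) ℂ)) = Polynomial.C (C (S : ℂ)) := by simp
    rw [hi, this, ← mul_assoc, ← Polynomial.C_mul, mul_comm (C _), hC, Polynomial.C_1, one_mul]
  set B := toMatrix n (slots (X : Fin n → MvPolynomial (Fin n) ℂ) 0) A with hB
  have hdet : ι (X i * (toMatrix n (slots (X : Fin n → MvPolynomial (Fin n) ℂ) 0)
      ((scalar (HPoly.smul S (var i)) n).add A)).det) =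
      Polynomial.C (C (S : ℂ)⁻¹) * (Polynomial.X * (-B).charpoly) := by
    -- As `A` does not involve `X i`, its entries become constants in the new variable, and the
    -- determinant is a characteristic polynomial.
    have h2 : toMatrix n (fun j => ι (slots X 0 j)) A = Polynomial.C.mapMatrix B := by
      rw [RingHom.mapMatrix_apply, hB, map_toMatrix]
      refine toMatrix_congr_of_isFree n i hA fun j hj => ?_
      by_cases h : j < n
      · have : (⟨j, h⟩ : Fin n) ≠ i := fun hh => hj (by rw [← hh])
        simp [slots, h, ι, this]
      · simp [slots, h]
    rw [map_mul, hi, mul_assoc, RingHom.map_det, RingHom.mapMatrix_apply, map_toMatrix,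
      toMatrix_add, toMatrix_scalar, h2, eval_smul, eval_var, zero_add, slots_val, hSi,
      Matrix.det_smul_one_add_map]
  -- Specialize the coefficients at the integers `p`; the entry of `p` at the index `i` plays no
  -- role, since `A` is free of that variable.
  have hev : (eval fun k : Fin n => ((p.getD k 0 : ℤ) : ℂ)).mapMatrix (-B) =
      toMatrix n (fun _ => 0) ((A.subst (listSubst (p.map const))).smul (const (-1))) := by
    rw [toMatrix_smul, toMatrix_subst, map_neg, RingHom.mapMatrix_apply, hB, map_toMatrix,
      eval_const, Int.cast_neg, Int.cast_one, neg_smul, one_smul]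
    congr 2
    funext j
    have : (listSubst (p.map const) j).eval (fun _ => (0 : ℂ)) 0 = ((p.getD j 0 : ℤ) : ℂ) := by
      rw [listSubst, List.getD_map]; rfl
    rw [this]
    by_cases h : j < n
    · simp [slots, h]
    · simp [slots, h, show p.length ≤ j by omega]
  have hsq : Squarefree (Polynomial.C (C (S : ℂ)⁻¹) * (Polynomial.X * (-B).charpoly)) := by
    refine Polynomial.squarefree_of_map (eval fun k : Fin n => ((p.getD k 0 : ℤ) : ℂ)) ?_ ?_
    · rw [Polynomial.leadingCoeff_mul, Polynomial.leadingCoeff_mul, Polynomial.leadingCoeff_C,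
        Polynomial.leadingCoeff_X, (Matrix.charpoly_monic _).leadingCoeff, mul_one, mul_one]
      exact IsUnit.of_mul_eq_one _ hC
    · rw [Polynomial.map_mul, Polynomial.map_mul, Polynomial.map_C, Polynomial.map_X,
        ← Matrix.charpoly_map, ← RingHom.mapMatrix_apply, hev,
        charpoly_of_isCharpolyCert hK hl h1, eval_C]
      refine (squarefree_of_isSeparableCert hq).squarefree_of_dvd ?_
      exact ((Polynomial.isUnit_C.2 (inv_ne_zero hS').isUnit).mul_left_dvd).2 dvd_rfl
  rw [← hdet] at hsq
  -- A square factor `g` maps to a square factor under `ι`, whose image is therefore a unit, and `κ`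
  -- carries this back to `g`.
  intro g hg
  have := hsq (ι g) (by rw [← map_mul]; exact map_dvd ι hg)
  rw [← hκ g]
  exact this.map κ

end HMat

end

/-! ### From singular points to common eigenvectors of multiplication. -/

noncomputable section

open HPoly
open scoped Matrix

/-! ### Common eigenvectors -/

/-- An endomorphism preserving a nonzero subspace has an eigenvector in it. -/
lemma Module.End.exists_mem_eigenvector {E : Type*} [AddCommGroup E] [Module ℂ E]
    [FiniteDimensional ℂ E] (f : Module.End ℂ E) {W : Submodule ℂ E} (hW : W ≠ ⊥)
    (h : ∀ v ∈ W, f v ∈ W) : ∃ μ : ℂ, W ⊓ LinearMap.ker (f - μ • (1 : Module.End ℂ E)) ≠ ⊥ := by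
  have : Nontrivial W := Submodule.nontrivial_iff_ne_bot.2 hW
  obtain ⟨μ, hμ⟩ := Module.End.exists_eigenvalue (f.restrict h)
  obtain ⟨v, hv⟩ := hμ.exists_hasEigenvector
  refine ⟨μ, fun h0 => hv.2 ?_⟩
  have h1 : f v = μ • (v : E) := congrArg Subtype.val hv.apply_eq_smul
  have : (v : E) ∈ W ⊓ LinearMap.ker (f - μ • (1 : Module.End ℂ E)) :=
    ⟨v.2, by simp [h1]⟩
  rw [h0, Submodule.mem_bot] at this
  exact Subtype.ext this

/-- Three commuting matrices which commute with a singular matrix have a common eigenvector in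
its kernel. -/
lemma Matrix.exists_common_eigenvector {n : ℕ} {X Y V G : Matrix (Fin n) (Fin n) ℂ}
    (hG : G.det = 0) (hXG : Commute X G) (hYG : Commute Y G) (hVG : Commute V G)
    (hXY : Commute X Y) (hXV : Commute X V) (hYV : Commute Y V) :
    ∃ (v : Fin n → ℂ) (x y w : ℂ), v ≠ 0 ∧ G *ᵥ v = 0 ∧ X *ᵥ v = x • v ∧ Y *ᵥ v = y • v ∧
      V *ᵥ v = w • v := by
  have hc : ∀ {A B : Matrix (Fin n) (Fin n) ℂ}, Commute A B → ∀ v, A *ᵥ B *ᵥ v = B *ᵥ A *ᵥ v := by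
    intro A B h v
    rw [Matrix.mulVec_mulVec, Matrix.mulVec_mulVec, h.eq]
  obtain ⟨v, hv, hv'⟩ := Matrix.exists_mulVec_eq_zero_iff.2 hG
  -- Start from the kernel of `G` and pass successively to eigenspaces of `X`, `Y` and `V` inside
  -- the subspace already found. Commutation keeps each subspace stable under the next matrix.
  have h0 : LinearMap.ker G.toLin' ≠ ⊥ := by
    intro h
    exact hv ((Submodule.mem_bot ℂ).1 (h ▸ (by simpa using hv')))
  obtain ⟨x, h1⟩ := Module.End.exists_mem_eigenvector X.toLin' h0 (by
    intro u hu
    simp only [LinearMap.mem_ker, Matrix.toLin'_apply] at hu ⊢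
    rw [← hc hXG, hu, Matrix.mulVec_zero])
  obtain ⟨y, h2⟩ := Module.End.exists_mem_eigenvector Y.toLin' h1 (by
    intro u hu
    simp only [Submodule.mem_inf, LinearMap.mem_ker, Matrix.toLin'_apply, LinearMap.sub_apply,
      LinearMap.smul_apply, Module.End.one_apply, sub_eq_zero] at hu ⊢
    rw [← hc hYG, hu.1, Matrix.mulVec_zero, hc hXY, hu.2, Matrix.mulVec_smul]
    exact ⟨rfl, rfl⟩)
  obtain ⟨w, h3⟩ := Module.End.exists_mem_eigenvector V.toLin' h2 (by
    intro u hu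
    simp only [Submodule.mem_inf, LinearMap.mem_ker, Matrix.toLin'_apply, LinearMap.sub_apply,
      LinearMap.smul_apply, Module.End.one_apply, sub_eq_zero] at hu ⊢
    rw [← hc hVG, hu.1.1, Matrix.mulVec_zero, hc hXV, hu.1.2, Matrix.mulVec_smul, hc hYV, hu.2,
      Matrix.mulVec_smul]
    exact ⟨⟨rfl, rfl⟩, rfl⟩)
  obtain ⟨u, hu, hu0⟩ := Submodule.exists_mem_ne_zero_of_ne_bot h3
  simp only [Submodule.mem_inf, LinearMap.mem_ker, Matrix.toLin'_apply, LinearMap.sub_apply,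
    LinearMap.smul_apply, Module.End.one_apply, sub_eq_zero] at hu
  exact ⟨u, x, y, w, hu0, hu.1.1.1, hu.1.1.2, hu.1.2, hu.2⟩

/-! ### Singular points -/

/-- The singular points of the surface `z ^ 2 = y ^ 3 + A(x) + y B(x) + s y ^ 2`. -/
lemma isSingularPoint_iff (α₁ α₂ α₃ α₄ α₅ β₁ β₂ β₃ s : ℂ) (g : (Fin 3 → ℂ) → ℂ)
    (hg : ∀ a, g a = a 2 ^ 2 - (a 1 ^ 3 + (α₁ * a 0 + α₂ * a 0 ^ 2 + α₃ * a 0 ^ 3 + α₄ * a 0 ^ 4 +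
      α₅ * a 0 ^ 5) + a 1 * (β₁ * a 0 + β₂ * a 0 ^ 2 + β₃ * a 0 ^ 3) + s * a 1 ^ 2))
    (a : Fin 3 → ℂ) :
    IsSingularPoint g a ↔ a 2 = 0 ∧
      a 1 ^ 3 + (α₁ * a 0 + α₂ * a 0 ^ 2 + α₃ * a 0 ^ 3 + α₄ * a 0 ^ 4 + α₅ * a 0 ^ 5) +
        a 1 * (β₁ * a 0 + β₂ * a 0 ^ 2 + β₃ * a 0 ^ 3) + s * a 1 ^ 2 = 0 ∧
      α₁ + 2 * α₂ * a 0 + 3 * α₃ * a 0 ^ 2 + 4 * α₄ * a 0 ^ 3 + 5 * α₅ * a 0 ^ 4 +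
        a 1 * (β₁ + 2 * β₂ * a 0 + 3 * β₃ * a 0 ^ 2) = 0 ∧
      3 * a 1 ^ 2 + (β₁ * a 0 + β₂ * a 0 ^ 2 + β₃ * a 0 ^ 3) + 2 * s * a 1 = 0 := by
  have h : ∀ i : Fin 3, HasFDerivAt (fun a : Fin 3 → ℂ => a i)
      (ContinuousLinearMap.proj (R := ℂ) (φ := fun _ : Fin 3 => ℂ) i) a := fun i =>
    (ContinuousLinearMap.proj (R := ℂ) (φ := fun _ : Fin 3 => ℂ) i).hasFDerivAt
  have hd := ((h 2).pow 2).fun_sub (((((h 1).pow 3).fun_add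
    ((((((h 0).const_mul α₁).fun_add (((h 0).pow 2).const_mul α₂)).fun_add
      (((h 0).pow 3).const_mul α₃)).fun_add (((h 0).pow 4).const_mul α₄)).fun_add
      (((h 0).pow 5).const_mul α₅))).fun_add
    ((h 1).fun_mul ((((h 0).const_mul β₁).fun_add (((h 0).pow 2).const_mul β₂)).fun_add
      (((h 0).pow 3).const_mul β₃)))).fun_add (((h 1).pow 2).const_mul s))
  have hgd := hd.congr_of_eventuallyEq (Filter.Eventually.of_forall hg)
  rw [IsSingularPoint, Fin.forall_fin_succ, Fin.forall_fin_succ, Fin.forall_fin_one, hg]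
  simp only [partialD, hgd.fderiv]
  simp
  constructor
  · rintro ⟨h1, h2, h3, h4⟩
    refine ⟨h4, ?_, ?_, ?_⟩
    · rw [h4] at h1; linear_combination -h1
    · linear_combination -h2
    · linear_combination -h3
  · rintro ⟨h1, h2, h3, h4⟩
    refine ⟨?_, ?_, ?_, h1⟩
    · rw [h1]; linear_combination -h2
    · linear_combination -h3
    · linear_combination -h4

/-! ### Coordinates -/

/-- The polynomial map with the given components. -/
def polyMap (n : ℕ) (l : List HPoly) (p : Fin n → ℂ) : Fin n → ℂ :=
  fun i => (listSubst l i).eval (slots p 0) 0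

/-- Whether `σ` after `τ` is the scaling by the powers of `l` with the given exponents. -/
def isInverseCert (n : ℕ) (σ τ : List HPoly) (l : ℤ) (w : List ℕ) : Bool :=
  (List.range n).all fun i => HPoly.isZero (HPoly.add
    (HPoly.subst (listSubst τ) 0 (listSubst σ i)) (HPoly.smul (-l ^ w.getD i 0) (var i)))

lemma slots_polyMap {n : ℕ} {τ : List HPoly} (hτ : τ.length ≤ n) (p : Fin n → ℂ) :
    slots (polyMap n τ p) 0 = fun i => (listSubst τ i).eval (slots p 0) 0 := by
  funext i
  by_cases hi : i < n
  · simp [slots, hi, polyMap]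
  · simp [slots, hi, listSubst, show τ.length ≤ i by omega]

lemma polyMap_polyMap {n : ℕ} {σ τ : List HPoly} {l : ℤ} {w : List ℕ} (hτ : τ.length ≤ n)
    (h : isInverseCert n σ τ l w = true) (p : Fin n → ℂ) :
    polyMap n σ (polyMap n τ p) = fun i : Fin n => (l : ℂ) ^ w.getD i 0 * p i := by
  funext i
  simp only [isInverseCert, List.all_eq_true, List.mem_range] at h
  have := eval_of_isZero (slots p 0) 0 _ (h i i.2)
  rw [HPoly.eval_add, eval_subst, eval_smul, eval_var, zero_add, slots_val] at this
  rw [polyMap, slots_polyMap hτ]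
  push_cast at this
  linear_combination this

/-- A polynomial map with an inverse up to scaling is bijective, also after scaling. -/
lemma bijective_polyMap {n : ℕ} {σ τ : List HPoly} {l : ℤ} {w w' : List ℕ} (hl : l ≠ 0)
    (hσ : σ.length ≤ n) (hτ : τ.length ≤ n)
    (h : isInverseCert n σ τ l w' = true) (h' : isInverseCert n τ σ l w = true) {c : Fin n → ℂ}
    (hc : ∀ i, c i ≠ 0) : Function.Bijective fun p i => c i * polyMap n σ p i := by
  have hl : (l : ℂ) ≠ 0 := by exact_mod_cast hl
  constructor
  · intro p q hpq
    have h1 : polyMap n σ p = polyMap n σ q := by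
      funext i
      exact mul_left_cancel₀ (hc i) (congrFun hpq i)
    have h2 := congrArg (polyMap n τ) h1
    rw [polyMap_polyMap hσ h', polyMap_polyMap hσ h'] at h2
    funext i
    exact mul_left_cancel₀ (pow_ne_zero _ hl) (congrFun h2 i)
  · intro x
    refine ⟨polyMap n τ fun i => ((l : ℂ) ^ w'.getD i 0)⁻¹ * (c i)⁻¹ * x i, ?_⟩
    funext i
    have := hc i
    change c i * polyMap n σ _ i = _
    rw [polyMap_polyMap hτ h]
    field_simp

/-- Whether the members of a list are homogeneous of the given degrees. -/
def isHomogeneousMap (n : ℕ) (w' w : List ℕ) (τ : List HPoly) : Bool :=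
  (List.range n).all fun i => HPoly.isHomogeneous w' (w.getD i 0) (listSubst τ i)

lemma slots_mul {n : ℕ} (w : List ℕ) (μ : ℂ) (p : Fin n → ℂ) :
    slots (fun i : Fin n => μ ^ w.getD i 0 * p i) 0 = fun i => μ ^ w.getD i 0 * slots p 0 i := by
  funext i
  by_cases hi : i < n
  · simp [slots, hi]
  · simp [slots, hi]

lemma polyMap_mul {n : ℕ} {τ : List HPoly} {w' w : List ℕ}
    (h : isHomogeneousMap n w' w τ = true) (μ : ℂ) (p : Fin n → ℂ) :
    polyMap n τ (fun i => μ ^ w'.getD i 0 * p i) = fun i : Fin n =>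
      μ ^ w.getD i 0 * polyMap n τ p i := by
  funext i
  simp only [isHomogeneousMap, List.all_eq_true, List.mem_range] at h
  rw [polyMap, slots_mul, eval_of_isHomogeneous _ (fun i => w'.getD i 0) μ 0 _ w' _
    (fun i => by rw [zero_add]) (h i i.2)]
  rfl

/-- Similar matrices have the same determinant. -/
lemma HMat.det_eq_of_transition {n : ℕ} {T P G : HMat} {τ κ : List HPoly} {a b : ℤ} {q : List ℤ}
    (h : ((P.mul (G.subst (listSubst τ))).smul (const b)).eq
      (((T.subst (listSubst κ)).mul P).smul (const a)) = true)
    (hG : G.length ≤ n) (hP : P.length ≤ n) (ht : P.isTriangular n q = true)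
    (hq : ∏ i : Fin n, q.getD i 0 ≠ 0) (ρ : ℕ → ℂ) :
    (b : ℂ) ^ n * (toMatrix n (fun i => (listSubst τ i).eval ρ 0) G).det =
      (a : ℂ) ^ n * (toMatrix n (fun i => (listSubst κ i).eval ρ 0) T).det := by
  have h1 := congrArg Matrix.det (toMatrix_eq n ρ h)
  rw [toMatrix_smul, toMatrix_smul, toMatrix_mul _ _ _ _ (by simpa [subst] using hG),
    toMatrix_mul _ _ _ _ hP, toMatrix_subst, toMatrix_subst, Matrix.det_smul, Matrix.det_smul,
    Matrix.det_mul, Matrix.det_mul, det_toMatrix_of_isTriangular n ρ ht, Fintype.card_fin,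
    eval_const, eval_const] at h1
  -- The determinant of `P` is the same nonzero constant on both sides and can be cancelled.
  have hq' : ((∏ i : Fin n, q.getD i 0 : ℤ) : ℂ) ≠ 0 := by exact_mod_cast hq
  refine mul_left_cancel₀ hq' ?_
  linear_combination h1

/-- The determinants correspond under the weighted homogeneous coordinate transformation. -/
lemma HMat.det_eq_of_coordinates {n : ℕ} {T P G : HMat} {σ τ κ : List HPoly} {a b l : ℤ}
    {q : List ℤ} {w w' e : List ℕ} {d : ℕ}
    (h : ((P.mul (G.subst (listSubst τ))).smul (const b)).eq
      (((T.subst (listSubst κ)).mul P).smul (const a)) = true)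
    (hG : G.length ≤ n) (hP : P.length ≤ n) (ht : P.isTriangular n q = true)
    (hq : ∏ i : Fin n, q.getD i 0 ≠ 0) (hσ : σ.length ≤ n) (hτ : τ.length ≤ n)
    (hτσ : isInverseCert n τ σ l w = true) (hl : l ≠ 0) (hτw : isHomogeneousMap n w' w τ = true)
    (hGw : G.isHomogeneous n w e d = true) {μ : ℂ} (hμ : μ ≠ 0) (p : Fin n → ℂ) :
    (a : ℂ) ^ n * (toMatrix n (fun i => (listSubst κ i).eval
      (slots (fun i : Fin n => μ ^ w'.getD i 0 * polyMap n σ p i) 0) 0) T).det =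
      (b : ℂ) ^ n * (μ * l) ^ (d * n) * (toMatrix n (slots p 0) G).det := by
  have hl : (l : ℂ) ≠ 0 := by exact_mod_cast hl
  -- Homogeneity of `τ` together with `τ ∘ σ = l ^ w` shows that `τ` sends the scaled image of `p`
  -- to `(μ l) ^ w p`; homogeneity of `G` turns this scaling into a factor of the determinant.
  rw [← det_eq_of_transition h hG hP ht hq, ← slots_polyMap hτ, polyMap_mul hτw,
    polyMap_polyMap hσ hτσ, mul_assoc, ← det_toMatrix_of_isHomogeneous n _ hGw
      (mul_ne_zero hμ hl).isUnit, ← slots_mul]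
  congr 5
  funext i
  rw [mul_pow, mul_assoc]

/-! ### Eigenvectors -/

/-- The matrix with one column. -/
def HMat.col (E : List HPoly) : HMat := E.map fun p => [p]

/-- A certificate that `E` is an eigenvector of `A` with eigenvalue `c` if `R` and `R'` vanish. -/
def isEigenvectorCert (A : HMat) (E : List HPoly) (c R R' : HPoly) (M M' : List HPoly) : Bool :=
  HMat.eq (A.mul (HMat.col E)) (((HMat.col E).smul c).add
    (((HMat.col M).smul R).add ((HMat.col M').smul R')))

lemma HMat.entry_col (E : List HPoly) (i : ℕ) : (HMat.col E).entry i 0 = E.getD i (const 0) := by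
  rw [HMat.entry, HMat.col]
  by_cases hi : i < E.length
  · simp [hi]
  · simp [not_lt.1 hi]

/-- The certificate is an identity `A E = c E + R M + R' M'` of polynomial columns: the two
relations are used with multipliers `M` and `M'`, and drop out where they vanish. -/
lemma mulVec_of_isEigenvectorCert {n : ℕ} (hn : 0 < n) {A : HMat} {E : List HPoly}
    (hE : E.length ≤ n) {c R R' : HPoly} {M M' : List HPoly}
    (h : isEigenvectorCert A E c R R' M M' = true) {ρ : ℕ → ℂ} (hR : R.eval ρ 0 = 0)
    (hR' : R'.eval ρ 0 = 0) :
    HMat.toMatrix n ρ A *ᵥ (fun i : Fin n => (E.getD i (const 0)).eval ρ 0) =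
      c.eval ρ 0 • fun i : Fin n => (E.getD i (const 0)).eval ρ 0 := by
  have h1 := HMat.toMatrix_eq n ρ h
  rw [HMat.toMatrix_mul _ _ _ _ (by simpa [HMat.col] using hE), HMat.toMatrix_add,
    HMat.toMatrix_add, HMat.toMatrix_smul, HMat.toMatrix_smul, HMat.toMatrix_smul, hR, hR',
    zero_smul, zero_smul, add_zero, add_zero] at h1
  funext i
  have h2 := congrFun (congrFun h1 i) ⟨0, hn⟩
  simp only [Matrix.mul_apply, HMat.toMatrix_apply, Matrix.smul_apply, HMat.entry_col] at h2
  exact h2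

/-- Eigenvectors depending on two auxiliary variables. -/
lemma mulVec_update_of_isEigenvectorCert {n : ℕ} (hn : 0 < n) {A : HMat} {E : List HPoly}
    (hE : E.length ≤ n) {c R R' : HPoly} {M M' : List HPoly}
    (h : isEigenvectorCert A E c R R' M M' = true) (hA : A.isFree n = true)
    (hA' : A.isFree (n + 1) = true) {ρ : ℕ → ℂ} {x u : ℂ}
    (hR : R.eval (Function.update (Function.update ρ n x) (n + 1) u) 0 = 0)
    (hR' : R'.eval (Function.update (Function.update ρ n x) (n + 1) u) 0 = 0) :
    HMat.toMatrix n ρ A *ᵥ (fun i : Fin n =>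
      (E.getD i (const 0)).eval (Function.update (Function.update ρ n x) (n + 1) u) 0) =
      c.eval (Function.update (Function.update ρ n x) (n + 1) u) 0 • fun i : Fin n =>
        (E.getD i (const 0)).eval (Function.update (Function.update ρ n x) (n + 1) u) 0 := by
  rw [← mulVec_of_isEigenvectorCert hn hE h hR hR',
    HMat.toMatrix_congr_of_isFree n (n + 1) hA' (fun j hj => Function.update_of_ne hj _ _),
    HMat.toMatrix_congr_of_isFree n n hA (fun j hj => Function.update_of_ne hj _ _)]

/-- The part of the matrix of multiplication by `f / x` which does not involve the parameter of
highest weight, in terms of the matrices of multiplication by `x`, `y` and `s y / x`. -/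
def nilpotentPart (n : ℕ) (X Y V : HMat) (l₁ l₂ l₃ : List HPoly) (c : ℤ) (j : ℕ) : HMat :=
  ((X.horner n l₁).add (Y.mul (X.horner n l₂))).add
    (((V.smul (const c)).add (X.horner n l₃)).smul (var j))

namespace HMat

variable {n : ℕ} {ρ : ℕ → ℂ} {X Y V : HMat} (l₁ l₂ l₃ : List HPoly) (c : ℤ) (j : ℕ) (q : HPoly)

lemma toMatrix_scalar_add_nilpotentPart (hX : X.length ≤ n) :
    toMatrix n ρ ((scalar q n).add (nilpotentPart n X Y V l₁ l₂ l₃ c j)) =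
      q.eval ρ 0 • (1 : Matrix (Fin n) (Fin n) ℂ) + ((toMatrix n ρ (X.horner n l₁) +
        toMatrix n ρ Y * toMatrix n ρ (X.horner n l₂)) +
        ρ j • ((c : ℂ) • toMatrix n ρ V + toMatrix n ρ (X.horner n l₃))) := by
  rw [toMatrix_add, toMatrix_scalar, nilpotentPart, toMatrix_add, toMatrix_add, toMatrix_smul,
    toMatrix_add, toMatrix_smul, toMatrix_mul _ _ _ _ (length_horner_le n hX l₂), eval_var,
    eval_const, zero_add]

lemma commute_scalar_add_nilpotentPart (hX : X.length ≤ n) {B : Matrix (Fin n) (Fin n) ℂ}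
    (h₁ : Commute B (toMatrix n ρ X)) (h₂ : Commute B (toMatrix n ρ Y))
    (h₃ : Commute B (toMatrix n ρ V)) :
    Commute B (toMatrix n ρ ((scalar q n).add (nilpotentPart n X Y V l₁ l₂ l₃ c j))) := by
  rw [toMatrix_scalar_add_nilpotentPart _ _ _ _ _ _ hX]
  exact ((Commute.one_right _).smul_right _).add_right
    (((commute_horner n ρ hX _ h₁).add_right (h₂.mul_right (commute_horner n ρ hX _ h₁))).add_right
      (((h₃.smul_right _).add_right (commute_horner n ρ hX _ h₁)).smul_right _))

lemma scalar_add_nilpotentPart_mulVec (hX : X.length ≤ n) {v : Fin n → ℂ} {x y w : ℂ}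
    (h₁ : toMatrix n ρ X *ᵥ v = x • v) (h₂ : toMatrix n ρ Y *ᵥ v = y • v)
    (h₃ : toMatrix n ρ V *ᵥ v = w • v) :
    toMatrix n ρ ((scalar q n).add (nilpotentPart n X Y V l₁ l₂ l₃ c j)) *ᵥ v =
      (q.eval ρ 0 + ((hornerVal ρ x l₁ + y * hornerVal ρ x l₂) +
        ρ j * (c * w + hornerVal ρ x l₃))) • v := by
  rw [toMatrix_scalar_add_nilpotentPart _ _ _ _ _ _ hX, Matrix.add_mulVec, Matrix.add_mulVec,
    Matrix.add_mulVec, Matrix.smul_mulVec, Matrix.smul_mulVec, Matrix.add_mulVec,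
    Matrix.smul_mulVec, Matrix.one_mulVec, ← Matrix.mulVec_mulVec,
    toMatrix_horner_mulVec n ρ hX l₁ h₁, toMatrix_horner_mulVec n ρ hX l₂ h₁,
    toMatrix_horner_mulVec n ρ hX l₃ h₁, h₃, Matrix.mulVec_smul, h₂]
  module

/-- If the matrix of multiplication by `f / x` is singular, then there is a common eigenvector of
multiplication by `x`, `y` and `s y / x` at which `f / x` vanishes. -/
lemma exists_eigenvector_of_det_eq_zero (hX : X.length ≤ n) (hY : Y.length ≤ n)
    (hV : V.length ≤ n) (hXY : (X.mul Y).eq (Y.mul X) = true)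
    (hXV : (X.mul V).eq (V.mul X) = true) (hYV : (Y.mul V).eq (V.mul Y) = true)
    (h : (toMatrix n ρ ((scalar q n).add (nilpotentPart n X Y V l₁ l₂ l₃ c j))).det = 0) :
    ∃ (v : Fin n → ℂ) (x y w : ℂ), v ≠ 0 ∧ toMatrix n ρ X *ᵥ v = x • v ∧
      toMatrix n ρ Y *ᵥ v = y • v ∧ toMatrix n ρ V *ᵥ v = w • v ∧
      q.eval ρ 0 + ((hornerVal ρ x l₁ + y * hornerVal ρ x l₂) +
        ρ j * (c * w + hornerVal ρ x l₃)) = 0 := by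
  have hXY : Commute (toMatrix n ρ X) (toMatrix n ρ Y) := by
    rw [commute_iff_eq, ← toMatrix_mul _ _ _ _ hY, ← toMatrix_mul _ _ _ _ hX, toMatrix_eq n ρ hXY]
  have hXV : Commute (toMatrix n ρ X) (toMatrix n ρ V) := by
    rw [commute_iff_eq, ← toMatrix_mul _ _ _ _ hV, ← toMatrix_mul _ _ _ _ hX, toMatrix_eq n ρ hXV]
  have hYV : Commute (toMatrix n ρ Y) (toMatrix n ρ V) := by
    rw [commute_iff_eq, ← toMatrix_mul _ _ _ _ hV, ← toMatrix_mul _ _ _ _ hY, toMatrix_eq n ρ hYV]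
  obtain ⟨v, x, y, w, hv, h0, h₁, h₂, h₃⟩ := Matrix.exists_common_eigenvector h
    (commute_scalar_add_nilpotentPart _ _ _ _ _ _ hX (Commute.refl _) hXY hXV)
    (commute_scalar_add_nilpotentPart _ _ _ _ _ _ hX hXY.symm (Commute.refl _) hYV)
    (commute_scalar_add_nilpotentPart _ _ _ _ _ _ hX hXV.symm hYV.symm (Commute.refl _))
    hXY hXV hYV
  refine ⟨v, x, y, w, hv, h₁, h₂, h₃, ?_⟩
  rw [scalar_add_nilpotentPart_mulVec _ _ _ _ _ _ hX h₁ h₂ h₃] at h0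
  exact (smul_eq_zero.1 h0).resolve_right hv

end HMat

/-- The singular points of the surface `z ^ 2 = f(x, y)` with `f = y ^ 3 + A(x) + y B(x) + s y ^ 2`
are given by `f / x = 0` and two equations in `x` and `u = y / x`. -/
lemma exists_isSingularPoint_iff {α₁ α₂ α₃ α₄ α₅ β₁ β₂ β₃ s : ℂ} (hα : α₁ ≠ 0)
    {g : (Fin 3 → ℂ) → ℂ}
    (hg : ∀ a, g a = a 2 ^ 2 - (a 1 ^ 3 + (α₁ * a 0 + α₂ * a 0 ^ 2 + α₃ * a 0 ^ 3 + α₄ * a 0 ^ 4 +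
      α₅ * a 0 ^ 5) + a 1 * (β₁ * a 0 + β₂ * a 0 ^ 2 + β₃ * a 0 ^ 3) + s * a 1 ^ 2)) :
    (∃ a, IsSingularPoint g a) ↔ ∃ x u : ℂ, x ≠ 0 ∧
      3 * x * u ^ 2 + 2 * s * u + (β₁ + β₂ * x + β₃ * x ^ 2) = 0 ∧
      s * u ^ 2 - 3 * (α₂ + 2 * α₃ * x + 3 * α₄ * x ^ 2 + 4 * α₅ * x ^ 3) -
        u * (β₁ + 4 * β₂ * x + 7 * β₃ * x ^ 2) = 0 ∧
      x ^ 2 * u ^ 3 + (α₁ + α₂ * x + α₃ * x ^ 2 + α₄ * x ^ 3 + α₅ * x ^ 4) +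
        u * (β₁ * x + β₂ * x ^ 2 + β₃ * x ^ 3) + s * x * u ^ 2 = 0 := by
  simp only [isSingularPoint_iff _ _ _ _ _ _ _ _ _ g hg]
  constructor
  · rintro ⟨a, -, h1, h2, h3⟩
    generalize a 0 = x at h1 h2 h3
    generalize a 1 = y at h1 h2 h3
    have hx : x ≠ 0 := by
      rintro rfl
      -- At `x = 0` one has `y f_y - 2 f = y ^ 3`. So `y = 0`, where `f_x` equals `α₁`.
      have hy : y ^ 3 = 0 := by linear_combination -2 * h1 + y * h3
      have hy : y = 0 := pow_eq_zero_iff (by norm_num) |>.1 hy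
      rw [hy] at h2
      exact hα (by linear_combination h2)
    refine ⟨x, y / x, hx, ?_, ?_, ?_⟩
    · field_simp
      linear_combination h3
    · field_simp
      -- In `3 f - 3 x f_x - y f_y` the terms `α₁ x` and `y ^ 3` cancel, which makes it divisible by
      -- `x ^ 2` and free of `α₁`.
      linear_combination 3 * h1 - 3 * x * h2 - y * h3
    · field_simp
      linear_combination h1
  · rintro ⟨x, u, hx, h1, h2, h3⟩
    refine ⟨![x, x * u, 0], rfl, ?_, ?_, ?_⟩
    · simp only [Matrix.cons_val_zero, Matrix.cons_val_one]
      linear_combination x * h3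
    · simp only [Matrix.cons_val_zero, Matrix.cons_val_one]
      -- The same combination solved for `f_x`, after division by `3 x`.
      linear_combination h3 - x / 3 * h2 - x * u / 3 * h1
    · simp only [Matrix.cons_val_zero, Matrix.cons_val_one]
      linear_combination x * h1

end

/-! ### Type `E6`. -/

noncomputable section

open HPoly
open scoped Matrix

set_option maxRecDepth 100000

namespace E6

/-- A multiple of the polynomial part of the potential of type `E6(1)`. -/
def potential : HPoly :=
  ofTerms [
    (353808, [10]), (972000, [7, 2]), (45360, [7, 0, 0, 1]), (45360, [6, 1, 1]),
    (-22680, [6, 0, 0, 0, 1]), (108864, [5, 0, 2]), (292320, [4, 4]), (-151200, [4, 2, 0, 1]),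
    (22680, [4, 0, 0, 2]), (-70560, [3, 3, 1]), (75600, [3, 2, 0, 0, 1]), (105840, [3, 1, 1, 1]),
    (7560, [3, 0, 0, 1, 1]), (22680, [2, 2, 2]), (-22680, [2, 1, 1, 0, 1]),
    (15120, [2, 0, 2, 1]), (1890, [2, 0, 0, 0, 2]), (29120, [1, 6]), (-16800, [1, 4, 0, 1]),
    (8400, [1, 2, 0, 2]), (5040, [1, 1, 3]), (3780, [1, 0, 2, 0, 1]), (1400, [1, 0, 0, 3]),
    (420, [1, 0, 0, 0, 0, 2]), (-7392, [0, 5, 1]), (5040, [0, 4, 0, 0, 1]), (3360, [0, 3, 1, 1]),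
    (-3360, [0, 2, 0, 1, 1]), (840, [0, 1, 1, 2]), (840, [0, 1, 0, 0, 1, 1]), (315, [0, 0, 4]),
    (840, [0, 0, 1, 1, 0, 1]), (420, [0, 0, 0, 2, 1])]

/-- A multiple of `x_5 - v`. -/
def branch : HPoly :=
  ofTerms [(9, [4]), (12, [1, 2]), (-2, [1, 0, 0, 1]), (-2, [0, 1, 1]), (1, [0, 0, 0, 0, 1])]

/-- Multiplication by `27 x`. -/
def X : HMat :=
  [
    [ofTerms [(-18, [0, 1])], ofTerms [(4, [2]), (-18, [0, 0, 0, 0, 0, 1])], ofTerms [(-1, [1, 0,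
      0, 0, 0, 1]), (-9, [0, 0, 0, 1])], ofTerms [(5, [1, 0, 1]), (-12, [0, 1, 0, 0, 0, 1])],
      ofTerms [(-1, [0, 0, 1, 0, 0, 1])], ofTerms [(1, [0, 0, 2]), (-6, [0, 0, 0, 1, 0, 1])]],
    [ofTerms [(-12, [1])], ofTerms [(-18, [0, 1])], ofTerms [(-3, [0, 0, 1])], ofTerms [(-1, [1,
      0, 0, 0, 0, 1]), (-9, [0, 0, 0, 1])], ofTerms [(-2, [0, 0, 0, 0, 0, 2])], ofTerms [(-1, [0,
      0, 1, 0, 0, 1])]],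
    [const 27, const 0, const 0, const 0, const 0, const 0],
    [const 0, const 27, const 0, const 0, const 0, const 0],
    [const 0, const 0, const 27, const 0, const 0, const 0],
    [const 0, const 0, const 0, const 27, const 0, const 0]]

/-- Multiplication by `81 y`. -/
def Y : HMat :=
  [
    [ofTerms [(12, [2]), (-54, [0, 0, 0, 0, 0, 1])], ofTerms [(18, [1, 1]), (-27, [0, 0, 1])],
      ofTerms [(3, [1, 0, 1])], ofTerms [(1, [2, 0, 0, 0, 0, 1]), (9, [1, 0, 0, 1])], ofTerms
      [(2, [1, 0, 0, 0, 0, 2])], ofTerms [(1, [1, 0, 1, 0, 0, 1])]],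
    [ofTerms [(-54, [0, 1])], ofTerms [(12, [2]), (-54, [0, 0, 0, 0, 0, 1])], ofTerms [(-3, [1,
      0, 0, 0, 0, 1]), (-27, [0, 0, 0, 1])], ofTerms [(15, [1, 0, 1]), (-36, [0, 1, 0, 0, 0,
      1])], ofTerms [(-3, [0, 0, 1, 0, 0, 1])], ofTerms [(3, [0, 0, 2]), (-18, [0, 0, 0, 1, 0,
      1])]],
    [const 0, ofTerms [(-27, [1])], ofTerms [(-54, [0, 0, 0, 0, 0, 1])], ofTerms [(-27, [0, 0,
      1])], const 0, const 0],
    [const 81, const 0, const 0, const 0, const 0, const 0],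
    [const 0, const 0, const 0, ofTerms [(-27, [1])], ofTerms [(-54, [0, 0, 0, 0, 0, 1])],
      ofTerms [(-27, [0, 0, 1])]],
    [const 0, const 0, const 81, const 0, const 0, const 0]]

/-- Multiplication by `3 s y / x`. -/
def V : HMat :=
  [
    [const 0, ofTerms [(-1, [1, 0, 0, 0, 0, 1])], ofTerms [(-2, [0, 0, 0, 0, 0, 2])], ofTerms
      [(-1, [0, 0, 1, 0, 0, 1])], const 0, const 0],
    [ofTerms [(3, [0, 0, 0, 0, 0, 1])], const 0, const 0, const 0, const 0, const 0],
    [const 0, const 0, const 0, ofTerms [(-1, [1, 0, 0, 0, 0, 1])], ofTerms [(-2, [0, 0, 0, 0, 0,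
      2])], ofTerms [(-1, [0, 0, 1, 0, 0, 1])]],
    [const 0, const 0, ofTerms [(3, [0, 0, 0, 0, 0, 1])], const 0, const 0, const 0],
    [const 0, const 27, ofTerms [(12, [1])], ofTerms [(18, [0, 1])], ofTerms [(3, [0, 0, 1])],
      ofTerms [(9, [0, 0, 0, 1])]],
    [const 0, const 0, const 0, const 0, ofTerms [(3, [0, 0, 0, 0, 0, 1])], const 0]]

/-- Multiplication by `19683 (f / x - t9)`. -/
def nilpotent : HMat :=
  nilpotentPart 6 X Y V
    [const 0, smul 486 (var 3), smul 9 (var 1)]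
    [smul 135 (var 2), smul 2 (var 0)]
    [smul (-2916) (var 2), smul (-108) (var 0)]
    (-1944) 5

/-- Multiplication by `19683 f / x`. -/
def valueMatrix : HMat := (HMat.scalar (smul 19683 (var 4)) 6).add nilpotent

/-- The coordinates `x` and the function `z` as polynomials in rescaled coordinates. -/
def coordinate : List HPoly := [
    var 0, var 1, var 2, var 3,
    ofTerms [(-9, [4]), (-12, [1, 2]), (2, [1, 0, 0, 1]), (2, [0, 1, 1]), (1, [0, 0, 0, 0, 2])],
    var 5, var 4]

/-- The parameters of the family as polynomials in rescaled coordinates. -/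
def parameter : List HPoly := [
    ofTerms [(-108, [1])],
    ofTerms [(216, [0, 1])],
    ofTerms [(-9072, [1, 1]), (648, [0, 0, 1])],
    ofTerms [(42768, [3]), (-3888, [1, 0, 0, 0, 1]), (14256, [0, 2]), (-1296, [0, 0, 0, 1])],
    ofTerms [
      (2099520, [3, 1]), (-349920, [2, 0, 1]), (-326592, [1, 1, 0, 0, 1]), (259200, [0, 3]),
      (-77760, [0, 1, 0, 1]), (23328, [0, 0, 1, 0, 1]), (7776, [0, 0, 0, 0, 0, 1])],
    ofTerms [(108, [0, 0, 0, 0, 1])]]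

/-- The transition matrix between the flat frame and the frame of monomials. -/
def transition : HMat :=
  [
    [const (-108), const 0, ofTerms [(-9072, [0, 1])], ofTerms [(128304, [2]), (-3888, [0, 0, 0,
      0, 1])], ofTerms [(-139968, [3]), (-46656, [0, 2]), (7776, [0, 0, 0, 1])], ofTerms
      [(6298560, [2, 1]), (-699840, [1, 0, 1]), (-326592, [0, 1, 0, 0, 1])]],
    [const 0, const 216, ofTerms [(-9072, [1])], ofTerms [(28512, [0, 1])], ofTerms [(-93312, [1,
      1]), (7776, [0, 0, 1])], ofTerms [ (2099520, [3]), (-326592, [1, 0, 0, 0, 1]), (777600, [0,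
      2]), (-77760, [0, 0, 0, 1])]],
    [const 0, const 0, const 648, const 0, ofTerms [(7776, [0, 1])], ofTerms [(-349920, [2]),
      (23328, [0, 0, 0, 0, 1])]],
    [const 0, const 0, const 0, const (-1296), ofTerms [(7776, [1])], ofTerms [(-77760, [0, 1])]],
    [const 0, const 0, const 0, const 0, const (-3888), const 0],
    [const 0, const 0, const 0, const 0, const 0, const 7776]]

/-- A multiple of the matrix `T`. -/
def matrixT : HMat :=
  eulerMatrix 6 840 1260 potential branch [2, 3, 5, 6, 8, 9, 4]

/-- The rescaled coordinates as polynomials in the parameters. -/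
def inverse : List HPoly := [
    ofTerms [(-3, [1])],
    ofTerms [(27, [0, 1])],
    ofTerms [(-1134, [1, 1]), (2916, [0, 0, 1])],
    ofTerms [(-891, [3]), (8748, [1, 0, 0, 0, 0, 1]), (8019, [0, 2]), (-26244, [0, 0, 0, 1])],
    ofTerms [(972, [0, 0, 0, 0, 0, 1])],
    ofTerms [
      (-503010, [3, 1]), (1180980, [2, 0, 1]), (2361960, [1, 1, 0, 0, 0, 1]), (1509030, [0, 3]),
      (-7085880, [0, 1, 0, 1]), (-8503056, [0, 0, 1, 0, 0, 1]), (25509168, [0, 0, 0, 0, 1])]]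

/-- The weights of the parameters. -/
def weight : List ℕ := [2, 3, 5, 6, 9, 4]

/-- The weights of the coordinates. -/
def coordWeight : List ℕ := [2, 3, 5, 6, 4, 9]

/-- Row `i` of `transition` is the class of `(∂f/∂x_i) / x` in the monomials `x²u, x², xu, x, u, 1`.
The factor `1 / z` in `∂z/∂x_i` disappears: `∂f/∂s` contributes `x u ^ 2`, which reduces by
`relation₁` to `-(2 s u + t5 + t2 x) / 3`; the part without `u` is cancelled by the dependence of
`t6` and `t9` on `z`, and `s` is a multiple of `z`. The identity says that in this frame
multiplication by `f / x` is `7776 T`, where `7776` is also the coefficient of `x6` in `t9`; the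
factors `35` and `708588` only compare the integer multiples used for both matrices. -/
lemma eq_transition :
    ((transition.mul (valueMatrix.subst (listSubst parameter))).smul (const 35)).eq
      (((matrixT.subst (listSubst coordinate)).mul transition).smul (const 708588)) =
      true := by
  decide +kernel

lemma isTriangular_transition :
    transition.isTriangular 6 [-108, 216, 648, -1296, -3888, 7776] = true := by
  decide +kernel

lemma isInverse_parameter : isInverseCert 6 parameter inverse 18 weight = true := by
  decide +kernel

lemma isInverse_inverse : isInverseCert 6 inverse parameter 18 coordWeight = true := by
  decide +kernel

lemma isHomogeneousMap_parameter :
    isHomogeneousMap 6 coordWeight weight parameter = true := by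
  decide +kernel

/-- The exponents are the weights of the monomials of the frame, where `x` has weight `3` and `u`
has weight `1`; `f / x` has weight `9`. -/
lemma isHomogeneous_valueMatrix :
    valueMatrix.isHomogeneous 6 weight [7, 6, 4, 3, 1, 0] 9 = true := by
  decide +kernel

lemma isFree_nilpotent : nilpotent.isFree 4 = true := by
  decide +kernel

lemma X_mul_Y : (X.mul Y).eq (Y.mul X) = true := by
  decide +kernel

lemma X_mul_V : (X.mul V).eq (V.mul X) = true := by
  decide +kernel

lemma Y_mul_V : (Y.mul V).eq (V.mul Y) = true := by
  decide +kernel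

/-- The potential of type `E6(1)`. -/
def potentialData : PotentialData 6 4 weightE6 (fun x => vE6 (x 0) (x 1) (x 2) (x 3))
    (fun x z => potentialE6 (x 0) (x 1) (x 2) (x 3) (x 4) (x 5) z) where
  Q := potential
  r := branch
  W := [2, 3, 5, 6, 8, 9, 4]
  L := 840
  b := 1
  β := 840
  γ := 1260
  h := 9
  W' := 4
  L_ne := by norm_num
  b_ne := by norm_num
  h_ne := by norm_num
  two_b_mul_γ := by norm_num
  eval_Q x z := by
    simp only [potentialE6, potential, eval_ofTerms_cons,
      eval_ofTerms_nil,
      eval_monomial_cons, eval_monomial_nil, Nat.reduceAdd]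
    simp [slots]
    ring
  eval_r x z := by
    simp only [vE6, branch, eval_ofTerms_cons, eval_ofTerms_nil,
      eval_monomial_cons, eval_monomial_nil, Nat.reduceAdd]
    simp [slots]
    ring
  v_update x y := rfl
  weight k := by fin_cases k <;> norm_num [weightE6]
  weight_z := rfl
  weight_r := by decide +kernel
  deriv_r := by decide +kernel
  deriv_z_Q := by decide +kernel
  deriv_z_r := by decide +kernel
  deriv_z_deriv_Q := by decide +kernel
  deriv_z_deriv_r := by decide +kernel

/-- An eigenvector of the matrices in terms of two further variables, which stand for `x` and
`y / x`. -/
def eigenvector : List HPoly :=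
    [ofTerms [(1, [0, 0, 0, 0, 0, 0, 2, 1])], ofTerms [(1, [0, 0, 0, 0, 0, 0, 2])], ofTerms [(1,
      [0, 0, 0, 0, 0, 0, 1, 1])], ofTerms [(1, [0, 0, 0, 0, 0, 0, 1])], ofTerms [(1, [0, 0, 0, 0,
      0, 0, 0, 1])], const 1]

/-- The derivative of `f` with respect to `y`, divided by `x`. -/
def relation₁ : HPoly :=
  ofTerms [
    (1, [1, 0, 0, 0, 0, 0, 1]), (1, [0, 0, 1]), (2, [0, 0, 0, 0, 0, 1, 0, 1]),
    (3, [0, 0, 0, 0, 0, 0, 1, 2])]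

/-- A combination of the derivatives of `f`, divided by `x ^ 2`. -/
def relation₂ : HPoly :=
  ofTerms [
    (-4, [1, 0, 0, 0, 0, 0, 1, 1]), (-6, [0, 1, 0, 0, 0, 0, 1]), (-1, [0, 0, 1, 0, 0, 0, 0, 1]),
    (-3, [0, 0, 0, 1]), (1, [0, 0, 0, 0, 0, 1, 0, 2]), (-9, [0, 0, 0, 0, 0, 0, 2])]

/-- Only `x · x²u` and `x · x²` leave the list of monomials, so the relations enter in the first two
rows alone. -/
lemma isEigenvector_X : isEigenvectorCert X eigenvector
    (ofTerms [(27, [0, 0, 0, 0, 0, 0, 1])]) relation₁ relation₂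
    [ofTerms [(4, [1, 0, 0, 0, 0, 0, 1]), (1, [0, 0, 1]), (-1, [0, 0, 0, 0, 0, 1, 0, 1])],
      ofTerms [(-1, [0, 0, 0, 0, 0, 1])], const 0, const 0, const 0, const 0]
    [ofTerms [(2, [0, 0, 0, 0, 0, 1]), (3, [0, 0, 0, 0, 0, 0, 1, 1])], ofTerms [(3, [0, 0, 0, 0,
      0, 0, 1])], const 0, const 0, const 0, const 0] = true := by
  decide +kernel

lemma isEigenvector_Y : isEigenvectorCert Y eigenvector
    (ofTerms [(81, [0, 0, 0, 0, 0, 0, 1, 1])]) relation₁ relation₂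
    [ofTerms [ (1, [1, 0, 0, 0, 0, 1]), (12, [1, 0, 0, 0, 0, 0, 1, 1]), (18, [0, 1, 0, 0, 0, 0,
      1]), (3, [0, 0, 1, 0, 0, 0, 0, 1]), (9, [0, 0, 0, 1]), (-3, [0, 0, 0, 0, 0, 1, 0, 2])],
      ofTerms [(12, [1, 0, 0, 0, 0, 0, 1]), (3, [0, 0, 1]), (-3, [0, 0, 0, 0, 0, 1, 0, 1])],
      ofTerms [(-27, [0, 0, 0, 0, 0, 0, 1])], const 0, const (-27), const 0]
    [ofTerms [(3, [0, 0, 1]), (6, [0, 0, 0, 0, 0, 1, 0, 1]), (9, [0, 0, 0, 0, 0, 0, 1, 2])],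
      ofTerms [(6, [0, 0, 0, 0, 0, 1]), (9, [0, 0, 0, 0, 0, 0, 1, 1])], const 0, const 0, const
      0, const 0] = true := by
  decide +kernel

/-- Multiplication by `u` alone would require reducing `u ^ 2`, for which neither relation suffices;
with the factor `s`, `relation₂` does it in the row of `u`. -/
lemma isEigenvector_V : isEigenvectorCert V eigenvector
    (ofTerms [(3, [0, 0, 0, 0, 0, 1, 0, 1])]) relation₁ relation₂
    [ofTerms [(-1, [0, 0, 0, 0, 0, 1, 1])], const 0, ofTerms [(-1, [0, 0, 0, 0, 0, 1])], const 0,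
      const 0, const 0]
    [const 0, const 0, const 0, const 0, const (-3), const 0] = true := by
  decide +kernel

/-- For `y = x u` and `w = s u` the right side is `2187 (9 f / x - (3 x u + 4 s / 3) R₁ + x R₂)`.
This combination removes `x²u³`, `x u²` and `x³`, and leaves each coefficient `t_k` with the factor
`k`, apart from the terms with `s`. -/
lemma valueMatrix_mulVec_eigenvalue (p : Fin 6 → ℂ) (x y w : ℂ) :
    (smul 19683 (var 4)).eval (slots p 0) 0 + ((HMat.hornerVal (slots p 0) (27 * x)
      [const 0, smul 486 (var 3), smul 9 (var 1)] +
      81 * y * HMat.hornerVal (slots p 0) (27 * x)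
      [smul 135 (var 2), smul 2 (var 0)]) +
      slots p 0 5 * ((-1944 : ℤ) * (3 * w) + HMat.hornerVal (slots p 0) (27 * x)
      [smul (-2916) (var 2), smul (-108) (var 0)])) =
      2187 * (9 * p 4 + 6 * p 3 * x + 3 * p 1 * x ^ 2 + 5 * p 2 * y + 2 * p 0 * x * y - 8/3 * p 5 * w -
        4/3 * p 5 * p 2 - 4/3 * p 5 * p 0 * x) := by
  simp [HMat.hornerVal, slots]
  ring

lemma exists_isSingularPoint_surface_iff {p : Fin 6 → ℂ} (hp : p 4 ≠ 0) :
    (∃ a, IsSingularPoint (surfaceE6 p) a) ↔ ∃ x u : ℂ, x ≠ 0 ∧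
      3 * x * u ^ 2 + 2 * p 5 * u + (p 2 + p 0 * x + 0 * x ^ 2) = 0 ∧
      p 5 * u ^ 2 - 3 * (p 3 + 2 * p 1 * x + 3 * 1 * x ^ 2 + 4 * 0 * x ^ 3) -
        u * (p 2 + 4 * p 0 * x + 7 * 0 * x ^ 2) = 0 ∧
      x ^ 2 * u ^ 3 + (p 4 + p 3 * x + p 1 * x ^ 2 + 1 * x ^ 3 + 0 * x ^ 4) +
        u * (p 2 * x + p 0 * x ^ 2 + 0 * x ^ 3) + p 5 * x * u ^ 2 = 0 :=
  exists_isSingularPoint_iff hp fun a => by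
    rw [surfaceE6, fE6]
    ring

lemma det_eq_zero_of_isSingularPoint {p : Fin 6 → ℂ} (hp : p 4 ≠ 0)
    (h : ∃ a, IsSingularPoint (surfaceE6 p) a) :
    (HMat.toMatrix 6 (slots p 0) valueMatrix).det = 0 := by
  obtain ⟨x, u, hx, h1, h2, h3⟩ := (exists_isSingularPoint_surface_iff hp).1 h
  have hR : relation₁.eval
      (Function.update (Function.update (slots p 0) 6 x) (6 + 1) u) 0 = 0 := by
    simp [relation₁, slots]
    linear_combination h1
  have hR' : relation₂.eval
      (Function.update (Function.update (slots p 0) 6 x) (6 + 1) u) 0 = 0 := by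
    simp [relation₂, slots]
    linear_combination h2
  have hX := mulVec_update_of_isEigenvectorCert (by norm_num) (by decide +kernel)
    isEigenvector_X (by decide +kernel) (by decide +kernel) hR hR'
  have hY := mulVec_update_of_isEigenvectorCert (by norm_num) (by decide +kernel)
    isEigenvector_Y (by decide +kernel) (by decide +kernel) hR hR'
  have hV := mulVec_update_of_isEigenvectorCert (by norm_num) (by decide +kernel)
    isEigenvector_V (by decide +kernel) (by decide +kernel) hR hR'
  rw [← Matrix.exists_mulVec_eq_zero_iff]
  -- The null vector consists of the values of the monomials at the singular point.
  refine ⟨fun i : Fin 6 => (eigenvector.getD i (const 0)).eval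
    (Function.update (Function.update (slots p 0) 6 x) (6 + 1) u) 0, fun h0 => ?_, ?_⟩
  rotate_left
  · rw [valueMatrix, nilpotent, HMat.scalar_add_nilpotentPart_mulVec _ _ _ _ _ _
      (by decide +kernel) hX hY hV]
    refine smul_eq_zero_of_left ?_ _
    have hx : (ofTerms [(27, [0, 0, 0, 0, 0, 0, 1])]).eval
        (Function.update (Function.update (slots p 0) 6 x) (6 + 1) u) 0 = 27 * x := by
      simp
      ring
    have hy : (ofTerms [(81, [0, 0, 0, 0, 0, 0, 1, 1])]).eval
        (Function.update (Function.update (slots p 0) 6 x) (6 + 1) u) 0 = 81 * (x * u) := by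
      simp
      ring
    have hw : (ofTerms [(3, [0, 0, 0, 0, 0, 1, 0, 1])]).eval
        (Function.update (Function.update (slots p 0) 6 x) (6 + 1) u) 0 =
          3 * (p 5 * u) := by
      simp [slots]
      ring
    rw [hx, hy, hw, valueMatrix_mulVec_eigenvalue]
    linear_combination
      19683 * h3 - 2187 * (3 * u * x + 4/3 * p 5) * h1 - 2187 * (-x) * h2
  -- The vector is not zero, since its last entry is the monomial `1`.
  · have := congrFun h0 5
    simp [eigenvector] at this

/-- A common eigenvector `v` should be a multiple of the vector of monomials; its last two entries
stand for `u` and `1`. The rows of `X`, `Y`, `V` without reduction give the other entries, and one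
row of `Y` and one of `V` are the relations themselves. What must be excluded is a degenerate
eigenvector with eigenvalue `x = 0` or last entry zero. -/
lemma isSingularPoint_of_det_eq_zero {p : Fin 6 → ℂ} (hp : p 4 ≠ 0)
    (h : (HMat.toMatrix 6 (slots p 0) valueMatrix).det = 0) :
    ∃ a, IsSingularPoint (surfaceE6 p) a := by
  rw [exists_isSingularPoint_surface_iff hp]
  obtain ⟨v, x, y, w, hv, hX, hY, hV, hg⟩ := HMat.exists_eigenvector_of_det_eq_zero _ _ _ _ _ _
    (by decide +kernel) (by decide +kernel) (by decide +kernel) X_mul_Y X_mul_V Y_mul_V h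
  obtain ⟨x, rfl⟩ : ∃ x', x = 27 * x' := ⟨x / 27, by ring⟩
  obtain ⟨y, rfl⟩ : ∃ y', y = 81 * y' := ⟨y / 81, by ring⟩
  obtain ⟨w, rfl⟩ : ∃ w', w = 3 * w' := ⟨w / 3, by ring⟩
  rw [valueMatrix_mulVec_eigenvalue] at hg
  have h2 : v 0 = x * v 2 := by
    have := congrFun hX 2
    simp [Matrix.mulVec, dotProduct, Fin.sum_univ_six, HMat.toMatrix_apply, HMat.entry, X] at this
    linear_combination this / 27
  have h3 : v 1 = x * v 3 := by
    have := congrFun hX 3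
    simp [Matrix.mulVec, dotProduct, Fin.sum_univ_six, HMat.toMatrix_apply, HMat.entry, X] at this
    linear_combination this / 27
  have h4 : v 2 = x * v 4 := by
    have := congrFun hX 4
    simp [Matrix.mulVec, dotProduct, Fin.sum_univ_six, HMat.toMatrix_apply, HMat.entry, X] at this
    linear_combination this / 27
  have h5 : v 3 = x * v 5 := by
    have := congrFun hX 5
    simp [Matrix.mulVec, dotProduct, Fin.sum_univ_six, HMat.toMatrix_apply, HMat.entry, X] at this
    linear_combination this / 27
  have hy : v 2 = y * v 5 := by
    have := congrFun hY 5
    simp [Matrix.mulVec, dotProduct, Fin.sum_univ_six, HMat.toMatrix_apply, HMat.entry, Y] at this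
    linear_combination this / 81
  have hw : p 5 * v 4 = w * v 5 := by
    have := congrFun hV 5
    simp [Matrix.mulVec, dotProduct, Fin.sum_univ_six, HMat.toMatrix_apply, HMat.entry, slots,
      V] at this
    linear_combination this / 3
  -- The product `y u = x u ^ 2` is reduced by `relation₁`, so this row of `Y` will become that
  -- relation.
  have hyu : -p 0 * v 3 - 2 * p 5 * v 4 - p 2 * v 5 = 3 * y * v 4 := by
    have := congrFun hY 4
    simp [Matrix.mulVec, dotProduct, Fin.sum_univ_six, HMat.toMatrix_apply, HMat.entry, slots,
      Y] at this
    linear_combination this / 27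
  -- Likewise `s u · u` is reduced by `relation₂`.
  have hwu : 9 * v 1 + 4 * p 0 * v 2 + 6 * p 1 * v 3 + p 2 * v 4 + 3 * p 3 * v 5 =
      w * v 4 := by
    have := congrFun hV 4
    simp [Matrix.mulVec, dotProduct, Fin.sum_univ_six, HMat.toMatrix_apply, HMat.entry, slots,
      V] at this
    linear_combination this / 3
  -- At `x = 0` only the entries for `u` and `1` survive, and in both cases below the vanishing
  -- eigenvalue of `f / x` reduces to `t9 = 0`.
  by_cases hx : x = 0
  · exfalso
    have z3 : v 3 = 0 := by rw [h5, hx, zero_mul]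
    have z2 : v 2 = 0 := by rw [h4, hx, zero_mul]
    have z1 : v 1 = 0 := by rw [h3, hx, zero_mul]
    have z0 : v 0 = 0 := by rw [h2, hx, zero_mul]
    simp only [z3, z2, z1, mul_zero, add_zero, zero_add] at hyu hwu hy
    by_cases hl : v 5 = 0
    · have hu : v 4 ≠ 0 := by
        intro hu
        refine hv (funext fun i => ?_)
        fin_cases i <;> simp [z3, z2, z1, z0, hl, hu]
      have hs : p 5 = 0 := by
        rw [hl, mul_zero] at hw
        exact (mul_eq_zero.1 hw).resolve_right hu
      have hy0 : y = 0 := by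
        rw [hs, hl] at hyu
        refine (mul_eq_zero.1 (?_ : y * v 4 = 0)).resolve_right hu
        linear_combination -hyu / 3
      rw [hx, hy0, hs] at hg
      exact hp (by linear_combination hg / 19683)
    · have hy0 : y = 0 := (mul_eq_zero.1 hy.symm).resolve_right hl
      -- This is `relation₁` at `x = 0`. The terms with `s` in the eigenvalue are a multiple of `s
      -- (2 w + t5)`.
      have hW : 2 * w + p 2 = 0 := by
        refine (mul_eq_zero.1 (?_ : (2 * w + p 2) * v 5 = 0)).resolve_right hl
        rw [hy0] at hyu
        linear_combination -hyu - 2 * hw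
      rw [hx, hy0] at hg
      exact hp (by linear_combination hg / 19683 + 4/27 * p 5 * hW)
  · have hl : v 5 ≠ 0 := by
      intro hl
      have hu : v 4 = 0 := by
        rw [h4, hl, mul_zero] at hy
        exact (mul_eq_zero.1 hy).resolve_left hx
      refine hv (funext fun i => ?_)
      fin_cases i <;> simp [h2, h3, h4, h5, hl, hu]
    -- With a nonzero last entry the eigenvector can be normalized, and `u` is read off from the
    -- entry before it.
    obtain ⟨u, hu⟩ : ∃ u, v 4 = u * v 5 := ⟨v 4 / v 5, by field_simp⟩
    have hyx : y = x * u := by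
      refine mul_right_cancel₀ hl ?_
      rw [← hy, h4, hu]
      ring
    have hws : w = p 5 * u := by
      refine mul_right_cancel₀ hl ?_
      rw [← hw, hu]
      ring
    have e3 : v 3 = x * v 5 := by rw [h5]
    have e2 : v 2 = u * x * v 5 := by rw [h4, hu]; ring
    have e1 : v 1 = x ^ 2 * v 5 := by rw [h3, e3]; ring
    have e0 : v 0 = u * x ^ 2 * v 5 := by rw [h2, e2]; ring
    simp only [e1, e2, e3, hu] at hyu hwu
    subst hyx hws
    have h1 : 3 * x * u ^ 2 + 2 * p 5 * u + (p 2 + p 0 * x + 0 * x ^ 2) = 0 := by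
      refine (mul_eq_zero.1 (?_ : _ * v 5 = 0)).resolve_right hl
      linear_combination -hyu
    have h2 : p 5 * u ^ 2 - 3 * (p 3 + 2 * p 1 * x + 3 * 1 * x ^ 2 +
        4 * 0 * x ^ 3) - u * (p 2 + 4 * p 0 * x + 7 * 0 * x ^ 2) = 0 := by
      refine (mul_eq_zero.1 (?_ : _ * v 5 = 0)).resolve_right hl
      linear_combination -hwu
    refine ⟨x, u, hx, h1, h2, ?_⟩
    linear_combination
      hg / 19683 + (1/3 * u * x + 4/27 * p 5) * h1 + (-1/9 * x) * h2

/-- The discriminant of the family of type `E6(1)`. -/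
def discriminant : MvPolynomial (Fin 6) ℂ :=
  MvPolynomial.X 4 *
    (HMat.toMatrix 6 (slots (MvPolynomial.X : Fin 6 → MvPolynomial (Fin 6) ℂ) 0)
      valueMatrix).det

lemma eval_discriminant (p : Fin 6 → ℂ) : MvPolynomial.eval p discriminant =
    p 4 * (HMat.toMatrix 6 (slots p 0) valueMatrix).det := by
  rw [discriminant, map_mul, MvPolynomial.eval_X, RingHom.map_det, RingHom.mapMatrix_apply,
    HMat.map_toMatrix]
  simp only [map_slots, MvPolynomial.eval_X, map_zero]

/-- The specialization is `t6 = -3`, `s4 = 3`, with `t2`, `t3` and `t5` zero. Then `q` is the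
characteristic polynomial in `19683 t9`, and `a`, `b`, `N` prove that it has simple roots. -/
lemma squarefree_discriminant : Squarefree discriminant :=
  HMat.squarefree_X_mul_det 4 (by norm_num) isFree_nilpotent
    (p := [0, 0, 0, -3, 0, 3]) (by norm_num)
    (K := [
      [const 0, const 9881430283232838131328, const 0, const (-5962659606036), const 0, const
      (-267)],
      [const 130980657453811658665288704, const 0, const (-45645131967913296), const 0, const
      (-2204496), const 0],
      [const (-201176878065285571542793728), const 0, const 121704535860392520, const 0, const
      5235678, const 0],
      [const 0, const (-6100023868408174054176), const 0, const 4527137554128, const 0, const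
      200],
      [const 0, const 5621944659684399076176, const 0, const (-3395353165596), const 0, const
      (-150)],
      [const 54951091693758558893633472, const 0, const 0, const 0, const 0, const 0]])
    (d := 54951091693758558893633472)
    (q := 
      [27015937072819796620602010368, 0, -53455926407997909168, 0, 21695547384, 0, 1])
    (a := 
      [8494664010170949157543488, 0, -50995622777113224, 0, -3302274])
    (b := 
      [0, -17133597649614837896866656, 0, 12479528354071716, 0, 550379])
    (N := 229491308353525427251393951459732503810652605186883584)
    (by decide +kernel) (by decide +kernel)

lemma isFamilyDiscriminant : IsFamilyDiscriminant surfaceE6 discriminant := by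
  refine ⟨squarefree_discriminant, fun p => ?_⟩
  rw [eval_discriminant]
  by_cases hp : p 4 = 0
  -- If `t9 = 0`, the origin is singular.
  · simp only [hp, zero_mul, true_iff]
    refine ⟨0, (isSingularPoint_iff (p 4) (p 3) (p 1) (1) (0)
      (p 2) (p 0) (0) (p 5) _ (fun a => by rw [surfaceE6, fE6]; ring) 0).2 ?_⟩
    simp [hp]
  · rw [mul_eq_zero_iff_left hp]
    exact ⟨isSingularPoint_of_det_eq_zero hp, det_eq_zero_of_isSingularPoint hp⟩

/-- The factors relating the coordinates and the rescaled coordinates. -/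
def scale (c : ℂ) (i : Fin 6) : ℂ :=
  ([1, 1, 1, 1, 1, 1] : List ℂ).getD i 0 *
    ((81 / 4) * c ^ 7) ^ coordWeight.getD i 0

/-- A coordinate of weight `k` carries `μ ^ k` with `μ = 81 c ^ 7 / 4`. Reducing `c ^ (7 k)` by `c ^
9 = 4 / 2187` leaves the power of `c` in the transformation, with exponent `7 k` modulo `9`. -/
lemma coord_eq {c : ℂ} (hc : c ^ 9 = 4 / 2187) (p : Fin 6 → ℂ) :
    coordE6 c p = fun i => scale c i * polyMap 6 inverse p i := by
  funext i
  fin_cases i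
  · have hk : (c ^ 7) ^ 2 = (4 / 2187) ^ 1 * c ^ 5 := by
      rw [show (c ^ 7) ^ 2 = (c ^ 9) ^ 1 * c ^ 5 by ring, hc]
    simp [coordE6, transformE6, scale, polyMap, listSubst, inverse, coordWeight, slots,
      mul_pow, hk]
    ring
  · have hk : (c ^ 7) ^ 3 = (4 / 2187) ^ 2 * c ^ 3 := by
      rw [show (c ^ 7) ^ 3 = (c ^ 9) ^ 2 * c ^ 3 by ring, hc]
    simp [coordE6, transformE6, scale, polyMap, listSubst, inverse, coordWeight, slots,
      mul_pow, hk]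
    ring
  · have hk : (c ^ 7) ^ 5 = (4 / 2187) ^ 3 * c ^ 8 := by
      rw [show (c ^ 7) ^ 5 = (c ^ 9) ^ 3 * c ^ 8 by ring, hc]
    simp [coordE6, transformE6, scale, polyMap, listSubst, inverse, coordWeight, slots,
      mul_pow, hk]
    ring
  · have hk : (c ^ 7) ^ 6 = (4 / 2187) ^ 4 * c ^ 6 := by
      rw [show (c ^ 7) ^ 6 = (c ^ 9) ^ 4 * c ^ 6 by ring, hc]
    simp [coordE6, transformE6, scale, polyMap, listSubst, inverse, coordWeight, slots,
      mul_pow, hk]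
    ring
  · have hk : (c ^ 7) ^ 4 = (4 / 2187) ^ 3 * c ^ 1 := by
      rw [show (c ^ 7) ^ 4 = (c ^ 9) ^ 3 * c ^ 1 by ring, hc]
    simp [coordE6, transformE6, scale, polyMap, listSubst, inverse, coordWeight, slots,
      mul_pow, hk]
    ring
  · have hk : (c ^ 7) ^ 9 = (4 / 2187) ^ 7 * c ^ 0 := by
      rw [show (c ^ 7) ^ 9 = (c ^ 9) ^ 7 * c ^ 0 by ring, hc]
    simp [coordE6, transformE6, scale, polyMap, listSubst, inverse, coordWeight, slots,
      mul_pow, hk]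
    ring

lemma ne_zero {c : ℂ} (hc : c ^ 9 = 4 / 2187) : c ≠ 0 := by
  rintro rfl
  norm_num at hc

lemma bijective_coord {c : ℂ} (hc : c ^ 9 = 4 / 2187) : Function.Bijective (coordE6 c) := by
  have h0 := ne_zero hc
  rw [show coordE6 c = fun p i => scale c i * polyMap 6 inverse p i from
    funext fun p => coord_eq hc p]
  refine bijective_polyMap (l := 18) (by norm_num) (by decide +kernel) (by decide +kernel)
    isInverse_inverse isInverse_parameter fun i => ?_
  refine mul_ne_zero ?_ (pow_ne_zero _ (mul_ne_zero (by norm_num) (pow_ne_zero _ h0)))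
  fin_cases i <;> simp

/-- The coordinates `x` and the function `z` at the image of the parameters. -/
lemma slots_coord {c : ℂ} (hc : c ^ 9 = 4 / 2187) (p : Fin 6 → ℂ) :
    slots (Function.update (coordE6 c p) 4 (coordE6 c p 4 ^ 2 +
      vE6 (coordE6 c p 0) (coordE6 c p 1) (coordE6 c p 2)
        (coordE6 c p 3)))
      (coordE6 c p 4) = fun i => (listSubst coordinate i).eval (slots (fun i : Fin 6 =>
        ((81 / 4) * c ^ 7) ^ coordWeight.getD i 0 *
          polyMap 6 inverse p i) 0) 0 := by
  simp only [coord_eq hc, scale]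
  generalize (81 / 4) * c ^ 7 = μ
  generalize polyMap 6 inverse p = a
  funext i
  rcases lt_or_ge i 7 with hi | hi
  · interval_cases i <;>
      simp [slots, coordinate, listSubst, coordWeight, vE6] <;> ring
  · simp [slots, coordinate, listSubst, show ¬ i < 6 by omega, show i ≠ 6 by omega, hi]

lemma exists_eval_discriminant {c : ℂ} (hc : c ^ 9 = 4 / 2187) : ∃ k : ℂ, k ≠ 0 ∧
    ∀ p : Fin 6 → ℂ, p 4 * MvPolynomial.eval (coordE6 c p) potentialData.discriminant =
      k * MvPolynomial.eval p discriminant := by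
  have hμ : ((81 / 4) * c ^ 7 : ℂ) ≠ 0 :=
    mul_ne_zero (by norm_num) (pow_ne_zero _ (ne_zero hc))
  -- The constant collects `(L h) ^ (-n)` from the potential, `b ^ n / a ^ n` from the transition
  -- identity, and `(18 μ) ^ (9 n)` from the scaling, with `n = 6`.
  refine ⟨((840 : ℂ)⁻¹ * (9 : ℂ)⁻¹) ^ 6 * (((708588 : ℤ) : ℂ) ^ 6)⁻¹ *
    (((35 : ℤ) : ℂ) ^ 6 *
      ((81 / 4) * c ^ 7 * (18 : ℤ)) ^ (9 * 6)), ?_, fun p => ?_⟩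
  · refine mul_ne_zero (by norm_num) (mul_ne_zero (by norm_num)
      (pow_ne_zero _ (mul_ne_zero hμ (by norm_num))))
  · have key := HMat.det_eq_of_coordinates eq_transition (by decide +kernel) (by decide +kernel)
      isTriangular_transition (by decide +kernel) (by decide +kernel) (by decide +kernel)
      isInverse_parameter (by norm_num) isHomogeneousMap_parameter isHomogeneous_valueMatrix hμ p
    rw [← slots_coord hc p] at key
    rw [potentialData.eval_discriminant, eval_discriminant]
    change p 4 * ((((840 : ℤ) : ℂ)⁻¹ * ((9 : ℤ) : ℂ)⁻¹) ^ 6 *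
      (HMat.toMatrix 6 _ matrixT).det) = _
    have hK : (((708588 : ℤ) : ℂ) ^ 6) ≠ 0 := by norm_num
    rw [← eq_inv_mul_iff_mul_eq₀ hK] at key
    rw [key]
    push_cast
    ring

end E6

end

/-! ### Type `E7`. -/

noncomputable section

open HPoly
open scoped Matrix

set_option maxRecDepth 100000

namespace E7

/-- A multiple of the polynomial part of the potential of type `E7(1)`. -/
def potential : HPoly :=
  ofTerms [
    (519979502592, [15]), (-213586813440, [13, 1]), (71195604480, [12, 0, 1]),
    (4860255778560, [11, 2]), (-35597802240, [11, 0, 0, 1]), (-391575824640, [10, 1, 1]),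
    (-5932967040, [10, 0, 0, 0, 1]), (4461591214080, [9, 3]), (-94927472640, [9, 1, 0, 1]),
    (1893464052480, [9, 0, 2]), (-5932967040, [9, 0, 0, 0, 0, 1]), (-35597802240, [8, 2, 1]),
    (-8899450560, [8, 1, 0, 0, 1]), (17798901120, [8, 0, 1, 1]), (8690313471840, [7, 4]),
    (436073077440, [7, 2, 0, 1]), (-2385052750080, [7, 1, 2]), (-8899450560, [7, 1, 0, 0, 0, 1]),
    (2966483520, [7, 0, 1, 0, 1]), (30421591200, [7, 0, 0, 2]), (2761796157120, [6, 3, 1]),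
    (83061538560, [6, 2, 0, 0, 1]), (759419781120, [6, 1, 1, 1]), (876101466240, [6, 0, 3]),
    (2966483520, [6, 0, 1, 0, 0, 1]), (-1483241760, [6, 0, 0, 1, 1]), (7275152508624, [5, 5]),
    (695640385440, [5, 3, 0, 1]), (2626821156960, [5, 2, 2]), (83061538560, [5, 2, 0, 0, 0, 1]),
    (51913461600, [5, 1, 1, 0, 1]), (58588049520, [5, 1, 0, 2]), (-225452747520, [5, 0, 2, 1]),
    (-1483241760, [5, 0, 0, 1, 0, 1]), (554449896, [5, 0, 0, 0, 2]), (3452245196400, [4, 4, 1]),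
    (60565705200, [4, 3, 0, 0, 1]), (249184615680, [4, 2, 1, 1]), (-1010582052480, [4, 1, 3]),
    (51913461600, [4, 1, 1, 0, 0, 1]), (9393864480, [4, 1, 0, 1, 1]),
    (33620146560, [4, 0, 2, 0, 1]), (741620880, [4, 0, 1, 2]), (-247206960, [4, 0, 0, 0, 1, 1]),
    (5511479173200, [3, 6]), (732845032920, [3, 4, 0, 1]), (593543910960, [3, 3, 2]),
    (60565705200, [3, 3, 0, 0, 0, 1]), (22495833360, [3, 2, 1, 0, 1]),
    (64026602640, [3, 2, 0, 2]), (38069871840, [3, 1, 2, 1]), (3460897440, [3, 1, 0, 1, 0, 1]),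
    (-556215660, [3, 1, 0, 0, 2]), (437226709920, [3, 0, 4]), (6921794880, [3, 0, 2, 0, 0, 1]),
    (-5685760080, [3, 0, 1, 1, 1]), (-2101259160, [3, 0, 0, 3]), (158918760, [3, 0, 0, 0, 0, 2]),
    (3518867472120, [2, 5, 1]), (51480849420, [2, 4, 0, 0, 1]), (351281090160, [2, 3, 1, 1]),
    (286677671280, [2, 2, 3]), (12113141040, [2, 2, 1, 0, 0, 1]), (6921794880, [2, 2, 0, 1, 1]),
    (-22495833360, [2, 1, 2, 0, 1]), (-21630609000, [2, 1, 1, 2]),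
    (-123603480, [2, 1, 0, 0, 1, 1]), (-78447008640, [2, 0, 3, 1]),
    (3213690480, [2, 0, 1, 1, 0, 1]), (515014500, [2, 0, 1, 0, 2]), (-61801740, [2, 0, 0, 2, 1]),
    (784325882340, [1, 7]), (254375961840, [1, 5, 0, 1]), (932711860080, [1, 4, 2]),
    (42395993640, [1, 4, 0, 0, 0, 1]), (20188568400, [1, 3, 1, 0, 1]),
    (21197996820, [1, 3, 0, 2]), (6056570520, [1, 2, 2, 1]), (5191346160, [1, 2, 0, 1, 0, 1]),
    (360510150, [1, 2, 0, 0, 2]), (-117093696720, [1, 1, 4]), (-1730448720, [1, 1, 2, 0, 0, 1]),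
    (2884081200, [1, 1, 1, 1, 1]), (-865224360, [1, 1, 0, 3]), (185405220, [1, 1, 0, 0, 0, 2]),
    (7690883200, [1, 0, 3, 0, 1]), (7787019240, [1, 0, 2, 2]), (-206005800, [1, 0, 1, 0, 1, 1]),
    (185405220, [1, 0, 0, 2, 0, 1]), (-51501450, [1, 0, 0, 1, 2]),
    (72102030, [1, 0, 0, 0, 0, 0, 2]), (148385977740, [0, 6, 1]), (1413199788, [0, 5, 0, 0, 1]),
    (56527991520, [0, 4, 1, 1]), (80081321320, [0, 3, 3]), (12113141040, [0, 3, 1, 0, 0, 1]),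
    (1009428420, [0, 3, 0, 1, 1]), (3028285260, [0, 2, 2, 0, 1]), (1009428420, [0, 2, 1, 2]),
    (288408120, [0, 2, 0, 0, 1, 1]), (17496759280, [0, 1, 3, 1]),
    (1153632480, [0, 1, 1, 1, 0, 1]), (-72102030, [0, 1, 1, 0, 2]), (-72102030, [0, 1, 0, 2, 1]),
    (144204060, [0, 1, 0, 0, 0, 1, 1]), (14266588336, [0, 0, 5]),
    (-961360400, [0, 0, 3, 0, 0, 1]), (-865224360, [0, 0, 2, 1, 1]), (144204060, [0, 0, 1, 3]),
    (144204060, [0, 0, 1, 0, 1, 0, 1]), (20600580, [0, 0, 1, 0, 0, 2]),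
    (72102030, [0, 0, 0, 2, 0, 0, 1]), (20600580, [0, 0, 0, 1, 1, 1]), (1716715, [0, 0, 0, 0, 3])]

/-- A multiple of `x_6 - v`. -/
def branch : HPoly :=
  ofTerms [
    (36, [6]), (36, [4, 1]), (-12, [3, 0, 1]), (231, [2, 2]), (6, [2, 0, 0, 1]), (84, [1, 1, 1]),
    (1, [1, 0, 0, 0, 1]), (49, [0, 3]), (7, [0, 1, 0, 1]), (7, [0, 0, 2]),
    (1, [0, 0, 0, 0, 0, 1])]

/-- Multiplication by `147 x`. -/
def X : HMat :=
  [
    [ofTerms [(-729, [2]), (-231, [0, 1])], ofTerms [(-324, [1, 1]), (378, [0, 0, 1]), (21, [0,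
      0, 0, 0, 0, 0, 1])], ofTerms [ (-486, [1, 0, 1]), (351, [1, 0, 0, 0, 0, 0, 1]), (-84, [0,
      2]), (-168, [0, 0, 0, 1])], ofTerms [(-81, [1, 0, 0, 1]), (21, [0, 1, 0, 0, 0, 0, 1]),
      (189, [0, 0, 0, 0, 1])], ofTerms [ (-27, [1, 1, 0, 0, 0, 0, 1]), (-243, [1, 0, 0, 0, 1]),
      (-105, [0, 1, 0, 1]), (252, [0, 0, 1, 0, 0, 0, 1])], ofTerms [(-54, [1, 0, 0, 0, 0, 0, 2]),
      (21, [0, 0, 0, 1, 0, 0, 1])], ofTerms [(-27, [1, 0, 0, 1, 0, 0, 1]), (-21, [0, 0, 0, 2]),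
      (126, [0, 0, 0, 0, 1, 0, 1])]],
    [ofTerms [(-189, [1])], ofTerms [(-84, [0, 1])], ofTerms [(-126, [0, 0, 1]), (-7, [0, 0, 0,
      0, 0, 0, 1])], ofTerms [(-21, [0, 0, 0, 1])], ofTerms [(-7, [0, 1, 0, 0, 0, 0, 1]), (-63,
      [0, 0, 0, 0, 1])], ofTerms [(-14, [0, 0, 0, 0, 0, 0, 2])], ofTerms [(-7, [0, 0, 0, 1, 0, 0,
      1])]],
    [const 147, const 0, const 0, const 0, const 0, const 0, const 0],
    [const 0, const 147, const 0, const 0, const 0, const 0, const 0],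
    [const 0, const 0, const 147, const 0, const 0, const 0, const 0],
    [const 0, const 0, const 0, const 147, const 0, const 0, const 0],
    [const 0, const 0, const 0, const 0, const 147, const 0, const 0]]

/-- Multiplication by `1029 y`. -/
def Y : HMat :=
  [
    [ofTerms [(6561, [3]), (2835, [1, 1]), (-882, [0, 0, 1]), (-49, [0, 0, 0, 0, 0, 0, 1])],
      ofTerms [ (2916, [2, 1]), (-3402, [1, 0, 1]), (-189, [1, 0, 0, 0, 0, 0, 1]), (336, [0, 2]),
      (-147, [0, 0, 0, 1])], ofTerms [ (4374, [2, 0, 1]), (-3159, [2, 0, 0, 0, 0, 0, 1]), (756,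
      [1, 2]), (1512, [1, 0, 0, 1]), (504, [0, 1, 1]), (-21, [0, 1, 0, 0, 0, 0, 1]), (-441, [0,
      0, 0, 0, 1])], ofTerms [ (729, [2, 0, 0, 1]), (-189, [1, 1, 0, 0, 0, 0, 1]), (-1701, [1, 0,
      0, 0, 1]), (84, [0, 1, 0, 1]), (-98, [0, 0, 0, 0, 0, 0, 2])], ofTerms [ (243, [2, 1, 0, 0,
      0, 0, 1]), (2187, [2, 0, 0, 0, 1]), (945, [1, 1, 0, 1]), (-2268, [1, 0, 1, 0, 0, 0, 1]),
      (28, [0, 2, 0, 0, 0, 0, 1]), (252, [0, 1, 0, 0, 1]), (-49, [0, 0, 0, 1, 0, 0, 1])], ofTerms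
      [ (486, [2, 0, 0, 0, 0, 0, 2]), (-189, [1, 0, 0, 1, 0, 0, 1]), (56, [0, 1, 0, 0, 0, 0,
      2])], ofTerms [ (243, [2, 0, 0, 1, 0, 0, 1]), (189, [1, 0, 0, 2]), (-1134, [1, 0, 0, 0, 1,
      0, 1]), (28, [0, 1, 0, 1, 0, 0, 1])]],
    [ofTerms [(1701, [2]), (196, [0, 1])], ofTerms [(756, [1, 1]), (-882, [0, 0, 1]), (-735, [0,
      0, 0, 0, 0, 0, 1])], ofTerms [ (1134, [1, 0, 1]), (-819, [1, 0, 0, 0, 0, 0, 1]), (196, [0,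
      2]), (49, [0, 0, 0, 1])], ofTerms [(189, [1, 0, 0, 1]), (-49, [0, 1, 0, 0, 0, 0, 1]),
      (-441, [0, 0, 0, 0, 1])], ofTerms [ (63, [1, 1, 0, 0, 0, 0, 1]), (567, [1, 0, 0, 0, 1]),
      (245, [0, 1, 0, 1]), (-588, [0, 0, 1, 0, 0, 0, 1])], ofTerms [(126, [1, 0, 0, 0, 0, 0, 2]),
      (-49, [0, 0, 0, 1, 0, 0, 1])], ofTerms [(63, [1, 0, 0, 1, 0, 0, 1]), (49, [0, 0, 0, 2]),
      (-294, [0, 0, 0, 0, 1, 0, 1])]],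
    [ofTerms [(-1323, [1])], ofTerms [(-588, [0, 1])], ofTerms [(-882, [0, 0, 1]), (-49, [0, 0,
      0, 0, 0, 0, 1])], ofTerms [(-147, [0, 0, 0, 1])], ofTerms [(-49, [0, 1, 0, 0, 0, 0, 1]),
      (-441, [0, 0, 0, 0, 1])], ofTerms [(-98, [0, 0, 0, 0, 0, 0, 2])], ofTerms [(-49, [0, 0, 0,
      1, 0, 0, 1])]],
    [const (-343), const 0, ofTerms [(-343, [0, 1])], ofTerms [(-686, [0, 0, 0, 0, 0, 0, 1])],
      ofTerms [(-343, [0, 0, 0, 1])], const 0, const 0],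
    [const 0, const 1029, const 0, const 0, const 0, const 0, const 0],
    [const 0, const 0, const (-343), const 0, ofTerms [(-343, [0, 1])], ofTerms [(-686, [0, 0, 0,
      0, 0, 0, 1])], ofTerms [(-343, [0, 0, 0, 1])]],
    [const 0, const 0, const 0, const 1029, const 0, const 0, const 0]]

/-- Multiplication by `21 s y / x`. -/
def V : HMat :=
  [
    [ofTerms [(-27, [1, 0, 0, 0, 0, 0, 1])], ofTerms [(-12, [0, 1, 0, 0, 0, 0, 1])], ofTerms
      [(-18, [0, 0, 1, 0, 0, 0, 1]), (-1, [0, 0, 0, 0, 0, 0, 2])], ofTerms [(-3, [0, 0, 0, 1, 0,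
      0, 1])], ofTerms [(-1, [0, 1, 0, 0, 0, 0, 2]), (-9, [0, 0, 0, 0, 1, 0, 1])], ofTerms [(-2,
      [0, 0, 0, 0, 0, 0, 3])], ofTerms [(-1, [0, 0, 0, 1, 0, 0, 2])]],
    [ofTerms [(-7, [0, 0, 0, 0, 0, 0, 1])], const 0, ofTerms [(-7, [0, 1, 0, 0, 0, 0, 1])],
      ofTerms [(-14, [0, 0, 0, 0, 0, 0, 2])], ofTerms [(-7, [0, 0, 0, 1, 0, 0, 1])], const 0,
      const 0],
    [const 0, ofTerms [(21, [0, 0, 0, 0, 0, 0, 1])], const 0, const 0, const 0, const 0, const 0],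
    [const 0, const 0, ofTerms [(-7, [0, 0, 0, 0, 0, 0, 1])], const 0, ofTerms [(-7, [0, 1, 0, 0,
      0, 0, 1])], ofTerms [(-14, [0, 0, 0, 0, 0, 0, 2])], ofTerms [(-7, [0, 0, 0, 1, 0, 0, 1])]],
    [const 0, const 0, const 0, ofTerms [(21, [0, 0, 0, 0, 0, 0, 1])], const 0, const 0, const 0],
    [const 0, const 147, ofTerms [(189, [1])], ofTerms [(84, [0, 1])], ofTerms [(126, [0, 0,
      1])], ofTerms [(21, [0, 0, 0, 1])], ofTerms [(63, [0, 0, 0, 0, 1])]],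
    [const 0, const 0, const 0, const 0, const 0, ofTerms [(21, [0, 0, 0, 0, 0, 0, 1])], const 0]]

/-- Multiplication by `22235661 (f / x - t7)`. -/
def nilpotent : HMat :=
  nilpotentPart 7 X Y V
    [const 0, smul 108045 (var 4), smul 441 (var 2), smul 1 (var 0)]
    [smul 12348 (var 3), smul 42 (var 1)]
    [smul (-3176523) (var 3), smul (-21609) (var 1), const (-147)]
    (-302526) 6

/-- Multiplication by `22235661 f / x`. -/
def valueMatrix : HMat := (HMat.scalar (smul 22235661 (var 5)) 7).add nilpotent

/-- The coordinates `x` and the function `z` as polynomials in rescaled coordinates. -/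
def coordinate : List HPoly := [
    var 0, var 1, var 2, var 3, var 4,
    ofTerms [
      (-36, [6]), (-36, [4, 1]), (12, [3, 0, 1]), (-231, [2, 2]), (-6, [2, 0, 0, 1]),
      (-84, [1, 1, 1]), (-1, [1, 0, 0, 0, 1]), (-49, [0, 3]), (-7, [0, 1, 0, 1]),
      (-7, [0, 0, 2]), (1, [0, 0, 0, 0, 0, 2])],
    var 6, var 5]

/-- The parameters of the family as polynomials in rescaled coordinates. -/
def parameter : List HPoly := [
    ofTerms [(-28, [1])],
    ofTerms [(-1092, [2]), (-588, [0, 1])],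
    ofTerms [(7616, [3]), (19992, [1, 1]), (1176, [0, 0, 1]), (-84, [0, 0, 0, 0, 0, 1])],
    ofTerms [
      (21168, [4]), (296352, [2, 1]), (49392, [1, 0, 1]), (86436, [0, 2]), (3528, [0, 0, 0, 1])],
    ofTerms [
      (-1862784, [5]), (-3259872, [3, 1]), (-155232, [2, 0, 1]), (91728, [2, 0, 0, 0, 0, 1]),
      (-4346496, [1, 2]), (-77616, [1, 0, 0, 1]), (-543312, [0, 1, 1]),
      (49392, [0, 1, 0, 0, 0, 1]), (-3528, [0, 0, 0, 0, 1])],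
    ofTerms [
      (-21306240, [7]), (277385472, [5, 1]), (96526080, [4, 0, 1]),
      (-1778112, [4, 0, 0, 0, 0, 1]), (235599840, [3, 2]), (6350400, [3, 0, 0, 1]),
      (17781120, [2, 1, 1]), (-24893568, [2, 1, 0, 0, 0, 1]), (-635040, [2, 0, 0, 0, 1]),
      (248935680, [1, 3]), (13335840, [1, 1, 0, 1]), (-7408800, [1, 0, 2]),
      (-4148928, [1, 0, 1, 0, 0, 1]), (211680, [1, 0, 0, 0, 0, 2]), (51861600, [0, 2, 1]),
      (-7260624, [0, 2, 0, 0, 0, 1]), (740880, [0, 1, 0, 0, 1]), (1481760, [0, 0, 1, 1]),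
      (-296352, [0, 0, 0, 1, 0, 1]), (148176, [0, 0, 0, 0, 0, 0, 1])],
    ofTerms [(-252, [0, 0, 0, 0, 0, 1])]]

/-- The transition matrix between the flat frame and the frame of monomials. -/
def transition : HMat :=
  [
    [const (-28), ofTerms [(-2184, [1])], ofTerms [(22848, [2]), (19992, [0, 1])], ofTerms
      [(84672, [3]), (592704, [1, 1]), (49392, [0, 0, 1])], ofTerms [ (-9313920, [4]), (-9779616,
      [2, 1]), (-310464, [1, 0, 1]), (183456, [1, 0, 0, 0, 0, 1]), (-4346496, [0, 2]), (-77616,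
      [0, 0, 0, 1])], ofTerms [ (-4572288, [5]), (-3048192, [3, 1]), (762048, [2, 0, 1]),
      (-9779616, [1, 2]), (-254016, [1, 0, 0, 1]), (-1778112, [0, 1, 1]), (-21168, [0, 0, 0, 0,
      1])], ofTerms [ (-103420800, [6]), (1417409280, [4, 1]), (378483840, [3, 0, 1]), (-7112448,
      [3, 0, 0, 0, 0, 1]), (804595680, [2, 2]), (21591360, [2, 0, 0, 1]), (53343360, [1, 1, 1]),
      (-49787136, [1, 1, 0, 0, 0, 1]), (-1058400, [1, 0, 0, 0, 1]), (248935680, [0, 3]),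
      (13335840, [0, 1, 0, 1]), (-7408800, [0, 0, 2]), (-4148928, [0, 0, 1, 0, 0, 1]), (211680,
      [0, 0, 0, 0, 0, 2])]],
    [const 0, const (-588), ofTerms [(19992, [1])], ofTerms [(296352, [2]), (172872, [0, 1])],
      ofTerms [ (-3259872, [3]), (-8692992, [1, 1]), (-543312, [0, 0, 1]), (49392, [0, 0, 0, 0,
      0, 1])], ofTerms [ (-762048, [4]), (-9779616, [2, 1]), (-1778112, [1, 0, 1]), (-3111696,
      [0, 2]), (-148176, [0, 0, 0, 1])], ofTerms [ (285005952, [5]), (568995840, [3, 1]),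
      (35562240, [2, 0, 1]), (-24893568, [2, 0, 0, 0, 0, 1]), (777924000, [1, 2]), (14817600, [1,
      0, 0, 1]), (103723200, [0, 1, 1]), (-14521248, [0, 1, 0, 0, 0, 1]), (740880, [0, 0, 0, 0,
      1])]],
    [const 0, const 0, const 1176, ofTerms [(49392, [1])], ofTerms [(-155232, [2]), (-543312, [0,
      1])], ofTerms [(254016, [3]), (-1778112, [1, 1]), (-296352, [0, 0, 1])], ofTerms [
      (93985920, [4]), (35562240, [2, 1]), (-11854080, [1, 0, 1]), (-4148928, [1, 0, 0, 0, 0,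
      1]), (51861600, [0, 2]), (1481760, [0, 0, 0, 1])]],
    [const 0, const 0, const 0, const 3528, ofTerms [(-77616, [1])], ofTerms [(-127008, [2]),
      (-148176, [0, 1])], ofTerms [ (7620480, [3]), (14817600, [1, 1]), (1481760, [0, 0, 1]),
      (-296352, [0, 0, 0, 0, 0, 1])]],
    [const 0, const 0, const 0, const 0, const (-3528), ofTerms [(-21168, [1])], ofTerms
      [(-423360, [2]), (740880, [0, 1])]],
    [const 0, const 0, const 0, const 0, const 0, const (-21168), ofTerms [(211680, [1])]],
    [const 0, const 0, const 0, const 0, const 0, const 0, const 148176]]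

/-- A multiple of the matrix `T`. -/
def matrixT : HMat :=
  eulerMatrix 7 27467440 41201160 potential branch [1, 2, 3, 4, 5, 6, 7, 3]

/-- The rescaled coordinates as polynomials in the parameters. -/
def inverse : List HPoly := [
    ofTerms [(-42, [1])],
    ofTerms [(-3276, [2]), (-2352, [0, 1])],
    ofTerms [
      (-1859256, [3]), (-1679328, [1, 1]), (1382976, [0, 0, 1]), (-460992, [0, 0, 0, 0, 0, 0, 1])],
    ofTerms [
      (-889426440, [4]), (-1016487360, [2, 1]), (813189888, [1, 0, 1]),
      (-271063296, [1, 0, 0, 0, 0, 0, 1]), (-135531648, [0, 2]), (542126592, [0, 0, 0, 1])],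
    ofTerms [
      (-1215459574560, [5]), (-1693177516800, [3, 1]), (1341763315200, [2, 0, 1]),
      (-447254438400, [2, 0, 0, 0, 0, 0, 1]), (-447254438400, [1, 2]),
      (500924971008, [1, 0, 0, 1]), (500924971008, [0, 1, 1]),
      (45538633728, [0, 1, 0, 0, 0, 0, 1]), (-637540872192, [0, 0, 0, 0, 1])],
    ofTerms [(-6453888, [0, 0, 0, 0, 0, 0, 1])],
    ofTerms [
      (-37292107593089664, [7]), (-70963622215976448, [5, 1]), (55814084888970240, [4, 0, 1]),
      (-18604694962990080, [4, 0, 0, 0, 0, 0, 1]), (-37209389925980160, [3, 2]),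
      (17079719966023680, [3, 0, 0, 1]), (51239159898071040, [2, 1, 1]),
      (-11992143805931520, [2, 1, 0, 0, 0, 0, 1]), (-15262728480276480, [2, 0, 0, 0, 1]),
      (-3997381268643840, [1, 3]), (10175152320184320, [1, 1, 0, 1]),
      (-15262728480276480, [1, 0, 2]), (10175152320184320, [1, 0, 1, 0, 0, 0, 1]),
      (803301498961920, [1, 0, 0, 0, 0, 0, 2]), (5087576160092160, [0, 2, 1]),
      (803301498961920, [0, 2, 0, 0, 0, 0, 1]), (-7497480656977920, [0, 1, 0, 0, 1]),
      (-7497480656977920, [0, 0, 1, 1]), (-4498488394186752, [0, 0, 0, 1, 0, 0, 1]),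
      (20992945839538176, [0, 0, 0, 0, 0, 1])]]

/-- The weights of the parameters. -/
def weight : List ℕ := [1, 2, 3, 4, 5, 7, 3]

/-- The weights of the coordinates. -/
def coordWeight : List ℕ := [1, 2, 3, 4, 5, 3, 7]

/-- The rows of `transition` are again the classes of `(∂f/∂x_i) / x`, now in the monomials `x³,
x²u, x², xu, x, u, 1`. Here `x u ^ 2` reduces to `-(2 s u + t4 + t2 x + x ^ 2) / 3`, and `t7` also
has a term in `z ^ 2`, whose derivative absorbs the factor `1 / z` by itself. The constants amount
to `f / x = 148176 T`, with `148176` the coefficient of `x7` in `t7`. -/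
lemma eq_transition :
    ((transition.mul (valueMatrix.subst (listSubst parameter))).smul (const 715)).eq
      (((matrixT.subst (listSubst coordinate)).mul transition).smul (const 2333772)) =
      true := by
  decide +kernel

lemma isTriangular_transition :
    transition.isTriangular 7 [-28, -588, 1176, 3528, -3528, -21168, 148176] = true := by
  decide +kernel

lemma isInverse_parameter : isInverseCert 7 parameter inverse 1176 weight = true := by
  decide +kernel

lemma isInverse_inverse : isInverseCert 7 inverse parameter 1176 coordWeight = true := by
  decide +kernel

lemma isHomogeneousMap_parameter :
    isHomogeneousMap 7 coordWeight weight parameter = true := by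
  decide +kernel

/-- The exponents are the weights of the monomials, with `x` of weight `2` and `u` of weight `1`; `f
/ x` has weight `7`. -/
lemma isHomogeneous_valueMatrix :
    valueMatrix.isHomogeneous 7 weight [6, 5, 4, 3, 2, 1, 0] 7 = true := by
  decide +kernel

lemma isFree_nilpotent : nilpotent.isFree 5 = true := by
  decide +kernel

lemma X_mul_Y : (X.mul Y).eq (Y.mul X) = true := by
  decide +kernel

lemma X_mul_V : (X.mul V).eq (V.mul X) = true := by
  decide +kernel

lemma Y_mul_V : (Y.mul V).eq (V.mul Y) = true := by
  decide +kernel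

/-- The potential of type `E7(1)`. -/
def potentialData : PotentialData 7 5 weightE7 (fun x => vE7 (x 0) (x 1) (x 2) (x 3) (x 4))
    (fun x z => potentialE7 (x 0) (x 1) (x 2) (x 3) (x 4) (x 5) (x 6) z) where
  Q := potential
  r := branch
  W := [1, 2, 3, 4, 5, 6, 7, 3]
  L := 144204060
  b := 1
  β := 27467440
  γ := 41201160
  h := 7
  W' := 3
  L_ne := by norm_num
  b_ne := by norm_num
  h_ne := by norm_num
  two_b_mul_γ := by norm_num
  eval_Q x z := by
    simp only [potentialE7, potentialE7Part0, potentialE7Part1, potentialE7Part2, potentialE7Part3,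
      potentialE7Part4, potentialE7Part5, potentialE7Part6, potential, eval_ofTerms_cons,
      eval_ofTerms_nil,
      eval_monomial_cons, eval_monomial_nil, Nat.reduceAdd]
    simp [slots]
    ring
  eval_r x z := by
    simp only [vE7, branch, eval_ofTerms_cons, eval_ofTerms_nil,
      eval_monomial_cons, eval_monomial_nil, Nat.reduceAdd]
    simp [slots]
    ring
  v_update x y := rfl
  weight k := by fin_cases k <;> norm_num [weightE7]
  weight_z := rfl
  weight_r := by decide +kernel
  deriv_r := by decide +kernel
  deriv_z_Q := by decide +kernel
  deriv_z_r := by decide +kernel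
  deriv_z_deriv_Q := by decide +kernel
  deriv_z_deriv_r := by decide +kernel

/-- An eigenvector of the matrices in terms of two further variables, which stand for `x` and
`y / x`. -/
def eigenvector : List HPoly :=
    [ofTerms [(1, [0, 0, 0, 0, 0, 0, 0, 3])], ofTerms [(1, [0, 0, 0, 0, 0, 0, 0, 2, 1])], ofTerms
      [(1, [0, 0, 0, 0, 0, 0, 0, 2])], ofTerms [(1, [0, 0, 0, 0, 0, 0, 0, 1, 1])], ofTerms [(1,
      [0, 0, 0, 0, 0, 0, 0, 1])], ofTerms [(1, [0, 0, 0, 0, 0, 0, 0, 0, 1])], const 1]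

/-- The derivative of `f` with respect to `y`, divided by `x`. -/
def relation₁ : HPoly :=
  ofTerms [
    (1, [0, 1, 0, 0, 0, 0, 0, 1]), (1, [0, 0, 0, 1]), (2, [0, 0, 0, 0, 0, 0, 1, 0, 1]),
    (1, [0, 0, 0, 0, 0, 0, 0, 2]), (3, [0, 0, 0, 0, 0, 0, 0, 1, 2])]

/-- A combination of the derivatives of `f`, divided by `x ^ 2`. -/
def relation₂ : HPoly :=
  ofTerms [
    (-9, [1, 0, 0, 0, 0, 0, 0, 2]), (-4, [0, 1, 0, 0, 0, 0, 0, 1, 1]),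
    (-6, [0, 0, 1, 0, 0, 0, 0, 1]), (-1, [0, 0, 0, 1, 0, 0, 0, 0, 1]), (-3, [0, 0, 0, 0, 1]),
    (1, [0, 0, 0, 0, 0, 0, 1, 0, 2]), (-7, [0, 0, 0, 0, 0, 0, 0, 2, 1])]

lemma isEigenvector_X : isEigenvectorCert X eigenvector
    (ofTerms [(147, [0, 0, 0, 0, 0, 0, 0, 1])]) relation₁ relation₂
    [ofTerms [ (-27, [1, 0, 0, 0, 0, 0, 1]), (-84, [0, 1, 0, 0, 0, 0, 0, 1]), (-21, [0, 0, 0,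
      1]), (21, [0, 0, 0, 0, 0, 0, 1, 0, 1]), (-147, [0, 0, 0, 0, 0, 0, 0, 2])], ofTerms [(-7,
      [0, 0, 0, 0, 0, 0, 1])], const 0, const 0, const 0, const 0, const 0]
    [ofTerms [ (81, [1, 0, 0, 0, 0, 0, 0, 1]), (-42, [0, 0, 0, 0, 0, 0, 1]), (-63, [0, 0, 0, 0,
      0, 0, 0, 1, 1])], ofTerms [(21, [0, 0, 0, 0, 0, 0, 0, 1])], const 0, const 0, const 0,
      const 0, const 0] = true := by
  decide +kernel

/-- The rows of `x³`, `x²u`, `x²`, `x u` and `u` need the relations; multiplying `x` and `1` by `y`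
stays in the list of monomials. -/
lemma isEigenvector_Y : isEigenvectorCert Y eigenvector
    (ofTerms [(1029, [0, 0, 0, 0, 0, 0, 0, 1, 1])]) relation₁ relation₂
    [ofTerms [ (243, [2, 0, 0, 0, 0, 0, 1]), (756, [1, 1, 0, 0, 0, 0, 0, 1]), (189, [1, 0, 0,
      1]), (-189, [1, 0, 0, 0, 0, 0, 1, 0, 1]), (2079, [1, 0, 0, 0, 0, 0, 0, 2]), (28, [0, 1, 0,
      0, 0, 0, 1]), (336, [0, 1, 0, 0, 0, 0, 0, 1, 1]), (504, [0, 0, 1, 0, 0, 0, 0, 1]), (84, [0,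
      0, 0, 1, 0, 0, 0, 0, 1]), (252, [0, 0, 0, 0, 1]), (-49, [0, 0, 0, 0, 0, 0, 1, 1]), (-84,
      [0, 0, 0, 0, 0, 0, 1, 0, 2]), (588, [0, 0, 0, 0, 0, 0, 0, 2, 1])], ofTerms [ (63, [1, 0, 0,
      0, 0, 0, 1]), (196, [0, 1, 0, 0, 0, 0, 0, 1]), (49, [0, 0, 0, 1]), (-49, [0, 0, 0, 0, 0, 0,
      1, 0, 1])], ofTerms [(-49, [0, 0, 0, 0, 0, 0, 1])], ofTerms [(-343, [0, 0, 0, 0, 0, 0, 0,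
      1])], const 0, const (-343), const 0]
    [ofTerms [ (-729, [2, 0, 0, 0, 0, 0, 0, 1]), (378, [1, 0, 0, 0, 0, 0, 1]), (567, [1, 0, 0, 0,
      0, 0, 0, 1, 1]), (84, [0, 0, 0, 1]), (168, [0, 0, 0, 0, 0, 0, 1, 0, 1]), (231, [0, 0, 0, 0,
      0, 0, 0, 2]), (252, [0, 0, 0, 0, 0, 0, 0, 1, 2])], ofTerms [ (-189, [1, 0, 0, 0, 0, 0, 0,
      1]), (98, [0, 0, 0, 0, 0, 0, 1]), (147, [0, 0, 0, 0, 0, 0, 0, 1, 1])], ofTerms [(147, [0,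
      0, 0, 0, 0, 0, 0, 1])], const 0, const 0, const 0, const 0] = true := by
  decide +kernel

lemma isEigenvector_V : isEigenvectorCert V eigenvector
    (ofTerms [(21, [0, 0, 0, 0, 0, 0, 1, 0, 1])]) relation₁ relation₂
    [ofTerms [(-1, [0, 0, 0, 0, 0, 0, 2])], ofTerms [(-7, [0, 0, 0, 0, 0, 0, 1, 1])], const 0,
      ofTerms [(-7, [0, 0, 0, 0, 0, 0, 1])], const 0, const 0, const 0]
    [ofTerms [(3, [0, 0, 0, 0, 0, 0, 1, 1])], const 0, const 0, const 0, const 0, const (-21),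
      const 0] = true := by
  decide +kernel

/-- For `y = x u` and `w = s u` the right side is `3176523 (7 f / x - (7 x u / 3 + s) R₁ + (2 x / 3)
R₂)`, which has no monomials that `X`, `Y`, `V` would not express. -/
lemma valueMatrix_mulVec_eigenvalue (p : Fin 7 → ℂ) (x y w : ℂ) :
    (smul 22235661 (var 5)).eval (slots p 0) 0 + ((HMat.hornerVal (slots p 0) (147 * x)
      [const 0, smul 108045 (var 4), smul 441 (var 2), smul 1 (var 0)] +
      1029 * y * HMat.hornerVal (slots p 0) (147 * x)
      [smul 12348 (var 3), smul 42 (var 1)]) +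
      slots p 0 6 * ((-302526 : ℤ) * (21 * w) + HMat.hornerVal (slots p 0) (147 * x)
      [smul (-3176523) (var 3), smul (-21609) (var 1), const (-147)])) =
      3176523 * (7 * p 5 + 5 * p 4 * x + 3 * p 2 * x ^ 2 + p 0 * x ^ 3 + 4 * p 3 * y + 2 * p 1 * x * y - 2
        * p 6 * w - p 6 * p 3 - p 6 * p 1 * x - p 6 * x ^ 2) := by
  simp [HMat.hornerVal, slots]
  ring

lemma exists_isSingularPoint_surface_iff {p : Fin 7 → ℂ} (hp : p 5 ≠ 0) :
    (∃ a, IsSingularPoint (surfaceE7 p) a) ↔ ∃ x u : ℂ, x ≠ 0 ∧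
      3 * x * u ^ 2 + 2 * p 6 * u + (p 3 + p 1 * x + 1 * x ^ 2) = 0 ∧
      p 6 * u ^ 2 - 3 * (p 4 + 2 * p 2 * x + 3 * p 0 * x ^ 2 + 4 * 0 * x ^ 3) -
        u * (p 3 + 4 * p 1 * x + 7 * 1 * x ^ 2) = 0 ∧
      x ^ 2 * u ^ 3 + (p 5 + p 4 * x + p 2 * x ^ 2 + p 0 * x ^ 3 + 0 * x ^ 4) +
        u * (p 3 * x + p 1 * x ^ 2 + 1 * x ^ 3) + p 6 * x * u ^ 2 = 0 :=
  exists_isSingularPoint_iff hp fun a => by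
    rw [surfaceE7, fE7]
    ring

lemma det_eq_zero_of_isSingularPoint {p : Fin 7 → ℂ} (hp : p 5 ≠ 0)
    (h : ∃ a, IsSingularPoint (surfaceE7 p) a) :
    (HMat.toMatrix 7 (slots p 0) valueMatrix).det = 0 := by
  obtain ⟨x, u, hx, h1, h2, h3⟩ := (exists_isSingularPoint_surface_iff hp).1 h
  have hR : relation₁.eval
      (Function.update (Function.update (slots p 0) 7 x) (7 + 1) u) 0 = 0 := by
    simp [relation₁, slots]
    linear_combination h1
  have hR' : relation₂.eval
      (Function.update (Function.update (slots p 0) 7 x) (7 + 1) u) 0 = 0 := by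
    simp [relation₂, slots]
    linear_combination h2
  have hX := mulVec_update_of_isEigenvectorCert (by norm_num) (by decide +kernel)
    isEigenvector_X (by decide +kernel) (by decide +kernel) hR hR'
  have hY := mulVec_update_of_isEigenvectorCert (by norm_num) (by decide +kernel)
    isEigenvector_Y (by decide +kernel) (by decide +kernel) hR hR'
  have hV := mulVec_update_of_isEigenvectorCert (by norm_num) (by decide +kernel)
    isEigenvector_V (by decide +kernel) (by decide +kernel) hR hR'
  rw [← Matrix.exists_mulVec_eq_zero_iff]
  refine ⟨fun i : Fin 7 => (eigenvector.getD i (const 0)).eval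
    (Function.update (Function.update (slots p 0) 7 x) (7 + 1) u) 0, fun h0 => ?_, ?_⟩
  rotate_left
  · rw [valueMatrix, nilpotent, HMat.scalar_add_nilpotentPart_mulVec _ _ _ _ _ _
      (by decide +kernel) hX hY hV]
    refine smul_eq_zero_of_left ?_ _
    have hx : (ofTerms [(147, [0, 0, 0, 0, 0, 0, 0, 1])]).eval
        (Function.update (Function.update (slots p 0) 7 x) (7 + 1) u) 0 = 147 * x := by
      simp
      ring
    have hy : (ofTerms [(1029, [0, 0, 0, 0, 0, 0, 0, 1, 1])]).eval
        (Function.update (Function.update (slots p 0) 7 x) (7 + 1) u) 0 = 1029 * (x * u) := by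
      simp
      ring
    have hw : (ofTerms [(21, [0, 0, 0, 0, 0, 0, 1, 0, 1])]).eval
        (Function.update (Function.update (slots p 0) 7 x) (7 + 1) u) 0 =
          21 * (p 6 * u) := by
      simp [slots]
      ring
    rw [hx, hy, hw, valueMatrix_mulVec_eigenvalue]
    linear_combination
      22235661 * h3 - 3176523 * (7/3 * u * x + p 6) * h1 - 3176523 * (-2/3 * x) * h2
  -- The last entry is the monomial `1`, so the null vector is not zero.
  · have := congrFun h0 6
    simp [eigenvector] at this

/-- The last two entries of the common eigenvector again stand for `u` and `1`, and determine it
once `x ≠ 0`. -/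
lemma isSingularPoint_of_det_eq_zero {p : Fin 7 → ℂ} (hp : p 5 ≠ 0)
    (h : (HMat.toMatrix 7 (slots p 0) valueMatrix).det = 0) :
    ∃ a, IsSingularPoint (surfaceE7 p) a := by
  rw [exists_isSingularPoint_surface_iff hp]
  obtain ⟨v, x, y, w, hv, hX, hY, hV, hg⟩ := HMat.exists_eigenvector_of_det_eq_zero _ _ _ _ _ _
    (by decide +kernel) (by decide +kernel) (by decide +kernel) X_mul_Y X_mul_V Y_mul_V h
  obtain ⟨x, rfl⟩ : ∃ x', x = 147 * x' := ⟨x / 147, by ring⟩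
  obtain ⟨y, rfl⟩ : ∃ y', y = 1029 * y' := ⟨y / 1029, by ring⟩
  obtain ⟨w, rfl⟩ : ∃ w', w = 21 * w' := ⟨w / 21, by ring⟩
  rw [valueMatrix_mulVec_eigenvalue] at hg
  have h2 : v 0 = x * v 2 := by
    have := congrFun hX 2
    simp [Matrix.mulVec, dotProduct, Fin.sum_univ_seven, HMat.toMatrix_apply, HMat.entry, X] at this
    linear_combination this / 147
  have h3 : v 1 = x * v 3 := by
    have := congrFun hX 3
    simp [Matrix.mulVec, dotProduct, Fin.sum_univ_seven, HMat.toMatrix_apply, HMat.entry, X] at this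
    linear_combination this / 147
  have h4 : v 2 = x * v 4 := by
    have := congrFun hX 4
    simp [Matrix.mulVec, dotProduct, Fin.sum_univ_seven, HMat.toMatrix_apply, HMat.entry, X] at this
    linear_combination this / 147
  have h5 : v 3 = x * v 5 := by
    have := congrFun hX 5
    simp [Matrix.mulVec, dotProduct, Fin.sum_univ_seven, HMat.toMatrix_apply, HMat.entry, X] at this
    linear_combination this / 147
  have h6 : v 4 = x * v 6 := by
    have := congrFun hX 6
    simp [Matrix.mulVec, dotProduct, Fin.sum_univ_seven, HMat.toMatrix_apply, HMat.entry, X] at this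
    linear_combination this / 147
  have hy : v 3 = y * v 6 := by
    have := congrFun hY 6
    simp [Matrix.mulVec, dotProduct, Fin.sum_univ_seven, HMat.toMatrix_apply, HMat.entry, Y] at this
    linear_combination this / 1029
  have hw : p 6 * v 5 = w * v 6 := by
    have := congrFun hV 6
    simp [Matrix.mulVec, dotProduct, Fin.sum_univ_seven, HMat.toMatrix_apply, HMat.entry, slots,
      V] at this
    linear_combination this / 21
  -- The term `-v 2` comes from `x³y` in `f`, which adds `x ^ 2` to `relation₁`.
  have hyu : -v 2 - p 1 * v 4 - 2 * p 6 * v 5 - p 3 * v 6 = 3 * y * v 5 := by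
    have := congrFun hY 5
    simp [Matrix.mulVec, dotProduct, Fin.sum_univ_seven, HMat.toMatrix_apply, HMat.entry, slots,
      Y] at this
    linear_combination this / 343
  have hwu : 7 * v 1 + 9 * p 0 * v 2 + 4 * p 1 * v 3 + 6 * p 2 * v 4 + p 3 * v 5 + 3 * p 4 * v 6 =
      w * v 5 := by
    have := congrFun hV 5
    simp [Matrix.mulVec, dotProduct, Fin.sum_univ_seven, HMat.toMatrix_apply, HMat.entry, slots,
      V] at this
    linear_combination this / 21
  -- For `x = 0` the vanishing of `f / x` forces `t7 = 0`.
  by_cases hx : x = 0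
  · exfalso
    have z4 : v 4 = 0 := by rw [h6, hx, zero_mul]
    have z3 : v 3 = 0 := by rw [h5, hx, zero_mul]
    have z2 : v 2 = 0 := by rw [h4, hx, zero_mul]
    have z1 : v 1 = 0 := by rw [h3, hx, zero_mul]
    have z0 : v 0 = 0 := by rw [h2, hx, zero_mul]
    simp only [z4, z3, z2, z1, mul_zero, add_zero, zero_add, sub_zero] at hyu hwu hy
    by_cases hl : v 6 = 0
    · have hu : v 5 ≠ 0 := by
        intro hu
        refine hv (funext fun i => ?_)
        fin_cases i <;> simp [z4, z3, z2, z1, z0, hl, hu]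
      have hs : p 6 = 0 := by
        rw [hl, mul_zero] at hw
        exact (mul_eq_zero.1 hw).resolve_right hu
      have hy0 : y = 0 := by
        rw [hs, hl] at hyu
        refine (mul_eq_zero.1 (?_ : y * v 5 = 0)).resolve_right hu
        linear_combination -hyu / 3
      rw [hx, hy0, hs] at hg
      exact hp (by linear_combination hg / 22235661)
    · have hy0 : y = 0 := (mul_eq_zero.1 hy.symm).resolve_right hl
      have hW : 2 * w + p 3 = 0 := by
        refine (mul_eq_zero.1 (?_ : (2 * w + p 3) * v 6 = 0)).resolve_right hl
        rw [hy0] at hyu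
        linear_combination -hyu - 2 * hw
      rw [hx, hy0] at hg
      exact hp (by linear_combination hg / 22235661 + 1/7 * p 6 * hW)
  · have hl : v 6 ≠ 0 := by
      intro hl
      have hu : v 5 = 0 := by
        rw [h5, hl, mul_zero] at hy
        exact (mul_eq_zero.1 hy).resolve_left hx
      refine hv (funext fun i => ?_)
      fin_cases i <;> simp [h2, h3, h4, h5, h6, hl, hu]
    -- Normalizing by the last entry turns the remaining rows of `Y` and `V` into the two relations
    -- at `(x, u)`.
    obtain ⟨u, hu⟩ : ∃ u, v 5 = u * v 6 := ⟨v 5 / v 6, by field_simp⟩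
    have hyx : y = x * u := by
      refine mul_right_cancel₀ hl ?_
      rw [← hy, h5, hu]
      ring
    have hws : w = p 6 * u := by
      refine mul_right_cancel₀ hl ?_
      rw [← hw, hu]
      ring
    have e4 : v 4 = x * v 6 := by rw [h6]
    have e3 : v 3 = u * x * v 6 := by rw [h5, hu]; ring
    have e2 : v 2 = x ^ 2 * v 6 := by rw [h4, e4]; ring
    have e1 : v 1 = u * x ^ 2 * v 6 := by rw [h3, e3]; ring
    have e0 : v 0 = x ^ 3 * v 6 := by rw [h2, e2]; ring
    simp only [e1, e2, e3, e4, hu] at hyu hwu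
    subst hyx hws
    have h1 : 3 * x * u ^ 2 + 2 * p 6 * u + (p 3 + p 1 * x + 1 * x ^ 2) = 0 := by
      refine (mul_eq_zero.1 (?_ : _ * v 6 = 0)).resolve_right hl
      linear_combination -hyu
    have h2 : p 6 * u ^ 2 - 3 * (p 4 + 2 * p 2 * x + 3 * p 0 * x ^ 2 +
        4 * 0 * x ^ 3) - u * (p 3 + 4 * p 1 * x + 7 * 1 * x ^ 2) = 0 := by
      refine (mul_eq_zero.1 (?_ : _ * v 6 = 0)).resolve_right hl
      linear_combination -hwu
    refine ⟨x, u, hx, h1, h2, ?_⟩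
    linear_combination
      hg / 22235661 + (1/3 * u * x + 1/7 * p 6) * h1 + (-2/21 * x) * h2

/-- The discriminant of the family of type `E7(1)`. -/
def discriminant : MvPolynomial (Fin 7) ℂ :=
  MvPolynomial.X 5 *
    (HMat.toMatrix 7 (slots (MvPolynomial.X : Fin 7 → MvPolynomial (Fin 7) ℂ) 0)
      valueMatrix).det

lemma eval_discriminant (p : Fin 7 → ℂ) : MvPolynomial.eval p discriminant =
    p 5 * (HMat.toMatrix 7 (slots p 0) valueMatrix).det := by
  rw [discriminant, map_mul, MvPolynomial.eval_X, RingHom.map_det, RingHom.mapMatrix_apply,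
    HMat.map_toMatrix]
  simp only [map_slots, MvPolynomial.eval_X, map_zero]

/-- The specialization is `t5 = -1`, `s3 = 1`, with `t1`, `t2`, `t3` and `t4` zero. -/
lemma squarefree_discriminant : Squarefree discriminant :=
  HMat.squarefree_X_mul_det 5 (by norm_num) isFree_nilpotent
    (p := [0, 0, 0, 0, -1, 0, 1]) (by norm_num)
    (K := [
      [const (-32976400283097772836846242276671156327157007177003175398120960), const
      2119441725013704578960063588672541212583401670504847800, const
      (-151994657740811054710583630692242546417674300412), const
      23647740265297694932298951920629861783600, const (-738272713048369088137947370007064),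
      const 43198065558273122170890300, const (-2099140023782236140)],
      [const 61982902454701293078965321972511408503077249422574153199068800, const
      388262969925418992048107812444793824531095160424461500, const
      164072280107989119651023939612680878976236936600, const
      (-2275206303464543363287629201059336460840), const 289887616554418074934818602032500, const
      (-6027330704215640872927896), const 1814006869535050500],
      [const 51055274852287814698583103147653382339733234080417976484262000, const
      (-351377771242734466701193613332557512173017125702687520), const
      396302871232608218097782298972335449473597276600, const
      (-5706161321406787848190661048873475446040), const 751867989386562921420804676409640, const
      (-10924073312657946580005300), const 352737600748477712],
      [const (-86798664368672960622442232233583760052207018718847059986503720), const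
      (-1329992206234351618819235318121823899008065122388342500), const
      (-188550783199120502760927041342365752048994576764), const
      (-1105665412558232939601865501167033726000), const (-1107805511099288106407012884950420),
      const 1862577473927796152270100, const (-2465197130623003300)],
      [const (-63326554535257533376231153011087475840651080848652247180520400), const
      3556470874397008448912022513249911296263517185055932030, const
      (-213056508299650508763007927073710948918609024050), const
      5433041404061796276474835399459595537058, const (-712330066344176596298816491754250), const
      (-16727081826968985377416140), const (-2120919260009500950)],
      [const 132788748911999926091286330953891998431761085081421629709170000, const
      7378022153503441724821227311663739329700755527468705167, const
      334489835132822162858628668198109647559723921825, const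
      (-10729522849451096767091757974212251119625), const 1404891171167160030036638891180805,
      const 47279741223751436733543000, const 5125929349649513519],
      [const 102242812214946184165556345696532836810062079217701591315954172, const 0, const 0,
      const 0, const 0, const 0, const 0]])
    (d := 102242812214946184165556345696532836810062079217701591315954172)
    (q := 
      [72942462113418378268646832261024712960722713935344,
      26417182139982786173327406988516106302860000, 498448360353657934388346431528702133,
      89829441469240357696131828375, -1355304408021589172175, 324331019020575, 0, 1])
    (a := 
      [3097076280849545959285474842750190753326975102933021796371884239996356176513267874,
      -21416002842176415920892698543879741756456162575800748198363548782206108486875,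
      762286727574164573838265944660941489620700849419648437079772644594380,
      -92747704471497760155493750345842985238651426118293700605101125,
      661898846475030157019232386619014653754861401638745800,
      -356069112490467286115140819898726439698326502825])
    (b := 

      [1284797366946868371248591030290115748611998236567248436647683593605818101118653717150015000,
      7552269003702812567652462848677212659512814986017242668325832747087372839205140643,
      5861220239400223246611352921409080964811231013938633002140085467124314940625,
      -147206160426667909323389295077442740264165882860194563922741774459465,
      17963315254939884294922761798715056885481492863949373411774625,
      -94556978067861451002747483802716379107837343091249400,
      50867016070066755159305831414103777099760928975])
    (N := 34166634424883955889695823184704157299187116910790442500130184326301226553057024948946768813745500936661877543022698069613191088338656)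
    (by decide +kernel) (by decide +kernel)

lemma isFamilyDiscriminant : IsFamilyDiscriminant surfaceE7 discriminant := by
  refine ⟨squarefree_discriminant, fun p => ?_⟩
  rw [eval_discriminant]
  by_cases hp : p 5 = 0
  · simp only [hp, zero_mul, true_iff]
    refine ⟨0, (isSingularPoint_iff (p 5) (p 4) (p 2) (p 0) (0)
      (p 3) (p 1) (1) (p 6) _ (fun a => by rw [surfaceE7, fE7]; ring) 0).2 ?_⟩
    simp [hp]
  · rw [mul_eq_zero_iff_left hp]
    exact ⟨isSingularPoint_of_det_eq_zero hp, det_eq_zero_of_isSingularPoint hp⟩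

/-- The factors relating the coordinates and the rescaled coordinates. -/
def scale (c : ℂ) (i : Fin 7) : ℂ :=
  ([1, 1, 1, 1, 1, 1, 1] : List ℂ).getD i 0 *
    ((1 / 14) * c ^ 2) ^ coordWeight.getD i 0

/-- Here `μ = c ^ 2 / 14`, so the exponent of `c` is twice the weight modulo `7`. The weights up to
three need no reduction; this covers `x1`, `x2`, `x3` and `z`. -/
lemma coord_eq {c : ℂ} (hc : c ^ 7 = 1 / 14112) (p : Fin 7 → ℂ) :
    coordE7 c p = fun i => scale c i * polyMap 7 inverse p i := by
  funext i
  fin_cases i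
  · simp [coordE7, transformE7, scale, polyMap, listSubst, inverse, coordWeight, slots]
    ring
  · simp [coordE7, transformE7, scale, polyMap, listSubst, inverse, coordWeight, slots]
    ring
  · simp [coordE7, transformE7, scale, polyMap, listSubst, inverse, coordWeight, slots]
    ring
  · have hk : (c ^ 2) ^ 4 = (1 / 14112) ^ 1 * c ^ 1 := by
      rw [show (c ^ 2) ^ 4 = (c ^ 7) ^ 1 * c ^ 1 by ring, hc]
    simp [coordE7, transformE7, scale, polyMap, listSubst, inverse, coordWeight, slots,
      mul_pow, hk]
    ring
  · have hk : (c ^ 2) ^ 5 = (1 / 14112) ^ 1 * c ^ 3 := by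
      rw [show (c ^ 2) ^ 5 = (c ^ 7) ^ 1 * c ^ 3 by ring, hc]
    simp [coordE7, transformE7, scale, polyMap, listSubst, inverse, coordWeight, slots,
      mul_pow, hk]
    ring
  · simp [coordE7, transformE7, scale, polyMap, listSubst, inverse, coordWeight, slots]
    ring
  · have hk : (c ^ 2) ^ 7 = (1 / 14112) ^ 2 * c ^ 0 := by
      rw [show (c ^ 2) ^ 7 = (c ^ 7) ^ 2 * c ^ 0 by ring, hc]
    simp [coordE7, transformE7, scale, polyMap, listSubst, inverse, coordWeight, slots,
      mul_pow, hk]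
    ring

lemma ne_zero {c : ℂ} (hc : c ^ 7 = 1 / 14112) : c ≠ 0 := by
  rintro rfl
  norm_num at hc

lemma bijective_coord {c : ℂ} (hc : c ^ 7 = 1 / 14112) : Function.Bijective (coordE7 c) := by
  have h0 := ne_zero hc
  rw [show coordE7 c = fun p i => scale c i * polyMap 7 inverse p i from
    funext fun p => coord_eq hc p]
  refine bijective_polyMap (l := 1176) (by norm_num) (by decide +kernel) (by decide +kernel)
    isInverse_inverse isInverse_parameter fun i => ?_
  refine mul_ne_zero ?_ (pow_ne_zero _ (mul_ne_zero (by norm_num) (pow_ne_zero _ h0)))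
  fin_cases i <;> simp

/-- The coordinates `x` and the function `z` at the image of the parameters. -/
lemma slots_coord {c : ℂ} (hc : c ^ 7 = 1 / 14112) (p : Fin 7 → ℂ) :
    slots (Function.update (coordE7 c p) 5 (coordE7 c p 5 ^ 2 +
      vE7 (coordE7 c p 0) (coordE7 c p 1) (coordE7 c p 2)
        (coordE7 c p 3) (coordE7 c p 4)))
      (coordE7 c p 5) = fun i => (listSubst coordinate i).eval (slots (fun i : Fin 7 =>
        ((1 / 14) * c ^ 2) ^ coordWeight.getD i 0 *
          polyMap 7 inverse p i) 0) 0 := by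
  simp only [coord_eq hc, scale]
  generalize (1 / 14) * c ^ 2 = μ
  generalize polyMap 7 inverse p = a
  funext i
  rcases lt_or_ge i 8 with hi | hi
  · interval_cases i <;>
      simp [slots, coordinate, listSubst, coordWeight, vE7] <;> ring
  · simp [slots, coordinate, listSubst, show ¬ i < 7 by omega, show i ≠ 7 by omega, hi]

lemma exists_eval_discriminant {c : ℂ} (hc : c ^ 7 = 1 / 14112) : ∃ k : ℂ, k ≠ 0 ∧
    ∀ p : Fin 7 → ℂ, p 5 * MvPolynomial.eval (coordE7 c p) potentialData.discriminant =
      k * MvPolynomial.eval p discriminant := by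
  have hμ : ((1 / 14) * c ^ 2 : ℂ) ≠ 0 :=
    mul_ne_zero (by norm_num) (pow_ne_zero _ (ne_zero hc))
  -- The scaling contributes `(1176 μ) ^ (7 n)` with `n = 7`; the other factors are the integer
  -- normalizations of the two matrices.
  refine ⟨((144204060 : ℂ)⁻¹ * (7 : ℂ)⁻¹) ^ 7 * (((2333772 : ℤ) : ℂ) ^ 7)⁻¹ *
    (((715 : ℤ) : ℂ) ^ 7 *
      ((1 / 14) * c ^ 2 * (1176 : ℤ)) ^ (7 * 7)), ?_, fun p => ?_⟩
  · refine mul_ne_zero (by norm_num) (mul_ne_zero (by norm_num)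
      (pow_ne_zero _ (mul_ne_zero hμ (by norm_num))))
  · have key := HMat.det_eq_of_coordinates eq_transition (by decide +kernel) (by decide +kernel)
      isTriangular_transition (by decide +kernel) (by decide +kernel) (by decide +kernel)
      isInverse_parameter (by norm_num) isHomogeneousMap_parameter isHomogeneous_valueMatrix hμ p
    rw [← slots_coord hc p] at key
    rw [potentialData.eval_discriminant, eval_discriminant]
    change p 5 * ((((144204060 : ℤ) : ℂ)⁻¹ * ((7 : ℤ) : ℂ)⁻¹) ^ 7 *
      (HMat.toMatrix 7 _ matrixT).det) = _
    have hK : (((2333772 : ℤ) : ℂ) ^ 7) ≠ 0 := by norm_num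
    rw [← eq_inv_mul_iff_mul_eq₀ hK] at key
    rw [key]
    push_cast
    ring

end E7

end

/-! ### Type `E8`. -/

noncomputable section

open HPoly
open scoped Matrix

set_option maxRecDepth 100000

namespace E8

/-- A multiple of the polynomial part of the potential of type `E8(1)`. -/
def potential : HPoly :=
  ofTerms [
    (152789840203, [25]), (237965728000, [22, 1]), (23796572800, [21, 0, 1]),
    (13884360890400, [19, 2]), (95186291200, [19, 0, 0, 1]), (773388616000, [18, 1, 1]),
    (-47593145600, [18, 0, 0, 0, 1]), (1641701061000, [17, 0, 2]), (-58301603360000, [16, 3]),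
    (-1856132678400, [16, 1, 0, 1]), (95186291200, [16, 0, 0, 0, 0, 1]),
    (14813366568000, [15, 2, 1]), (452134883200, [15, 1, 0, 0, 1]), (23796572800, [15, 0, 1, 1]),
    (-47593145600, [15, 0, 0, 0, 0, 0, 1]), (9601917124800, [14, 1, 2]),
    (35694859200, [14, 0, 1, 0, 1]), (354069206691200, [13, 4]), (-5425618598400, [13, 2, 0, 1]),
    (-713897184000, [13, 1, 0, 0, 0, 1]), (1680632954000, [13, 0, 3]),
    (5862194184000, [13, 0, 0, 2]), (-72912699059200, [12, 3, 1]),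
    (6282295219200, [12, 2, 0, 0, 1]), (23487217353600, [12, 1, 1, 1]),
    (356948592000, [12, 1, 0, 0, 0, 0, 1]), (-71389718400, [12, 0, 1, 0, 0, 1]),
    (142779436800, [12, 0, 0, 1, 1]), (42833831040000, [11, 2, 2]),
    (-3069757891200, [11, 1, 1, 0, 1]), (6657091240800, [11, 0, 2, 1]),
    (35694859200, [11, 0, 1, 0, 0, 0, 1]), (161438113200, [11, 0, 0, 0, 2]),
    (-1211683412459520, [10, 5]), (164386724902400, [10, 3, 0, 1]),
    (-13992384806400, [10, 2, 0, 0, 0, 1]), (9417493685600, [10, 1, 3]),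
    (-13564046496000, [10, 1, 0, 2]), (972684913200, [10, 0, 2, 0, 1]),
    (-285558873600, [10, 0, 0, 1, 0, 1]), (513768006752000, [9, 4, 1]),
    (-35361707180800, [9, 3, 0, 0, 1]), (-34124285395200, [9, 2, 1, 1]),
    (6996192403200, [9, 2, 0, 0, 0, 0, 1]), (5996736345600, [9, 1, 1, 0, 0, 1]),
    (14991840864000, [9, 1, 0, 1, 1]), (2318678562200, [9, 0, 4]), (8423986771200, [9, 0, 1, 2]),
    (142779436800, [9, 0, 0, 1, 0, 0, 1]), (142779436800, [9, 0, 0, 0, 1, 1]),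
    (-66535217548800, [8, 3, 2]), (14777671708800, [8, 2, 1, 0, 1]),
    (30626189193600, [8, 1, 2, 1]), (-2998368172800, [8, 1, 1, 0, 0, 0, 1]),
    (-249864014400, [8, 1, 0, 0, 2]), (-499728028800, [8, 0, 2, 0, 0, 1]),
    (2998368172800, [8, 0, 1, 1, 1]), (-71389718400, [8, 0, 0, 0, 1, 0, 1]),
    (3060239262080000, [7, 6]), (-711327154137600, [7, 4, 0, 1]),
    (55588794060800, [7, 3, 0, 0, 0, 1]), (26985313555200, [7, 2, 3]),
    (126217022131200, [7, 2, 0, 2]), (3676570497600, [7, 1, 2, 0, 1]),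
    (-7424530713600, [7, 1, 0, 1, 0, 1]), (7579208436800, [7, 0, 3, 1]),
    (249864014400, [7, 0, 2, 0, 0, 0, 1]), (249864014400, [7, 0, 1, 0, 2]),
    (7757682732800, [7, 0, 0, 3]), (683301590400, [7, 0, 0, 0, 0, 2]),
    (-1601128604275200, [6, 5, 1]), (126550174150400, [6, 4, 0, 0, 1]),
    (328011959475200, [6, 3, 1, 1]), (-27794397030400, [6, 3, 0, 0, 0, 0, 1]),
    (-13706825932800, [6, 2, 1, 0, 0, 1]), (-27413651865600, [6, 2, 0, 1, 1]),
    (5651686040000, [6, 1, 4]), (43833287097600, [6, 1, 1, 2]),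
    (3712265356800, [6, 1, 0, 1, 0, 0, 1]), (1285014931200, [6, 1, 0, 0, 1, 1]),
    (779337759200, [6, 0, 3, 0, 1]), (5568398035200, [6, 0, 1, 1, 0, 1]),
    (-71389718400, [6, 0, 0, 2, 1]), (142779436800, [6, 0, 0, 0, 0, 1, 1]),
    (390787318521600, [5, 4, 2]), (-41977154419200, [5, 3, 1, 0, 1]),
    (2570029862400, [5, 2, 2, 1]), (6853412966400, [5, 2, 1, 0, 0, 0, 1]),
    (3640875638400, [5, 2, 0, 0, 2]), (1285014931200, [5, 1, 2, 0, 0, 1]),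
    (9423442828800, [5, 1, 1, 1, 1]), (747807300240, [5, 0, 5]), (13920995088000, [5, 0, 2, 2]),
    (-856676620800, [5, 0, 1, 1, 0, 0, 1]), (928066339200, [5, 0, 1, 0, 1, 1]),
    (678202324800, [5, 0, 0, 1, 2]), (60681260640, [5, 0, 0, 0, 0, 0, 2]),
    (-2488550397132800, [4, 7]), (1415229777561600, [4, 5, 0, 1]),
    (-134212670592000, [4, 4, 0, 0, 0, 1]), (-38074516480000, [4, 3, 3]),
    (-182757679104000, [4, 3, 0, 2]), (8566766208000, [4, 2, 2, 0, 1]),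
    (34838182579200, [4, 2, 0, 1, 0, 1]), (18561326784000, [4, 1, 3, 1]),
    (464033169600, [4, 1, 1, 0, 2]), (-6091922636800, [4, 1, 0, 3]),
    (2284470988800, [4, 1, 0, 0, 0, 2]), (690100611200, [4, 0, 3, 0, 0, 1]),
    (3640875638400, [4, 0, 2, 1, 1]), (178474296000, [4, 0, 1, 0, 1, 0, 1]),
    (3997824230400, [4, 0, 0, 2, 0, 1]), (-5949143200, [4, 0, 0, 0, 3]),
    (1015828099686400, [3, 6, 1]), (-129072610867200, [3, 5, 0, 0, 1]),
    (-542561859840000, [3, 4, 1, 1]), (62822952192000, [3, 4, 0, 0, 0, 0, 1]),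
    (46260537523200, [3, 3, 1, 0, 0, 1]), (56540656972800, [3, 3, 0, 1, 1]),
    (6603548952000, [3, 2, 4]), (54256185984000, [3, 2, 1, 2]),
    (-12279031564800, [3, 2, 0, 1, 0, 0, 1]), (-4283383104000, [3, 2, 0, 0, 1, 1]),
    (975659484800, [3, 1, 3, 0, 1]), (5140059724800, [3, 1, 1, 1, 0, 1]),
    (9709001702400, [3, 1, 0, 2, 1]), (285558873600, [3, 1, 0, 0, 0, 1, 1]),
    (2278521845600, [3, 0, 4, 1]), (-23796572800, [3, 0, 3, 0, 0, 0, 1]),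
    (285558873600, [3, 0, 2, 0, 2]), (8186021043200, [3, 0, 1, 3]),
    (999456057600, [3, 0, 1, 0, 0, 2]), (1856132678400, [3, 0, 0, 2, 0, 0, 1]),
    (1142235494400, [3, 0, 0, 1, 1, 1]), (-140494965811200, [2, 5, 2]),
    (35409300326400, [2, 4, 1, 0, 1]), (86238779827200, [2, 3, 2, 1]),
    (-19703562278400, [2, 3, 1, 0, 0, 0, 1]), (-2570029862400, [2, 3, 0, 0, 2]),
    (-4283383104000, [2, 2, 2, 0, 0, 1]), (-856676620800, [2, 2, 1, 1, 1]),
    (2141691552000, [2, 2, 0, 0, 1, 0, 1]), (446185740000, [2, 1, 5]),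
    (10280119449600, [2, 1, 2, 2]), (2570029862400, [2, 1, 1, 1, 0, 0, 1]),
    (2570029862400, [2, 1, 1, 0, 1, 1]), (-285558873600, [2, 1, 0, 0, 0, 0, 2]),
    (223092870000, [2, 0, 4, 0, 1]), (2998368172800, [2, 0, 2, 1, 0, 1]),
    (3855044793600, [2, 0, 1, 2, 1]), (285558873600, [2, 0, 1, 0, 0, 1, 1]),
    (-142779436800, [2, 0, 0, 1, 1, 0, 1]), (142779436800, [2, 0, 0, 0, 2, 1]),
    (354093003264000, [1, 8]), (-304596131840000, [1, 6, 0, 1]),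
    (27413651865600, [1, 5, 0, 0, 0, 1]), (7234158131200, [1, 4, 3]),
    (102801194496000, [1, 4, 0, 2]), (-1998912115200, [1, 3, 2, 0, 1]),
    (-22844709888000, [1, 3, 0, 1, 0, 1]), (-1427794368000, [1, 2, 3, 1]),
    (2141691552000, [1, 2, 2, 0, 0, 0, 1]), (428338310400, [1, 2, 1, 0, 2]),
    (5711177472000, [1, 2, 0, 3]), (2855588736000, [1, 2, 0, 0, 0, 2]),
    (713897184000, [1, 1, 3, 0, 0, 1]), (2998368172800, [1, 1, 2, 1, 1]),
    (-428338310400, [1, 1, 1, 0, 1, 0, 1]), (5711177472000, [1, 1, 0, 2, 0, 1]),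
    (47593145600, [1, 1, 0, 0, 3]), (32720287600, [1, 0, 6]), (2284470988800, [1, 0, 3, 2]),
    (214169155200, [1, 0, 2, 1, 0, 0, 1]), (356948592000, [1, 0, 2, 0, 1, 1]),
    (285558873600, [1, 0, 1, 1, 2]), (35694859200, [1, 0, 1, 0, 0, 0, 2]),
    (3331520192000, [1, 0, 0, 4]), (1427794368000, [1, 0, 0, 1, 0, 2]),
    (35694859200, [1, 0, 0, 0, 2, 0, 1]), (142779436800, [1, 0, 0, 0, 0, 0, 0, 2]),
    (-67011149004800, [0, 7, 1]), (15229806592000, [0, 6, 0, 0, 1]),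
    (50258361753600, [0, 5, 1, 1]), (-9594778152960, [0, 5, 0, 0, 0, 0, 1]),
    (-2284470988800, [0, 4, 1, 0, 0, 1]), (-9137883955200, [0, 4, 0, 1, 1]),
    (95186291200, [0, 3, 4]), (-12564590438400, [0, 3, 1, 2]),
    (6853412966400, [0, 3, 0, 1, 0, 0, 1]), (1142235494400, [0, 3, 0, 0, 1, 1]),
    (142779436800, [0, 2, 3, 0, 1]), (3426706483200, [0, 2, 1, 1, 0, 1]),
    (571117747200, [0, 2, 0, 2, 1]), (-1142235494400, [0, 2, 0, 0, 0, 1, 1]),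
    (499728028800, [0, 1, 4, 1]), (-71389718400, [0, 1, 3, 0, 0, 0, 1]),
    (71389718400, [0, 1, 2, 0, 2]), (4188196812800, [0, 1, 1, 3]),
    (285558873600, [0, 1, 1, 0, 0, 2]), (-1142235494400, [0, 1, 0, 2, 0, 0, 1]),
    (571117747200, [0, 1, 0, 1, 1, 1]), (285558873600, [0, 1, 0, 0, 0, 0, 1, 1]),
    (35694859200, [0, 0, 4, 0, 0, 1]), (214169155200, [0, 0, 3, 1, 1]),
    (35694859200, [0, 0, 2, 0, 1, 0, 1]), (1713353241600, [0, 0, 1, 2, 0, 1]),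
    (11898286400, [0, 0, 1, 0, 3]), (285558873600, [0, 0, 1, 0, 0, 1, 0, 1]),
    (190372582400, [0, 0, 0, 3, 1]), (285558873600, [0, 0, 0, 1, 1, 0, 0, 1]),
    (285558873600, [0, 0, 0, 1, 0, 1, 1]), (142779436800, [0, 0, 0, 0, 1, 2])]

/-- A multiple of `x_7 - v`. -/
def branch : HPoly :=
  ofTerms [
    (2, [10]), (-10, [7, 1]), (-1, [6, 0, 1]), (156, [4, 2]), (-4, [4, 0, 0, 1]),
    (-40, [3, 1, 1]), (2, [3, 0, 0, 0, 1]), (3, [2, 0, 2]), (-176, [1, 3]), (48, [1, 1, 0, 1]),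
    (-4, [1, 0, 0, 0, 0, 1]), (24, [0, 2, 1]), (-4, [0, 1, 0, 0, 1]), (-4, [0, 0, 1, 1]),
    (2, [0, 0, 0, 0, 0, 0, 1])]

/-- Multiplication by `1296 x`. -/
def X : HMat :=
  [
    [ofTerms [(-147, [3]), (-972, [0, 1])], ofTerms [(-189, [2, 1]), (396, [1, 0, 1]), (-864, [0,
      0, 0, 0, 0, 0, 0, 1])], ofTerms [(-84, [2, 0, 1]), (-36, [1, 0, 0, 0, 0, 0, 0, 1]), (-648,
      [0, 0, 0, 1])], ofTerms [ (-7, [3, 0, 0, 0, 0, 0, 0, 1]), (-126, [2, 0, 0, 1]), (288, [1,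
      0, 0, 0, 1]), (-648, [0, 1, 0, 0, 0, 0, 0, 1]), (144, [0, 0, 2])], ofTerms [ (-21, [2, 0,
      0, 0, 1]), (-36, [0, 0, 1, 0, 0, 0, 0, 1]), (-324, [0, 0, 0, 0, 0, 1])], ofTerms [ (-7, [2,
      0, 1, 0, 0, 0, 0, 1]), (-63, [2, 0, 0, 0, 0, 1]), (180, [0, 0, 1, 0, 1]), (-432, [0, 0, 0,
      1, 0, 0, 0, 1])], ofTerms [(-14, [2, 0, 0, 0, 0, 0, 0, 2]), (-36, [0, 0, 0, 0, 1, 0, 0,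
      1])], ofTerms [ (-7, [2, 0, 0, 0, 1, 0, 0, 1]), (36, [0, 0, 0, 0, 2]), (-216, [0, 0, 0, 0,
      0, 1, 0, 1])]],
    [ofTerms [(-756, [1])], ofTerms [(-972, [0, 1])], ofTerms [(-432, [0, 0, 1])], ofTerms [(-36,
      [1, 0, 0, 0, 0, 0, 0, 1]), (-648, [0, 0, 0, 1])], ofTerms [(-108, [0, 0, 0, 0, 1])],
      ofTerms [(-36, [0, 0, 1, 0, 0, 0, 0, 1]), (-324, [0, 0, 0, 0, 0, 1])], ofTerms [(-72, [0,
      0, 0, 0, 0, 0, 0, 2])], ofTerms [(-36, [0, 0, 0, 0, 1, 0, 0, 1])]],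
    [const 1296, const 0, const 0, const 0, const 0, const 0, const 0, const 0],
    [const 0, const 1296, const 0, const 0, const 0, const 0, const 0, const 0],
    [const 0, const 0, const 1296, const 0, const 0, const 0, const 0, const 0],
    [const 0, const 0, const 0, const 1296, const 0, const 0, const 0, const 0],
    [const 0, const 0, const 0, const 0, const 1296, const 0, const 0, const 0],
    [const 0, const 0, const 0, const 0, const 0, const 1296, const 0, const 0]]

/-- Multiplication by `46656 y`. -/
def Y : HMat :=
  [
    [ofTerms [ (-1029, [5]), (-13608, [2, 1]), (14256, [1, 0, 1]), (-31104, [0, 0, 0, 0, 0, 0, 0,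
      1])], ofTerms [ (-1323, [4, 1]), (2772, [3, 0, 1]), (-5616, [2, 0, 0, 0, 0, 0, 0, 1]),
      (-8748, [1, 2]), (7776, [1, 0, 0, 1]), (11664, [0, 1, 1]), (-15552, [0, 0, 0, 0, 1])],
      ofTerms [ (-588, [4, 0, 1]), (-252, [3, 0, 0, 0, 0, 0, 0, 1]), (-4536, [2, 0, 0, 1]),
      (-3888, [1, 1, 1]), (1296, [1, 0, 0, 0, 1]), (5184, [0, 0, 2])], ofTerms [ (-49, [5, 0, 0,
      0, 0, 0, 0, 1]), (-882, [4, 0, 0, 1]), (2016, [3, 0, 0, 0, 1]), (-4860, [2, 1, 0, 0, 0, 0,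
      0, 1]), (1008, [2, 0, 2]), (-5832, [1, 1, 0, 1]), (864, [1, 0, 1, 0, 0, 0, 0, 1]), (3888,
      [1, 0, 0, 0, 0, 1]), (7776, [0, 0, 1, 1])], ofTerms [ (-147, [4, 0, 0, 0, 1]), (-252, [2,
      0, 1, 0, 0, 0, 0, 1]), (-2268, [2, 0, 0, 0, 0, 1]), (-972, [1, 1, 0, 0, 1]), (864, [1, 0,
      0, 0, 0, 0, 0, 2]), (1296, [0, 0, 1, 0, 1])], ofTerms [ (-49, [4, 0, 1, 0, 0, 0, 0, 1]),
      (-441, [4, 0, 0, 0, 0, 1]), (1260, [2, 0, 1, 0, 1]), (-3024, [2, 0, 0, 1, 0, 0, 0, 1]),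
      (-324, [1, 1, 1, 0, 0, 0, 0, 1]), (-2916, [1, 1, 0, 0, 0, 1]), (432, [1, 0, 0, 0, 1, 0, 0,
      1]), (432, [0, 0, 2, 0, 0, 0, 0, 1]), (3888, [0, 0, 1, 0, 0, 1])], ofTerms [ (-98, [4, 0,
      0, 0, 0, 0, 0, 2]), (-252, [2, 0, 0, 0, 1, 0, 0, 1]), (-648, [1, 1, 0, 0, 0, 0, 0, 2]),
      (864, [0, 0, 1, 0, 0, 0, 0, 2])], ofTerms [ (-49, [4, 0, 0, 0, 1, 0, 0, 1]), (252, [2, 0,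
      0, 0, 2]), (-1512, [2, 0, 0, 0, 0, 1, 0, 1]), (-324, [1, 1, 0, 0, 1, 0, 0, 1]), (432, [0,
      0, 1, 0, 1, 0, 0, 1])]],
    [ofTerms [(-5292, [3]), (-34992, [0, 1])], ofTerms [(-6804, [2, 1]), (14256, [1, 0, 1]),
      (-31104, [0, 0, 0, 0, 0, 0, 0, 1])], ofTerms [(-3024, [2, 0, 1]), (-1296, [1, 0, 0, 0, 0,
      0, 0, 1]), (-23328, [0, 0, 0, 1])], ofTerms [ (-252, [3, 0, 0, 0, 0, 0, 0, 1]), (-4536, [2,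
      0, 0, 1]), (10368, [1, 0, 0, 0, 1]), (-23328, [0, 1, 0, 0, 0, 0, 0, 1]), (5184, [0, 0,
      2])], ofTerms [ (-756, [2, 0, 0, 0, 1]), (-1296, [0, 0, 1, 0, 0, 0, 0, 1]), (-11664, [0, 0,
      0, 0, 0, 1])], ofTerms [ (-252, [2, 0, 1, 0, 0, 0, 0, 1]), (-2268, [2, 0, 0, 0, 0, 1]),
      (6480, [0, 0, 1, 0, 1]), (-15552, [0, 0, 0, 1, 0, 0, 0, 1])], ofTerms [(-504, [2, 0, 0, 0,
      0, 0, 0, 2]), (-1296, [0, 0, 0, 0, 1, 0, 0, 1])], ofTerms [ (-252, [2, 0, 0, 0, 1, 0, 0,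
      1]), (1296, [0, 0, 0, 0, 2]), (-7776, [0, 0, 0, 0, 0, 1, 0, 1])]],
    [ofTerms [(9072, [2])], ofTerms [(11664, [1, 1]), (-15552, [0, 0, 1])], ofTerms [(5184, [1,
      0, 1]), (-31104, [0, 0, 0, 0, 0, 0, 0, 1])], ofTerms [(432, [2, 0, 0, 0, 0, 0, 0, 1]),
      (7776, [1, 0, 0, 1]), (-15552, [0, 0, 0, 0, 1])], ofTerms [(1296, [1, 0, 0, 0, 1])],
      ofTerms [(432, [1, 0, 1, 0, 0, 0, 0, 1]), (3888, [1, 0, 0, 0, 0, 1])], ofTerms [(864, [1,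
      0, 0, 0, 0, 0, 0, 2])], ofTerms [(432, [1, 0, 0, 0, 1, 0, 0, 1])]],
    [const 46656, const 0, const 0, const 0, const 0, const 0, const 0, const 0],
    [const 0, ofTerms [(-15552, [1])], const 0, ofTerms [(-15552, [0, 0, 1])], ofTerms [(-31104,
      [0, 0, 0, 0, 0, 0, 0, 1])], ofTerms [(-15552, [0, 0, 0, 0, 1])], const 0, const 0],
    [const 0, const 0, const 46656, const 0, const 0, const 0, const 0, const 0],
    [const 0, const 0, const 0, ofTerms [(-15552, [1])], const 0, ofTerms [(-15552, [0, 0, 1])],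
      ofTerms [(-31104, [0, 0, 0, 0, 0, 0, 0, 1])], ofTerms [(-15552, [0, 0, 0, 0, 1])]],
    [const 0, const 0, const 0, const 0, const 46656, const 0, const 0, const 0]]

/-- Multiplication by `108 s y / x`. -/
def V : HMat :=
  [
    [ofTerms [(21, [2, 0, 0, 0, 0, 0, 0, 1])], ofTerms [(27, [1, 1, 0, 0, 0, 0, 0, 1]), (-36, [0,
      0, 1, 0, 0, 0, 0, 1])], ofTerms [(12, [1, 0, 1, 0, 0, 0, 0, 1]), (-72, [0, 0, 0, 0, 0, 0,
      0, 2])], ofTerms [ (1, [2, 0, 0, 0, 0, 0, 0, 2]), (18, [1, 0, 0, 1, 0, 0, 0, 1]), (-36, [0,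
      0, 0, 0, 1, 0, 0, 1])], ofTerms [(3, [1, 0, 0, 0, 1, 0, 0, 1])], ofTerms [(1, [1, 0, 1, 0,
      0, 0, 0, 2]), (9, [1, 0, 0, 0, 0, 1, 0, 1])], ofTerms [(2, [1, 0, 0, 0, 0, 0, 0, 3])],
      ofTerms [(1, [1, 0, 0, 0, 1, 0, 0, 2])]],
    [ofTerms [(108, [0, 0, 0, 0, 0, 0, 0, 1])], const 0, const 0, const 0, const 0, const 0,
      const 0, const 0],
    [const 0, ofTerms [(-36, [1, 0, 0, 0, 0, 0, 0, 1])], const 0, ofTerms [(-36, [0, 0, 1, 0, 0,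
      0, 0, 1])], ofTerms [(-72, [0, 0, 0, 0, 0, 0, 0, 2])], ofTerms [(-36, [0, 0, 0, 0, 1, 0, 0,
      1])], const 0, const 0],
    [const 0, const 0, ofTerms [(108, [0, 0, 0, 0, 0, 0, 0, 1])], const 0, const 0, const 0,
      const 0, const 0],
    [const 0, const 0, const 0, ofTerms [(-36, [1, 0, 0, 0, 0, 0, 0, 1])], const 0, ofTerms
      [(-36, [0, 0, 1, 0, 0, 0, 0, 1])], ofTerms [(-72, [0, 0, 0, 0, 0, 0, 0, 2])], ofTerms
      [(-36, [0, 0, 0, 0, 1, 0, 0, 1])]],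
    [const 0, const 0, const 0, const 0, ofTerms [(108, [0, 0, 0, 0, 0, 0, 0, 1])], const 0,
      const 0, const 0],
    [const 0, const 1296, ofTerms [(756, [1])], ofTerms [(972, [0, 1])], ofTerms [(432, [0, 0,
      1])], ofTerms [(648, [0, 0, 0, 1])], ofTerms [(108, [0, 0, 0, 0, 1])], ofTerms [(324, [0,
      0, 0, 0, 0, 1])]],
    [const 0, const 0, const 0, const 0, const 0, const 0, ofTerms [(108, [0, 0, 0, 0, 0, 0, 0,
      1])], const 0]]

/-- Multiplication by `940369969152 (f / x - t12)`. -/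
def nilpotent : HMat :=
  nilpotentPart 8 X Y V
    [const 0, smul 544195584 (var 5), smul 279936 (var 3), smul 108 (var 1)]
    [smul 11757312 (var 4), smul 5184 (var 2), smul 1 (var 0)]
    [smul (-130606940160) (var 4), smul (-100776960) (var 2), smul (-77760) (var 0)]
    (-2418647040) 7

/-- Multiplication by `940369969152 f / x`. -/
def valueMatrix : HMat := (HMat.scalar (smul 940369969152 (var 6)) 8).add nilpotent

/-- The coordinates `x` and the function `z` as polynomials in rescaled coordinates. -/
def coordinate : List HPoly := [
    smul 2 (var 0), var 1, var 2, var 3, var 4, var 5,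
    ofTerms [
      (-1024, [10]), (640, [7, 1]), (32, [6, 0, 1]), (-1248, [4, 2]), (32, [4, 0, 0, 1]),
      (160, [3, 1, 1]), (-8, [3, 0, 0, 0, 1]), (-6, [2, 0, 2]), (176, [1, 3]),
      (-48, [1, 1, 0, 1]), (4, [1, 0, 0, 0, 0, 1]), (-12, [0, 2, 1]), (2, [0, 1, 0, 0, 1]),
      (2, [0, 0, 1, 1]), (1, [0, 0, 0, 0, 0, 0, 2])],
    var 7, var 6]

/-- The parameters of the family as polynomials in rescaled coordinates. -/
def parameter : List HPoly := [
    ofTerms [(24, [1])],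
    ofTerms [(-736, [3]), (48, [0, 1])],
    ofTerms [(-1872, [4]), (624, [1, 1]), (-12, [0, 0, 1])],
    ofTerms [
      (21760, [6]), (-22848, [3, 1]), (816, [2, 0, 1]), (-48, [1, 0, 0, 0, 0, 0, 1]),
      (816, [0, 2]), (-48, [0, 0, 0, 1])],
    ofTerms [
      (4608, [7]), (-21504, [4, 1]), (1344, [3, 0, 1]), (4032, [1, 2]), (-336, [1, 0, 0, 1]),
      (-168, [0, 1, 1]), (12, [0, 0, 0, 0, 1])],
    ofTerms [
      (-382976, [9]), (405504, [6, 1]), (-12672, [5, 0, 1]), (3744, [4, 0, 0, 0, 0, 0, 1]),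
      (-215424, [3, 2]), (6336, [3, 0, 0, 1]), (15840, [2, 1, 1]), (-528, [2, 0, 0, 0, 1]),
      (-1248, [1, 1, 0, 0, 0, 0, 1]), (-264, [1, 0, 2]), (5632, [0, 3]), (-1056, [0, 1, 0, 1]),
      (24, [0, 0, 1, 0, 0, 0, 1]), (48, [0, 0, 0, 0, 0, 1])],
    ofTerms [
      (-624640, [12]), (-2211840, [9, 1]), (261120, [8, 0, 1]), (-9216, [7, 0, 0, 0, 0, 0, 1]),
      (1221120, [6, 2]), (-84480, [6, 0, 0, 1]), (-76800, [5, 1, 1]), (-384, [5, 0, 0, 0, 1]),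
      (43008, [4, 1, 0, 0, 0, 0, 1]), (-2400, [4, 0, 2]), (-513280, [3, 3]),
      (42240, [3, 1, 0, 1]), (-2688, [3, 0, 1, 0, 0, 0, 1]), (1920, [3, 0, 0, 0, 0, 1]),
      (60480, [2, 2, 1]), (-3840, [2, 1, 0, 0, 1]), (-960, [2, 0, 1, 1]),
      (240, [2, 0, 0, 0, 0, 0, 2]), (-8064, [1, 2, 0, 0, 0, 0, 1]), (-2160, [1, 1, 2]),
      (240, [1, 0, 1, 0, 1]), (672, [1, 0, 0, 1, 0, 0, 1]), (12000, [0, 4]),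
      (-4800, [0, 2, 0, 1]), (336, [0, 1, 1, 0, 0, 0, 1]), (480, [0, 1, 0, 0, 0, 1]),
      (20, [0, 0, 3]), (240, [0, 0, 0, 2]), (-24, [0, 0, 0, 0, 1, 0, 1]),
      (-48, [0, 0, 0, 0, 0, 0, 0, 1])],
    ofTerms [(-6, [0, 0, 0, 0, 0, 0, 1])]]

/-- The transition matrix between the flat frame and the frame of monomials. -/
def transition : HMat :=
  [
    [const 12, ofTerms [(-1104, [2])], ofTerms [(-3744, [3]), (312, [0, 1])], ofTerms [(65280,
      [5]), (-34272, [2, 1]), (816, [1, 0, 1]), (-24, [0, 0, 0, 0, 0, 0, 1])], ofTerms [ (16128,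
      [6]), (-43008, [3, 1]), (2016, [2, 0, 1]), (2016, [0, 2]), (-168, [0, 0, 0, 1])], ofTerms [
      (-1723392, [8]), (1216512, [5, 1]), (-31680, [4, 0, 1]), (7488, [3, 0, 0, 0, 0, 0, 1]),
      (-323136, [2, 2]), (9504, [2, 0, 0, 1]), (15840, [1, 1, 1]), (-528, [1, 0, 0, 0, 1]),
      (-624, [0, 1, 0, 0, 0, 0, 1]), (-132, [0, 0, 2])], ofTerms [ (-61440, [9]), (26880, [6,
      1]), (1152, [5, 0, 1]), (-29952, [3, 2]), (768, [3, 0, 0, 1]), (2880, [2, 1, 1]), (-144,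
      [2, 0, 0, 0, 1]), (-72, [1, 0, 2]), (1056, [0, 3]), (-288, [0, 1, 0, 1]), (24, [0, 0, 0, 0,
      0, 1])], ofTerms [ (-2519040, [11]), (-10490880, [8, 1]), (1021440, [7, 0, 1]), (-32256,
      [6, 0, 0, 0, 0, 0, 1]), (4262400, [5, 2]), (-268800, [5, 0, 0, 1]), (-249600, [4, 1, 1]),
      (1920, [4, 0, 0, 0, 1]), (86016, [3, 1, 0, 0, 0, 0, 1]), (-3360, [3, 0, 2]), (-791040, [2,
      3]), (69120, [2, 1, 0, 1]), (-4032, [2, 0, 1, 0, 0, 0, 1]), (2400, [2, 0, 0, 0, 0, 1]),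
      (60480, [1, 2, 1]), (-3840, [1, 1, 0, 0, 1]), (-960, [1, 0, 1, 1]), (240, [1, 0, 0, 0, 0,
      0, 2]), (-4032, [0, 2, 0, 0, 0, 0, 1]), (-1080, [0, 1, 2]), (120, [0, 0, 1, 0, 1]), (336,
      [0, 0, 0, 1, 0, 0, 1])]],
    [const 0, const 48, ofTerms [(624, [1])], ofTerms [(-22848, [3]), (1632, [0, 1])], ofTerms
      [(-21504, [4]), (8064, [1, 1]), (-168, [0, 0, 1])], ofTerms [ (405504, [6]), (-430848, [3,
      1]), (15840, [2, 0, 1]), (-1248, [1, 0, 0, 0, 0, 0, 1]), (16896, [0, 2]), (-1056, [0, 0, 0,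
      1])], ofTerms [ (7680, [7]), (-29952, [4, 1]), (1920, [3, 0, 1]), (6336, [1, 2]), (-576,
      [1, 0, 0, 1]), (-288, [0, 1, 1]), (24, [0, 0, 0, 0, 1])], ofTerms [ (-2365440, [9]),
      (3041280, [6, 1]), (-115200, [5, 0, 1]), (43008, [4, 0, 0, 0, 0, 0, 1]), (-1666560, [3,
      2]), (53760, [3, 0, 0, 1]), (126720, [2, 1, 1]), (-4320, [2, 0, 0, 0, 1]), (-16128, [1, 1,
      0, 0, 0, 0, 1]), (-2160, [1, 0, 2]), (48000, [0, 3]), (-9600, [0, 1, 0, 1]), (336, [0, 0,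
      1, 0, 0, 0, 1]), (480, [0, 0, 0, 0, 0, 1])]],
    [const 0, const 0, const (-12), ofTerms [(816, [2])], ofTerms [(1344, [3]), (-168, [0, 1])],
      ofTerms [(-12672, [5]), (15840, [2, 1]), (-528, [1, 0, 1]), (24, [0, 0, 0, 0, 0, 0, 1])],
      ofTerms [(384, [6]), (1920, [3, 1]), (-144, [2, 0, 1]), (-144, [0, 2]), (24, [0, 0, 0,
      1])], ofTerms [ (253440, [8]), (-115200, [5, 1]), (-1920, [4, 0, 1]), (-2688, [3, 0, 0, 0,
      0, 0, 1]), (63360, [2, 2]), (-1440, [2, 0, 0, 1]), (-4320, [1, 1, 1]), (240, [1, 0, 0, 0,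
      1]), (336, [0, 1, 0, 0, 0, 0, 1]), (60, [0, 0, 2])]],
    [const 0, const 0, const 0, const (-48), ofTerms [(-336, [1])], ofTerms [(6336, [3]), (-1056,
      [0, 1])], ofTerms [(384, [4]), (-576, [1, 1]), (24, [0, 0, 1])], ofTerms [ (-92160, [6]),
      (53760, [3, 1]), (-1440, [2, 0, 1]), (672, [1, 0, 0, 0, 0, 0, 1]), (-4800, [0, 2]), (480,
      [0, 0, 0, 1])]],
    [const 0, const 0, const 0, const 0, const 12, ofTerms [(-528, [2])], ofTerms [(-96, [3]),
      (24, [0, 1])], ofTerms [(1536, [5]), (-4320, [2, 1]), (240, [1, 0, 1]), (-24, [0, 0, 0, 0,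
      0, 0, 1])]],
    [const 0, const 0, const 0, const 0, const 0, const 48, ofTerms [(48, [1])], ofTerms [(960,
      [3]), (480, [0, 1])]],
    [const 0, const 0, const 0, const 0, const 0, const 0, const (-12), ofTerms [(240, [2])]],
    [const 0, const 0, const 0, const 0, const 0, const 0, const 0, const (-48)]]

/-- A multiple of the matrix `T`. -/
def matrixT : HMat :=
  eulerMatrix 8 23796572800 17847429600 potential branch [1, 3, 4, 6, 7, 9, 10, 12, 5]

/-- The rescaled coordinates as polynomials in the parameters. -/
def inverse : List HPoly := [
    ofTerms [(3, [1])],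
    ofTerms [(414, [3]), (7776, [0, 1])],
    ofTerms [(51948, [4]), (1213056, [1, 1]), (-2239488, [0, 0, 1])],
    ofTerms [
      (5871528, [6]), (195115392, [3, 1]), (-342641664, [2, 0, 1]),
      (967458816, [1, 0, 0, 0, 0, 0, 0, 1]), (1027924992, [0, 2]), (-2902376448, [0, 0, 0, 1])],
    ofTerms [
      (523694160, [7]), (20046216960, [4, 1]), (-34989760512, [3, 0, 1]),
      (81266540544, [2, 0, 0, 0, 0, 0, 0, 1]), (157453922304, [1, 2]),
      (-243799621632, [1, 0, 0, 1]), (-243799621632, [0, 1, 1]), (835884417024, [0, 0, 0, 0, 1])],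
    ofTerms [
      (78433368552, [9]), (3799986753024, [6, 1]), (-6592748101632, [5, 0, 1]),
      (13408979189760, [4, 0, 0, 0, 0, 0, 0, 1]), (49445610762240, [3, 2]),
      (-40226937569280, [3, 0, 0, 1]), (-120680812707840, [2, 1, 1]),
      (82752557285376, [2, 0, 0, 0, 1]), (165505114570752, [1, 1, 0, 0, 0, 0, 0, 1]),
      (82752557285376, [1, 0, 2]), (120680812707840, [0, 3]), (-496515343712256, [0, 1, 0, 1]),
      (-361102068154368, [0, 0, 1, 0, 0, 0, 0, 1]), (1083306204463104, [0, 0, 0, 0, 0, 1])],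
    ofTerms [(-322486272, [0, 0, 0, 0, 0, 0, 0, 1])],
    ofTerms [
      (708203923434000, [12]), (45172953612864000, [9, 1]), (-78058863843028992, [8, 0, 1]),
      (148389127305560064, [7, 0, 0, 0, 0, 0, 0, 1]), (936706366116347904, [6, 2]),
      (-445167381916680192, [6, 0, 0, 1]), (-2671004291500081152, [5, 1, 1]),
      (832520818129895424, [5, 0, 0, 0, 1]), (4162604090649477120, [4, 1, 0, 0, 0, 0, 0, 1]),
      (2081302045324738560, [4, 0, 2]), (6677510728750202880, [3, 3]),
      (-12487812271948431360, [3, 1, 0, 1]), (-7539811183063203840, [3, 0, 1, 0, 0, 0, 0, 1]),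
      (5654858387297402880, [3, 0, 0, 0, 0, 1]), (-18731718407922647040, [2, 2, 1]),
      (16964575161892208640, [2, 1, 0, 0, 1]), (16964575161892208640, [2, 0, 1, 1]),
      (9359765606561218560, [2, 0, 0, 0, 0, 0, 0, 2]),
      (16964575161892208640, [1, 2, 0, 0, 0, 0, 0, 1]), (16964575161892208640, [1, 1, 2]),
      (-28079296819683655680, [1, 0, 1, 0, 1]),
      (-28079296819683655680, [1, 0, 0, 1, 0, 0, 0, 1]), (9365859203961323520, [0, 4]),
      (-50893725485676625920, [0, 2, 0, 1]), (-28079296819683655680, [0, 1, 1, 0, 0, 0, 0, 1]),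
      (84237890459050967040, [0, 1, 0, 0, 0, 1]), (-4679882803280609280, [0, 0, 3]),
      (42118945229525483520, [0, 0, 0, 2]), (134780624734481547264, [0, 0, 0, 0, 1, 0, 0, 1]),
      (-404341874203444641792, [0, 0, 0, 0, 0, 0, 1])]]

/-- The weights of the parameters. -/
def weight : List ℕ := [1, 3, 4, 6, 7, 9, 12, 5]

/-- The weights of the coordinates. -/
def coordWeight : List ℕ := [1, 3, 4, 6, 7, 9, 5, 12]

/-- The rows of `transition` are the classes of `(∂f/∂x_i) / x` in the monomials `x³u, x³, x²u, x²,
xu, x, u, 1`. The coordinate `x1` is twice the rescaled variable, as in `coordinate`, so the first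
row is half the derivative in that variable. The constants amount to `f / x = -48 T`, with `-48` the
coefficient of `x8` in `t12`. -/
lemma eq_transition :
    ((transition.mul (valueMatrix.subst (listSubst parameter))).smul (const 185910725)).eq
      (((matrixT.subst (listSubst coordinate)).mul transition).smul (const (-2448880128))) =
      true := by
  decide +kernel

lemma isTriangular_transition :
    transition.isTriangular 8 [12, 48, -12, -48, 12, 48, -12, -48] = true := by
  decide +kernel

lemma isInverse_parameter : isInverseCert 8 parameter inverse 72 weight = true := by
  decide +kernel

lemma isInverse_inverse : isInverseCert 8 inverse parameter 72 coordWeight = true := by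
  decide +kernel

lemma isHomogeneousMap_parameter :
    isHomogeneousMap 8 coordWeight weight parameter = true := by
  decide +kernel

/-- The exponents are the weights of the monomials, with `x` of weight `3` and `u` of weight `2`; `f
/ x` has weight `12`. -/
lemma isHomogeneous_valueMatrix :
    valueMatrix.isHomogeneous 8 weight [11, 9, 8, 6, 5, 3, 2, 0] 12 = true := by
  decide +kernel

lemma isFree_nilpotent : nilpotent.isFree 6 = true := by
  decide +kernel

lemma X_mul_Y : (X.mul Y).eq (Y.mul X) = true := by
  decide +kernel

lemma X_mul_V : (X.mul V).eq (V.mul X) = true := by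
  decide +kernel

lemma Y_mul_V : (Y.mul V).eq (V.mul Y) = true := by
  decide +kernel

/-- The potential of type `E8(1)`. -/
def potentialData : PotentialData 8 6 weightE8 (fun x => vE8 (x 0) (x 1) (x 2) (x 3) (x 4) (x 5))
    (fun x z => potentialE8 (x 0) (x 1) (x 2) (x 3) (x 4) (x 5) (x 6) (x 7) z) where
  Q := potential
  r := branch
  W := [1, 3, 4, 6, 7, 9, 10, 12, 5]
  L := 285558873600
  b := 2
  β := 23796572800
  γ := 17847429600
  h := 12
  W' := 5
  L_ne := by norm_num
  b_ne := by norm_num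
  h_ne := by norm_num
  two_b_mul_γ := by norm_num
  eval_Q x z := by
    simp only [potentialE8, potentialE8Part0, potentialE8Part1, potentialE8Part2, potentialE8Part3,
      potentialE8Part4, potentialE8Part5, potentialE8Part6, potentialE8Part7, potentialE8Part8,
      potentialE8Part9, potentialE8Part10, potentialE8Part11, potential, eval_ofTerms_cons,
      eval_ofTerms_nil,
      eval_monomial_cons, eval_monomial_nil, Nat.reduceAdd]
    simp [slots]
    ring
  eval_r x z := by
    simp only [vE8, branch, eval_ofTerms_cons, eval_ofTerms_nil,
      eval_monomial_cons, eval_monomial_nil, Nat.reduceAdd]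
    simp [slots]
    ring
  v_update x y := rfl
  weight k := by fin_cases k <;> norm_num [weightE8]
  weight_z := rfl
  weight_r := by decide +kernel
  deriv_r := by decide +kernel
  deriv_z_Q := by decide +kernel
  deriv_z_r := by decide +kernel
  deriv_z_deriv_Q := by decide +kernel
  deriv_z_deriv_r := by decide +kernel

/-- An eigenvector of the matrices in terms of two further variables, which stand for `x` and
`y / x`. -/
def eigenvector : List HPoly :=
    [ofTerms [(1, [0, 0, 0, 0, 0, 0, 0, 0, 3, 1])], ofTerms [(1, [0, 0, 0, 0, 0, 0, 0, 0, 3])],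
      ofTerms [(1, [0, 0, 0, 0, 0, 0, 0, 0, 2, 1])], ofTerms [(1, [0, 0, 0, 0, 0, 0, 0, 0, 2])],
      ofTerms [(1, [0, 0, 0, 0, 0, 0, 0, 0, 1, 1])], ofTerms [(1, [0, 0, 0, 0, 0, 0, 0, 0, 1])],
      ofTerms [(1, [0, 0, 0, 0, 0, 0, 0, 0, 0, 1])], const 1]

/-- The derivative of `f` with respect to `y`, divided by `x`. -/
def relation₁ : HPoly :=
  ofTerms [
    (1, [1, 0, 0, 0, 0, 0, 0, 0, 2]), (1, [0, 0, 1, 0, 0, 0, 0, 0, 1]), (1, [0, 0, 0, 0, 1]),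
    (2, [0, 0, 0, 0, 0, 0, 0, 1, 0, 1]), (3, [0, 0, 0, 0, 0, 0, 0, 0, 1, 2])]

/-- A combination of the derivatives of `f`, divided by `x ^ 2`. -/
def relation₂ : HPoly :=
  ofTerms [
    (-7, [1, 0, 0, 0, 0, 0, 0, 0, 2, 1]), (-9, [0, 1, 0, 0, 0, 0, 0, 0, 2]),
    (-4, [0, 0, 1, 0, 0, 0, 0, 0, 1, 1]), (-6, [0, 0, 0, 1, 0, 0, 0, 0, 1]),
    (-1, [0, 0, 0, 0, 1, 0, 0, 0, 0, 1]), (-3, [0, 0, 0, 0, 0, 1]),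
    (1, [0, 0, 0, 0, 0, 0, 0, 1, 0, 2]), (-12, [0, 0, 0, 0, 0, 0, 0, 0, 3])]

lemma isEigenvector_X : isEigenvectorCert X eigenvector
    (ofTerms [(1296, [0, 0, 0, 0, 0, 0, 0, 0, 1])]) relation₁ relation₂
    [ofTerms [ (-7, [2, 0, 0, 0, 0, 0, 0, 1]), (252, [1, 0, 0, 0, 0, 0, 0, 0, 2]), (144, [0, 0,
      1, 0, 0, 0, 0, 0, 1]), (36, [0, 0, 0, 0, 1]), (-36, [0, 0, 0, 0, 0, 0, 0, 1, 0, 1])],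
      ofTerms [(-36, [0, 0, 0, 0, 0, 0, 0, 1])], const 0, const 0, const 0, const 0, const 0,
      const 0]
    [ofTerms [ (21, [2, 0, 0, 0, 0, 0, 0, 0, 1]), (72, [0, 0, 0, 0, 0, 0, 0, 1]), (108, [0, 0, 0,
      0, 0, 0, 0, 0, 1, 1])], ofTerms [(108, [0, 0, 0, 0, 0, 0, 0, 0, 1])], const 0, const 0,
      const 0, const 0, const 0, const 0] = true := by
  decide +kernel

lemma isEigenvector_Y : isEigenvectorCert Y eigenvector
    (ofTerms [(46656, [0, 0, 0, 0, 0, 0, 0, 0, 1, 1])]) relation₁ relation₂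
    [ofTerms [ (-49, [4, 0, 0, 0, 0, 0, 0, 1]), (1764, [3, 0, 0, 0, 0, 0, 0, 0, 2]), (1008, [2,
      0, 1, 0, 0, 0, 0, 0, 1]), (252, [2, 0, 0, 0, 1]), (-252, [2, 0, 0, 0, 0, 0, 0, 1, 0, 1]),
      (-324, [1, 1, 0, 0, 0, 0, 0, 1]), (432, [1, 0, 0, 0, 0, 0, 0, 1, 1]), (9072, [1, 0, 0, 0,
      0, 0, 0, 0, 2, 1]), (11664, [0, 1, 0, 0, 0, 0, 0, 0, 2]), (432, [0, 0, 1, 0, 0, 0, 0, 1]),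
      (5184, [0, 0, 1, 0, 0, 0, 0, 0, 1, 1]), (7776, [0, 0, 0, 1, 0, 0, 0, 0, 1]), (1296, [0, 0,
      0, 0, 1, 0, 0, 0, 0, 1]), (3888, [0, 0, 0, 0, 0, 1]), (-1296, [0, 0, 0, 0, 0, 0, 0, 1, 0,
      2])], ofTerms [ (-252, [2, 0, 0, 0, 0, 0, 0, 1]), (9072, [1, 0, 0, 0, 0, 0, 0, 0, 2]),
      (5184, [0, 0, 1, 0, 0, 0, 0, 0, 1]), (1296, [0, 0, 0, 0, 1]), (-1296, [0, 0, 0, 0, 0, 0, 0,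
      1, 0, 1])], ofTerms [(432, [1, 0, 0, 0, 0, 0, 0, 1]), (-15552, [0, 0, 0, 0, 0, 0, 0, 0,
      2])], const 0, ofTerms [(-15552, [0, 0, 0, 0, 0, 0, 0, 0, 1])], const 0, const (-15552),
      const 0]
    [ofTerms [ (147, [4, 0, 0, 0, 0, 0, 0, 0, 1]), (504, [2, 0, 0, 0, 0, 0, 0, 1]), (756, [2, 0,
      0, 0, 0, 0, 0, 0, 1, 1]), (972, [1, 1, 0, 0, 0, 0, 0, 0, 1]), (1296, [0, 0, 0, 0, 1]),
      (2592, [0, 0, 0, 0, 0, 0, 0, 1, 0, 1]), (3888, [0, 0, 0, 0, 0, 0, 0, 0, 1, 2])], ofTerms [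
      (756, [2, 0, 0, 0, 0, 0, 0, 0, 1]), (2592, [0, 0, 0, 0, 0, 0, 0, 1]), (3888, [0, 0, 0, 0,
      0, 0, 0, 0, 1, 1])], ofTerms [(-1296, [1, 0, 0, 0, 0, 0, 0, 0, 1])], const 0, const 0,
      const 0, const 0, const 0] = true := by
  decide +kernel

lemma isEigenvector_V : isEigenvectorCert V eigenvector
    (ofTerms [(108, [0, 0, 0, 0, 0, 0, 0, 1, 0, 1])]) relation₁ relation₂
    [ofTerms [(1, [1, 0, 0, 0, 0, 0, 0, 2]), (-36, [0, 0, 0, 0, 0, 0, 0, 1, 2])], const 0,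
      ofTerms [(-36, [0, 0, 0, 0, 0, 0, 0, 1, 1])], const 0, ofTerms [(-36, [0, 0, 0, 0, 0, 0, 0,
      1])], const 0, const 0, const 0]
    [ofTerms [(-3, [1, 0, 0, 0, 0, 0, 0, 1, 1])], const 0, const 0, const 0, const 0, const 0,
      const (-108), const 0] = true := by
  decide +kernel

/-- For `y = x u` and `w = s u` the right side is `78364164096 (12 f / x - (4 x u + 5 s / 3) R₁ + x
R₂)`; the multiple of `R₂` removes `x ^ 4`. -/
lemma valueMatrix_mulVec_eigenvalue (p : Fin 8 → ℂ) (x y w : ℂ) :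
    (smul 940369969152 (var 6)).eval (slots p 0) 0 + ((HMat.hornerVal (slots p 0) (1296 * x)
      [const 0, smul 544195584 (var 5), smul 279936 (var 3), smul 108 (var 1)] +
      46656 * y * HMat.hornerVal (slots p 0) (1296 * x)
      [smul 11757312 (var 4), smul 5184 (var 2), smul 1 (var 0)]) +
      slots p 0 7 * ((-2418647040 : ℤ) * (108 * w) + HMat.hornerVal (slots p 0) (1296 * x)
      [smul (-130606940160) (var 4), smul (-100776960) (var 2), smul (-77760) (var 0)])) =
      78364164096 * (12 * p 6 + 9 * p 5 * x + 6 * p 3 * x ^ 2 + 3 * p 1 * x ^ 3 + 7 * p 4 * y + 4 * p 2 * x *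
        y + p 0 * x ^ 2 * y - 10/3 * p 7 * w - 5/3 * p 7 * p 4 - 5/3 * p 7 * p 2 * x - 5/3 * p 7
        * p 0 * x ^ 2) := by
  simp [HMat.hornerVal, slots]
  ring

lemma exists_isSingularPoint_surface_iff {p : Fin 8 → ℂ} (hp : p 6 ≠ 0) :
    (∃ a, IsSingularPoint (surfaceE8 p) a) ↔ ∃ x u : ℂ, x ≠ 0 ∧
      3 * x * u ^ 2 + 2 * p 7 * u + (p 4 + p 2 * x + p 0 * x ^ 2) = 0 ∧
      p 7 * u ^ 2 - 3 * (p 5 + 2 * p 3 * x + 3 * p 1 * x ^ 2 + 4 * 1 * x ^ 3) -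
        u * (p 4 + 4 * p 2 * x + 7 * p 0 * x ^ 2) = 0 ∧
      x ^ 2 * u ^ 3 + (p 6 + p 5 * x + p 3 * x ^ 2 + p 1 * x ^ 3 + 1 * x ^ 4) +
        u * (p 4 * x + p 2 * x ^ 2 + p 0 * x ^ 3) + p 7 * x * u ^ 2 = 0 :=
  exists_isSingularPoint_iff hp fun a => by
    rw [surfaceE8, fE8]
    ring

lemma det_eq_zero_of_isSingularPoint {p : Fin 8 → ℂ} (hp : p 6 ≠ 0)
    (h : ∃ a, IsSingularPoint (surfaceE8 p) a) :
    (HMat.toMatrix 8 (slots p 0) valueMatrix).det = 0 := by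
  obtain ⟨x, u, hx, h1, h2, h3⟩ := (exists_isSingularPoint_surface_iff hp).1 h
  have hR : relation₁.eval
      (Function.update (Function.update (slots p 0) 8 x) (8 + 1) u) 0 = 0 := by
    simp [relation₁, slots]
    linear_combination h1
  have hR' : relation₂.eval
      (Function.update (Function.update (slots p 0) 8 x) (8 + 1) u) 0 = 0 := by
    simp [relation₂, slots]
    linear_combination h2
  have hX := mulVec_update_of_isEigenvectorCert (by norm_num) (by decide +kernel)
    isEigenvector_X (by decide +kernel) (by decide +kernel) hR hR'
  have hY := mulVec_update_of_isEigenvectorCert (by norm_num) (by decide +kernel)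
    isEigenvector_Y (by decide +kernel) (by decide +kernel) hR hR'
  have hV := mulVec_update_of_isEigenvectorCert (by norm_num) (by decide +kernel)
    isEigenvector_V (by decide +kernel) (by decide +kernel) hR hR'
  rw [← Matrix.exists_mulVec_eq_zero_iff]
  refine ⟨fun i : Fin 8 => (eigenvector.getD i (const 0)).eval
    (Function.update (Function.update (slots p 0) 8 x) (8 + 1) u) 0, fun h0 => ?_, ?_⟩
  rotate_left
  · rw [valueMatrix, nilpotent, HMat.scalar_add_nilpotentPart_mulVec _ _ _ _ _ _
      (by decide +kernel) hX hY hV]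
    refine smul_eq_zero_of_left ?_ _
    have hx : (ofTerms [(1296, [0, 0, 0, 0, 0, 0, 0, 0, 1])]).eval
        (Function.update (Function.update (slots p 0) 8 x) (8 + 1) u) 0 = 1296 * x := by
      simp
      ring
    have hy : (ofTerms [(46656, [0, 0, 0, 0, 0, 0, 0, 0, 1, 1])]).eval
        (Function.update (Function.update (slots p 0) 8 x) (8 + 1) u) 0 = 46656 * (x * u) := by
      simp
      ring
    have hw : (ofTerms [(108, [0, 0, 0, 0, 0, 0, 0, 1, 0, 1])]).eval
        (Function.update (Function.update (slots p 0) 8 x) (8 + 1) u) 0 =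
          108 * (p 7 * u) := by
      simp [slots]
      ring
    rw [hx, hy, hw, valueMatrix_mulVec_eigenvalue]
    linear_combination
      940369969152 * h3 - 78364164096 * (4 * u * x + 5/3 * p 7) * h1 - 78364164096 * (-x) * h2
  -- The last entry is the monomial `1`, so the null vector is not zero.
  · have := congrFun h0 7
    simp [eigenvector] at this

/-- All entries of a common eigenvector are determined by the last two, which stand for `u` and `1`:
six rows of `X` express the others through them. -/
lemma isSingularPoint_of_det_eq_zero {p : Fin 8 → ℂ} (hp : p 6 ≠ 0)
    (h : (HMat.toMatrix 8 (slots p 0) valueMatrix).det = 0) :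
    ∃ a, IsSingularPoint (surfaceE8 p) a := by
  rw [exists_isSingularPoint_surface_iff hp]
  obtain ⟨v, x, y, w, hv, hX, hY, hV, hg⟩ := HMat.exists_eigenvector_of_det_eq_zero _ _ _ _ _ _
    (by decide +kernel) (by decide +kernel) (by decide +kernel) X_mul_Y X_mul_V Y_mul_V h
  obtain ⟨x, rfl⟩ : ∃ x', x = 1296 * x' := ⟨x / 1296, by ring⟩
  obtain ⟨y, rfl⟩ : ∃ y', y = 46656 * y' := ⟨y / 46656, by ring⟩
  obtain ⟨w, rfl⟩ : ∃ w', w = 108 * w' := ⟨w / 108, by ring⟩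
  rw [valueMatrix_mulVec_eigenvalue] at hg
  have h2 : v 0 = x * v 2 := by
    have := congrFun hX 2
    simp [Matrix.mulVec, dotProduct, Fin.sum_univ_eight, HMat.toMatrix_apply, HMat.entry, X] at this
    linear_combination this / 1296
  have h3 : v 1 = x * v 3 := by
    have := congrFun hX 3
    simp [Matrix.mulVec, dotProduct, Fin.sum_univ_eight, HMat.toMatrix_apply, HMat.entry, X] at this
    linear_combination this / 1296
  have h4 : v 2 = x * v 4 := by
    have := congrFun hX 4
    simp [Matrix.mulVec, dotProduct, Fin.sum_univ_eight, HMat.toMatrix_apply, HMat.entry, X] at this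
    linear_combination this / 1296
  have h5 : v 3 = x * v 5 := by
    have := congrFun hX 5
    simp [Matrix.mulVec, dotProduct, Fin.sum_univ_eight, HMat.toMatrix_apply, HMat.entry, X] at this
    linear_combination this / 1296
  have h6 : v 4 = x * v 6 := by
    have := congrFun hX 6
    simp [Matrix.mulVec, dotProduct, Fin.sum_univ_eight, HMat.toMatrix_apply, HMat.entry, X] at this
    linear_combination this / 1296
  have h7 : v 5 = x * v 7 := by
    have := congrFun hX 7
    simp [Matrix.mulVec, dotProduct, Fin.sum_univ_eight, HMat.toMatrix_apply, HMat.entry, X] at this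
    linear_combination this / 1296
  have hy : v 4 = y * v 7 := by
    have := congrFun hY 7
    simp [Matrix.mulVec, dotProduct, Fin.sum_univ_eight, HMat.toMatrix_apply, HMat.entry, Y] at this
    linear_combination this / 46656
  have hw : p 7 * v 6 = w * v 7 := by
    have := congrFun hV 7
    simp [Matrix.mulVec, dotProduct, Fin.sum_univ_eight, HMat.toMatrix_apply, HMat.entry, slots,
      V] at this
    linear_combination this / 108
  have hyu : -p 0 * v 3 - p 2 * v 5 - 2 * p 7 * v 6 - p 4 * v 7 = 3 * y * v 6 := by
    have := congrFun hY 6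
    simp [Matrix.mulVec, dotProduct, Fin.sum_univ_eight, HMat.toMatrix_apply, HMat.entry, slots,
      Y] at this
    linear_combination this / 15552
  have hwu : 12 * v 1 + 7 * p 0 * v 2 + 9 * p 1 * v 3 + 4 * p 2 * v 4 + 6 * p 3 * v 5 + p 4 * v 6 + 3 *
      p 5 * v 7 =
      w * v 6 := by
    have := congrFun hV 6
    simp [Matrix.mulVec, dotProduct, Fin.sum_univ_eight, HMat.toMatrix_apply, HMat.entry, slots,
      V] at this
    linear_combination this / 108
  -- For `x = 0` the vanishing of `f / x` forces `t12 = 0`.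
  by_cases hx : x = 0
  · exfalso
    have z5 : v 5 = 0 := by rw [h7, hx, zero_mul]
    have z4 : v 4 = 0 := by rw [h6, hx, zero_mul]
    have z3 : v 3 = 0 := by rw [h5, hx, zero_mul]
    have z2 : v 2 = 0 := by rw [h4, hx, zero_mul]
    have z1 : v 1 = 0 := by rw [h3, hx, zero_mul]
    have z0 : v 0 = 0 := by rw [h2, hx, zero_mul]
    simp only [z5, z4, z3, z2, z1, mul_zero, add_zero, zero_add] at hyu hwu hy
    by_cases hl : v 7 = 0
    · have hu : v 6 ≠ 0 := by
        intro hu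
        refine hv (funext fun i => ?_)
        fin_cases i <;> simp [z5, z4, z3, z2, z1, z0, hl, hu]
      have hs : p 7 = 0 := by
        rw [hl, mul_zero] at hw
        exact (mul_eq_zero.1 hw).resolve_right hu
      have hy0 : y = 0 := by
        rw [hs, hl] at hyu
        refine (mul_eq_zero.1 (?_ : y * v 6 = 0)).resolve_right hu
        linear_combination -hyu / 3
      rw [hx, hy0, hs] at hg
      exact hp (by linear_combination hg / 940369969152)
    · have hy0 : y = 0 := (mul_eq_zero.1 hy.symm).resolve_right hl
      have hW : 2 * w + p 4 = 0 := by
        refine (mul_eq_zero.1 (?_ : (2 * w + p 4) * v 7 = 0)).resolve_right hl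
        rw [hy0] at hyu
        linear_combination -hyu - 2 * hw
      rw [hx, hy0] at hg
      exact hp (by linear_combination hg / 940369969152 + 5/36 * p 7 * hW)
  -- If the last entry were zero, the last rows of `Y` and `X` would give `x u`-entry zero, hence
  -- `u`-entry zero as `x ≠ 0`, and so `v = 0`.
  · have hl : v 7 ≠ 0 := by
      intro hl
      have hu : v 6 = 0 := by
        rw [h6, hl, mul_zero] at hy
        exact (mul_eq_zero.1 hy).resolve_left hx
      refine hv (funext fun i => ?_)
      fin_cases i <;> simp [h2, h3, h4, h5, h6, h7, hl, hu]
    obtain ⟨u, hu⟩ : ∃ u, v 6 = u * v 7 := ⟨v 6 / v 7, by field_simp⟩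
    have hyx : y = x * u := by
      refine mul_right_cancel₀ hl ?_
      rw [← hy, h6, hu]
      ring
    have hws : w = p 7 * u := by
      refine mul_right_cancel₀ hl ?_
      rw [← hw, hu]
      ring
    have e5 : v 5 = x * v 7 := by rw [h7]
    have e4 : v 4 = u * x * v 7 := by rw [h6, hu]; ring
    have e3 : v 3 = x ^ 2 * v 7 := by rw [h5, e5]; ring
    have e2 : v 2 = u * x ^ 2 * v 7 := by rw [h4, e4]; ring
    have e1 : v 1 = x ^ 3 * v 7 := by rw [h3, e3]; ring
    have e0 : v 0 = u * x ^ 3 * v 7 := by rw [h2, e2]; ring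
    simp only [e1, e2, e3, e4, e5, hu] at hyu hwu
    subst hyx hws
    have h1 : 3 * x * u ^ 2 + 2 * p 7 * u + (p 4 + p 2 * x + p 0 * x ^ 2) = 0 := by
      refine (mul_eq_zero.1 (?_ : _ * v 7 = 0)).resolve_right hl
      linear_combination -hyu
    have h2 : p 7 * u ^ 2 - 3 * (p 5 + 2 * p 3 * x + 3 * p 1 * x ^ 2 +
        4 * 1 * x ^ 3) - u * (p 4 + 4 * p 2 * x + 7 * p 0 * x ^ 2) = 0 := by
      refine (mul_eq_zero.1 (?_ : _ * v 7 = 0)).resolve_right hl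
      linear_combination -hwu
    refine ⟨x, u, hx, h1, h2, ?_⟩
    linear_combination
      hg / 940369969152 + (1/3 * u * x + 5/36 * p 7) * h1 + (-1/12 * x) * h2

/-- The discriminant of the family of type `E8(1)`. -/
def discriminant : MvPolynomial (Fin 8) ℂ :=
  MvPolynomial.X 6 *
    (HMat.toMatrix 8 (slots (MvPolynomial.X : Fin 8 → MvPolynomial (Fin 8) ℂ) 0)
      valueMatrix).det

lemma eval_discriminant (p : Fin 8 → ℂ) : MvPolynomial.eval p discriminant =
    p 6 * (HMat.toMatrix 8 (slots p 0) valueMatrix).det := by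
  rw [discriminant, map_mul, MvPolynomial.eval_X, RingHom.map_det, RingHom.mapMatrix_apply,
    HMat.map_toMatrix]
  simp only [map_slots, MvPolynomial.eval_X, map_zero]

/-- The specialization is `t9 = 12`, `s5 = -3`, with `t1`, `t3`, `t4`, `t6` and `t7` zero. -/
lemma squarefree_discriminant : Squarefree discriminant :=
  HMat.squarefree_X_mul_det 6 (by norm_num) isFree_nilpotent
    (p := [0, 0, 0, 0, 0, 12, 0, -3]) (by norm_num)
    (K := [
      [const
      10631067566513038380765659423297681205521258025828007136506201284037223558992403268419867262901345138628571955200,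
      const
      2092214924137489410040983028513813560914810829111334457371067011709328778046751289111446395289600000,
      const
      854924884996946506097914930230273898831594068444089060450511027187073462659014218219520,
      const 4524038170238335320175337974181655267110763910951667198767420182154444800, const
      3353278507509350064720141351267316787547260110690258929057792, const
      (-470092065903088523142157412465300264262429573120), const
      (-5701906793680825732239618441216000), const (-2476426869367830336852)],
      [const
      (-48885146108283778805853198304732269695334178128609939161414491309484902971677624903335533252773743120141516800000),
      const
      (-3718489176400694466906485748849967387477443479170697179003838878635713623386399154313702657753088000),
      const
      137365560169323512403650556581604950002666933581569994537202455790998632606591877120000,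
      const (-12178600211135618145982339184506491995782196212957175386597687384483037184), const
      3515400993618754495353969612338214008366582796678730874880000, const
      (-75532319970032148428143565511237330240798720000), const
      5495400166903771616472524765921280, const (-808705928970116796375)],
      [const
      (-24962673544035896625141983381937593809587971564063719791343557169691197286890069816181825240891463665555865600000),
      const
      (-6102939894507947922345631063894059881003718437160827050484731696390324457089217411844043178067886080),
      const
      18938272612402236919623152700151296346573364412912970016375478615465012154966474752000,
      const (-18427591518767521611491555045950648409890924065545294597955609329670291456), const
      4007782389745437832519559430256046237977722992797150378721280, const
      (-10413466555055121907216700050348864922714112000), const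
      17680125135934794744578150359105536, const (-358509935061145156050)],
      [const
      35467698875892151870500198290499024523578393657883044911262771074142710109012175460595111776837517879021246873600,
      const
      (-3224878845025635692062762895107756888432956351297809217252579954609791112296037468020738831155200000),
      const
      562305302413738365952202038794486110752032045268886317131382479465297221516435424018432,
      const (-30416948655714330716462901441458708308534953797689939697500090619500953600), const
      2931713263451287559430507127243081912053231139889872896000000, const
      (-173933738063882984359133927056853503590122127360), const
      6001514983872677630361630523392000, const (-637000365949234034375)],
      [const
      61634760260373159901927549146199825429632103566664432880358751415738494068548761688430038171600658140904397209600,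
      const
      (-3738954600823536208542703350721758295025186166130113713830288985722227544695979023374161752883200000),
      const
      493064705091744218073190094990089746780643003777969591179179193740017977759874896887808,
      const (-47984618574099340764087478603233179402150585606421238462945892345944473600), const
      3324083322201898442889374155516317437047714498091365171200000, const
      (-271118328531638178275250198973871122995109429248), const
      7749726878246502169943976738816000, const (-697319587058556375000)],
      [const
      10480426249751324153912895738447953065200446827499304459999108785066013461444574569801536086507492320949043200000,
      const
      (-2678412918090409600705553747108766488883390317239186384560551360727264993447864805294215152151822336),
      const
      (-75167882573392401187677181810603288200198679882473789952819802228537089789551181824000),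
      const (-12585948219753901679207817269210585931080210827775420606269049379225600000), const
      (-178613454654525356033026628554612286639934337340035521576960), const
      41332081716878562085644101722849917894918144000, const 3751798133869095188988217958400000,
      const 278586516404793046725],
      [const
      37729534499104766954086424658412631034721608578997496055996791626237648461200468451285529911426972355416555520000,
      const
      (-2147658683954409875386103237497387618658815868722328749069271716692418904497021999561966462628265984),
      const
      (-270604377264212644275637854518171837520715247576905643830151288022733523242384254566400),
      const (-45309413591114046045148142169158109351888758979991514182568577765212160000), const
      (-643008436756291281718895862796604231903763614424127877677056), const
      148795494180762823508318766202259704421705318400, const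
      13506473281928742680357584650240000, const 1002911459057254968210],
      [const
      17619307332500887680934750767596474459463462386718341829753372347125998133829767452163208900282038798180813897728,
      const 0, const 0, const 0, const 0, const 0, const 0, const 0]])
    (d := 17619307332500887680934750767596474459463462386718341829753372347125998133829767452163208900282038798180813897728)
    (q := 

      [557371326051082294617010961957745609936431086146181585907201289986239393628034421730051137350070161113088,
      -28798181898149474073560499152658818972191227332233283994527189421290625392101511663714304000,
      3307425531469108962114494477487667716469290034269334037186801829745579278729216,
      -788940955616611240529336398361377512450061777169487557938410160128,
      15835071665743319426540571736702971652474115457024000,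
      -3637265748591438272894128202054413320192, 265288703664880029479731200, 0, 1])
    (a := 

      [34729910886837283095121604407501040858167793171324432555635578498105620186606580707314764832685976199685212627142512214016,
      18116667884989286354489835680408155491285312663678720399064072413248127265756024990215183537214423503470592000,
      -5254058402336916727852602150550971435478246130534175319978430888915610543919757589526746218102784,
      9188762339031653328537735337625055525821813417149087988133246049261402254905180160,
      -18950784160318309608886670356054113517762064132664445648636917841920000,
      -867762604215874189536367988167575349282493737430276112384,
      69607596945026414256601711476999835942533800])
    (b := 

      [-1282103429931385767378028132360155645687032553078230336222772711140889604934427590171653592064285142074516628222954396854591915294720000,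
      21412104332153506846074188837973839621860404966286019439105342894643057480945193335093860601021905046592751097393025384448,
      -5527168550477176931093258415568827205430213679562907715335026524200874528436986828319590669665272841895936000,
      711840400733645329570992914710973986149608731024924663816037359978198905554818687994487103291392,
      17913267478750528968249906245887391873876967132381864309180316041784284015577006080,
      1791782108828116174620302952207929317229585983487948863142268764160000,
      108470325526984273692045998520946918660311717178784514048,
      -8700949618128301782075213934624979492816725])
    (N := 56279704272037802175467772241627499162584487350156975364377684036330105422718901378342547458857878284789240839760798632982638284527813125213355616030924715343259673683739052299914295526655056443596565316766268257379672714641408)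
    (by decide +kernel) (by decide +kernel)

lemma isFamilyDiscriminant : IsFamilyDiscriminant surfaceE8 discriminant := by
  refine ⟨squarefree_discriminant, fun p => ?_⟩
  rw [eval_discriminant]
  by_cases hp : p 6 = 0
  · simp only [hp, zero_mul, true_iff]
    refine ⟨0, (isSingularPoint_iff (p 6) (p 5) (p 3) (p 1) (1)
      (p 4) (p 2) (p 0) (p 7) _ (fun a => by rw [surfaceE8, fE8]; ring) 0).2 ?_⟩
    simp [hp]
  · rw [mul_eq_zero_iff_left hp]
    exact ⟨isSingularPoint_of_det_eq_zero hp, det_eq_zero_of_isSingularPoint hp⟩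

/-- The factors relating the coordinates and the rescaled coordinates. -/
def scale (c : ℂ) (i : Fin 8) : ℂ :=
  ([2, 1, 1, 1, 1, 1, 1, 1] : List ℂ).getD i 0 *
    ((3 / 32) * c ^ 7) ^ coordWeight.getD i 0

/-- Here `μ = 3 c ^ 7 / 32`, so the exponent of `c` is seven times the weight modulo `12`; the extra
factor `2` in `scale` belongs to `x1`. -/
lemma coord_eq {c : ℂ} (hc : c ^ 12 = -16 / 243) (p : Fin 8 → ℂ) :
    coordE8 c p = fun i => scale c i * polyMap 8 inverse p i := by
  funext i
  fin_cases i
  · simp [coordE8, transformE8, scale, polyMap, listSubst, inverse, coordWeight, slots]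
    ring
  · have hk : (c ^ 7) ^ 3 = (-16 / 243) ^ 1 * c ^ 9 := by
      rw [show (c ^ 7) ^ 3 = (c ^ 12) ^ 1 * c ^ 9 by ring, hc]
    simp [coordE8, transformE8, scale, polyMap, listSubst, inverse, coordWeight, slots,
      mul_pow, hk]
    ring
  · have hk : (c ^ 7) ^ 4 = (-16 / 243) ^ 2 * c ^ 4 := by
      rw [show (c ^ 7) ^ 4 = (c ^ 12) ^ 2 * c ^ 4 by ring, hc]
    simp [coordE8, transformE8, scale, polyMap, listSubst, inverse, coordWeight, slots,
      mul_pow, hk]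
    ring
  · have hk : (c ^ 7) ^ 6 = (-16 / 243) ^ 3 * c ^ 6 := by
      rw [show (c ^ 7) ^ 6 = (c ^ 12) ^ 3 * c ^ 6 by ring, hc]
    simp [coordE8, transformE8, scale, polyMap, listSubst, inverse, coordWeight, slots,
      mul_pow, hk]
    ring
  · have hk : (c ^ 7) ^ 7 = (-16 / 243) ^ 4 * c ^ 1 := by
      rw [show (c ^ 7) ^ 7 = (c ^ 12) ^ 4 * c ^ 1 by ring, hc]
    simp [coordE8, transformE8, scale, polyMap, listSubst, inverse, coordWeight, slots,
      mul_pow, hk]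
    ring
  · have hk : (c ^ 7) ^ 9 = (-16 / 243) ^ 5 * c ^ 3 := by
      rw [show (c ^ 7) ^ 9 = (c ^ 12) ^ 5 * c ^ 3 by ring, hc]
    simp [coordE8, transformE8, scale, polyMap, listSubst, inverse, coordWeight, slots,
      mul_pow, hk]
    ring
  · have hk : (c ^ 7) ^ 5 = (-16 / 243) ^ 2 * c ^ 11 := by
      rw [show (c ^ 7) ^ 5 = (c ^ 12) ^ 2 * c ^ 11 by ring, hc]
    simp [coordE8, transformE8, scale, polyMap, listSubst, inverse, coordWeight, slots,
      mul_pow, hk]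
    ring
  · have hk : (c ^ 7) ^ 12 = (-16 / 243) ^ 7 * c ^ 0 := by
      rw [show (c ^ 7) ^ 12 = (c ^ 12) ^ 7 * c ^ 0 by ring, hc]
    simp [coordE8, transformE8, scale, polyMap, listSubst, inverse, coordWeight, slots,
      mul_pow, hk]
    ring

lemma ne_zero {c : ℂ} (hc : c ^ 12 = -16 / 243) : c ≠ 0 := by
  rintro rfl
  norm_num at hc

lemma bijective_coord {c : ℂ} (hc : c ^ 12 = -16 / 243) : Function.Bijective (coordE8 c) := by
  have h0 := ne_zero hc
  rw [show coordE8 c = fun p i => scale c i * polyMap 8 inverse p i from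
    funext fun p => coord_eq hc p]
  refine bijective_polyMap (l := 72) (by norm_num) (by decide +kernel) (by decide +kernel)
    isInverse_inverse isInverse_parameter fun i => ?_
  refine mul_ne_zero ?_ (pow_ne_zero _ (mul_ne_zero (by norm_num) (pow_ne_zero _ h0)))
  fin_cases i <;> simp

/-- The coordinates `x` and the function `z` at the image of the parameters. -/
lemma slots_coord {c : ℂ} (hc : c ^ 12 = -16 / 243) (p : Fin 8 → ℂ) :
    slots (Function.update (coordE8 c p) 6 (coordE8 c p 6 ^ 2 +
      vE8 (coordE8 c p 0) (coordE8 c p 1) (coordE8 c p 2) (coordE8 c p 3)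
        (coordE8 c p 4) (coordE8 c p 5)))
      (coordE8 c p 6) = fun i => (listSubst coordinate i).eval (slots (fun i : Fin 8 =>
        ((3 / 32) * c ^ 7) ^ coordWeight.getD i 0 *
          polyMap 8 inverse p i) 0) 0 := by
  simp only [coord_eq hc, scale]
  generalize (3 / 32) * c ^ 7 = μ
  generalize polyMap 8 inverse p = a
  funext i
  rcases lt_or_ge i 9 with hi | hi
  -- The doubled first variable in `coordinate` matches the factor `2` in `scale`, both in `x1` and
  -- inside `v`.
  · interval_cases i <;>
      simp [slots, coordinate, listSubst, coordWeight, vE8] <;> ring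
  · simp [slots, coordinate, listSubst, show ¬ i < 8 by omega, show i ≠ 8 by omega, hi]

lemma exists_eval_discriminant {c : ℂ} (hc : c ^ 12 = -16 / 243) : ∃ k : ℂ, k ≠ 0 ∧
    ∀ p : Fin 8 → ℂ, p 6 * MvPolynomial.eval (coordE8 c p) potentialData.discriminant =
      k * MvPolynomial.eval p discriminant := by
  have hμ : ((3 / 32) * c ^ 7 : ℂ) ≠ 0 :=
    mul_ne_zero (by norm_num) (pow_ne_zero _ (ne_zero hc))
  -- The scaling contributes `(72 μ) ^ (12 n)` with `n = 8`.
  refine ⟨((285558873600 : ℂ)⁻¹ * (12 : ℂ)⁻¹) ^ 8 * ((((-2448880128) : ℤ) : ℂ) ^ 8)⁻¹ *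
    (((185910725 : ℤ) : ℂ) ^ 8 *
      ((3 / 32) * c ^ 7 * (72 : ℤ)) ^ (12 * 8)), ?_, fun p => ?_⟩
  · refine mul_ne_zero (by norm_num) (mul_ne_zero (by norm_num)
      (pow_ne_zero _ (mul_ne_zero hμ (by norm_num))))
  · have key := HMat.det_eq_of_coordinates eq_transition (by decide +kernel) (by decide +kernel)
      isTriangular_transition (by decide +kernel) (by decide +kernel) (by decide +kernel)
      isInverse_parameter (by norm_num) isHomogeneousMap_parameter isHomogeneous_valueMatrix hμ p
    rw [← slots_coord hc p] at key
    rw [potentialData.eval_discriminant, eval_discriminant]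
    change p 6 * ((((285558873600 : ℤ) : ℂ)⁻¹ * ((12 : ℤ) : ℂ)⁻¹) ^ 8 *
      (HMat.toMatrix 8 _ matrixT).det) = _
    have hK : ((((-2448880128) : ℤ) : ℂ) ^ 8) ≠ 0 := by norm_num
    rw [← eq_inv_mul_iff_mul_eq₀ hK] at key
    rw [key]
    push_cast
    ring

end E8

end

/-! ### The three types together. -/

theorem mainTheorem4 :
    ((∀ a, surfaceE6 0 a = a 2 ^ 2 - (a 1 ^ 3 + a 0 ^ 4)) ∧
      ∃ Δ D : MvPolynomial (Fin 6) ℂ,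
        IsPotentialDiscriminantE6 Δ ∧ IsFamilyDiscriminant surfaceE6 D ∧
        ∀ c : ℂ, c ^ 9 = 4 / 2187 →
          Function.Bijective (coordE6 c) ∧
          ∃ k : ℂ, k ≠ 0 ∧ ∀ p : Fin 6 → ℂ, p 4 * eval (coordE6 c p) Δ = k * eval p D) ∧
    ((∀ a, surfaceE7 0 a = a 2 ^ 2 - (a 1 ^ 3 + a 0 ^ 3 * a 1)) ∧
      ∃ Δ D : MvPolynomial (Fin 7) ℂ,
        IsPotentialDiscriminantE7 Δ ∧ IsFamilyDiscriminant surfaceE7 D ∧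
        ∀ c : ℂ, c ^ 7 = 1 / 14112 →
          Function.Bijective (coordE7 c) ∧
          ∃ k : ℂ, k ≠ 0 ∧ ∀ p : Fin 7 → ℂ, p 5 * eval (coordE7 c p) Δ = k * eval p D) ∧
    ((∀ a, surfaceE8 0 a = a 2 ^ 2 - (a 1 ^ 3 + a 0 ^ 5)) ∧
      ∃ Δ D : MvPolynomial (Fin 8) ℂ,
        IsPotentialDiscriminantE8 Δ ∧ IsFamilyDiscriminant surfaceE8 D ∧
        ∀ c : ℂ, c ^ 12 = -16 / 243 →
          Function.Bijective (coordE8 c) ∧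
          ∃ k : ℂ, k ≠ 0 ∧ ∀ p : Fin 8 → ℂ, p 6 * eval (coordE8 c p) Δ = k * eval p D) := by
  -- The polynomials `Δ` and `D` are fixed before `c`; only the coordinate transformation and the
  -- factor `k` depend on it.
  refine ⟨⟨fun a => by simp [surfaceE6, fE6], E6.potentialData.discriminant, E6.discriminant,
      E6.potentialData.isPotentialDiscriminant, E6.isFamilyDiscriminant,
      fun c hc => ⟨E6.bijective_coord hc, E6.exists_eval_discriminant hc⟩⟩,
    ⟨fun a => by simp [surfaceE7, fE7, mul_comm], E7.potentialData.discriminant, E7.discriminant,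
      E7.potentialData.isPotentialDiscriminant, E7.isFamilyDiscriminant,
      fun c hc => ⟨E7.bijective_coord hc, E7.exists_eval_discriminant hc⟩⟩,
    ⟨fun a => by simp [surfaceE8, fE8], E8.potentialData.discriminant, E8.discriminant,
      E8.potentialData.isPotentialDiscriminant, E8.isFamilyDiscriminant,
      fun c hc => ⟨E8.bijective_coord hc, E8.exists_eval_discriminant hc⟩⟩⟩
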